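/- Let $n>1$, let $M$ be a closed smooth manifold of dimension $2n+1$, and let $\xi$ be a (co-oriented) contact structure on $M$. For such a $\xi$ let $c_k(\xi)\in H^{2k}(M;\mathbb Z)$ denote the $k$-th Chern class of the complex vector bundle $(\xi,J)$, where $J$ is any complex structure on $\xi$ compatible with $d\alpha|_\xi$ for a contact form $\alpha$ defining $\xi$; it does not depend on the choices of $\alpha$ and $J$. Let $B$ be a smooth manifold (without boundary) of dimension $n-1$, and let $\psi\colon B\times S^1\to M$ be an embedded isotropically parameterized family of transverse curves in $(M,\xi)$, that is, a smooth embedding such that $\psi(\{p\}\times S^1)$ is transverse to $\xi$ for every $p\in B$ and $\psi(B\times\{\phi\})$ is tangent to $\xi$ for every $\phi\in S^1$. (a) Let $U\subset M$ be an open tubular neighborhood of $\psi(B\times S^1)$, i.e. the image of a smooth vector bundle over $B\times S^1$ under a diffeomorphism onto an open subset of $M$ that restricts to $\psi$ on the zero section. Let $\xi'$ be a (co-oriented) contact structure on $M$ obtained from $\xi$ by altering it inside $U$, i.e. the closure of the set of points at which $\xi$ and $\xi'$ differ as co-oriented hyperplane fields is contained in $U$. Then $$c_k(\xi)=c_k(\xi')\in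 H^{2k}(M;\mathbb Z)\qquad\text{for all integers } 0\le k<\frac{n+1}{2}.$$ (b) In particular, if $\xi'$ is the result of a generalized Lutz twist of $\xi$ along $\psi(B\times S^1)$, then $c_1(\xi)=c_1(\xi')$. Here a generalized Lutz twist is the following modification. Let $T^*B\times S^1\times\mathbb C$ be identified with an open subset of $M$ by a diffeomorphism that extends $\psi$ (the embedding of $B$ in $T^*B$ being the zero section), in such a way that on $N\times S^1\times D_b$, where $N$ is a neighborhood of the zero section of $T^*B$ and $D_b$ is the closed disk of radius $b>0$, the structure $\xi$ is $\ker(\lambda_{can}+d\phi+r^2\,d\theta)$. Then $\xi'$ is a contact structure that agrees with $\xi$ outside $N\times S^1\times D_b$ and near the boundary of this set (precisely: the closure of the set where they differ lies in $\operatorname{int}N\times S^1\times\operatorname{int}D_b$), and that on $N'\times S^1\times D_b$, for some smaller neighborhood $N'\subset N$ of the zero section, is $\ker(\lambda_{can}+k(r)\,d\phi+l(r)\,d\theta)$. Here $k,l$ are smooth functions with $kl'-k'l>0$ on $(0,b]$, $(k,l)=(1,r^2)$ for $r$ near $0$ and near $b$, and the curve $(k(r),l(r))$, $0\le r\le b$,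 makes one additional full positive turn around the origin compared with $(1,r^2)$. As usual, $\lambda_{can}$ is the canonical $1$-form of $T^*B$, $\phi$ is the angular coordinate on $S^1$ and $(r,\theta)$ are polar coordinates on $\mathbb C$. -/

import Mathlib

open Set Topology Bundle Manifold
open scoped ContDiff

noncomputable section

namespace ContactChern

/-! ### Integral singular cohomology -/

/-- The standard `m`-simplex. -/
abbrev Simplex (m : ℕ) : Type := stdSimplex ℝ (Fin (m + 1))

/-- The affine map of standard simplices given by a map of vertices. -/
def simplexMap {p q : ℕ} (f : Fin (p + 1) → Fin (q + 1)) : C(Simplex p, Simplex q) :=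
  ⟨stdSimplex.map f, stdSimplex.continuous_map f⟩

/-- Integral singular `m`-cochains of `X`: arbitrary functions on the singular `m`-simplices. -/
abbrev Cochain (X : Type*) [TopologicalSpace X] (m : ℕ) := C(Simplex m, X) → ℤ

/-- The coboundary `(d f)(σ) = ∑ᵢ (-1)ⁱ f(∂ᵢ σ)`. -/
def coboundary (X : Type*) [TopologicalSpace X] (m : ℕ) : Cochain X m →+ Cochain X (m + 1) where
  toFun f σ := ∑ i : Fin (m + 2), (-1 : ℤ) ^ (i : ℕ) * f (σ.comp (simplexMap i.succAbove))
  map_zero' := by ext σ; simp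
  map_add' f g := by ext σ; simp [mul_add, Finset.sum_add_distrib]

/-- The group of `m`-cocycles. -/
def cocycles (X : Type*) [TopologicalSpace X] (m : ℕ) : AddSubgroup (Cochain X m) :=
  (coboundary X m).ker

/-- The group of `m`-coboundaries. -/
def coboundaries (X : Type*) [TopologicalSpace X] : (m : ℕ) → AddSubgroup (Cochain X m)
  | 0 => ⊥
  | m + 1 => (coboundary X m).range

/-- Singular cohomology `Hᵐ(X; ℤ)`: cocycles modulo coboundaries. -/
abbrev Cohomology (X : Type*) [TopologicalSpace X] (m : ℕ) :=
  cocycles X m ⧸ (coboundaries X m).addSubgroupOf (cocycles X m)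

/-- The cochain `a` is a cocycle and represents the cohomology class `x`. -/
def Represents {X : Type*} [TopologicalSpace X] {m : ℕ} (a : Cochain X m)
    (x : Cohomology X m) : Prop :=
  ∃ h : a ∈ cocycles X m, (QuotientAddGroup.mk ⟨a, h⟩ : Cohomology X m) = x

section Pullback

variable {X Y : Type*} [TopologicalSpace X] [TopologicalSpace Y]

/-- Pull-back of cochains along a continuous map. -/
def cochainPullback (g : C(X, Y)) (m : ℕ) : Cochain Y m →+ Cochain X m where
  toFun f σ := f (g.comp σ)
  map_zero' := rfl
  map_add' _ _ := rfl

theorem coboundary_cochainPullback (g : C(X, Y)) (m : ℕ) (f : Cochain Y m) :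
    coboundary X m (cochainPullback g m f) = cochainPullback g (m + 1) (coboundary Y m f) := rfl

theorem cochainPullback_mem_cocycles (g : C(X, Y)) (m : ℕ) {f : Cochain Y m}
    (hf : f ∈ cocycles Y m) : cochainPullback g m f ∈ cocycles X m := by
  have hf' : coboundary Y m f = 0 := hf
  change coboundary X m (cochainPullback g m f) = 0
  rw [coboundary_cochainPullback, hf', map_zero]

theorem cochainPullback_mem_coboundaries (g : C(X, Y)) (m : ℕ) {f : Cochain Y m}
    (hf : f ∈ coboundaries Y m) : cochainPullback g m f ∈ coboundaries X m := by
  cases m with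
  | zero =>
    have hf' : f = 0 := hf
    rw [hf', map_zero]
    exact zero_mem _
  | succ m =>
    obtain ⟨e, rfl⟩ := hf
    exact ⟨cochainPullback g m e, coboundary_cochainPullback g m e⟩

/-- Pull-back of cocycles. -/
def cocyclePullback (g : C(X, Y)) (m : ℕ) : cocycles Y m →+ cocycles X m where
  toFun f := ⟨cochainPullback g m f, cochainPullback_mem_cocycles g m f.2⟩
  map_zero' := rfl
  map_add' _ _ := rfl

/-- The homomorphism `g* : Hᵐ(Y; ℤ) → Hᵐ(X; ℤ)`. -/
def pullback (g : C(X, Y)) (m : ℕ) : Cohomology Y m →+ Cohomology X m :=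
  QuotientAddGroup.map _ _ (cocyclePullback g m)
    (fun f hf => cochainPullback_mem_coboundaries g m (f := (f : Cochain Y m)) hf)

end Pullback

/-- The (Alexander–Whitney) cup product of cochains,
`(a ⌣ b)(σ) = a(σ|[0,…,p]) b(σ|[p,…,p+q])`, with `r = p + q`. -/
def cup {X : Type*} [TopologicalSpace X] {p q r : ℕ} (h : p + q = r)
    (a : Cochain X p) (b : Cochain X q) : Cochain X r := fun σ =>
  a (σ.comp (simplexMap fun i => ⟨i, by omega⟩)) *
    b (σ.comp (simplexMap fun i => ⟨p + i, by omega⟩))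

/-! ### The classifying space `BU(n)` and the universal Chern classes -/

/-- The Hilbert space `ℓ²(ℕ; ℂ)`. -/
abbrev Hil : Type := lp (fun _ : ℕ => ℂ) 2

/-- The Grassmannian of `n`-dimensional complex subspaces of `ℓ²`, a subspace being identified with
the orthogonal projection onto it; it carries the operator norm topology and is a model of `BU(n)`,
the tautological bundle having fibre `range P` at `P`. -/
def Gr (n : ℕ) : Type :=
  {P : Hil →L[ℂ] Hil // IsStarProjection P ∧ FiniteDimensional ℂ P.range ∧
    Module.finrank ℂ P.range = n}

instance (n : ℕ) : TopologicalSpace (Gr n) :=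
  inferInstanceAs (TopologicalSpace {P : Hil →L[ℂ] Hil // IsStarProjection P ∧
    FiniteDimensional ℂ P.range ∧ Module.finrank ℂ P.range = n})

/-- The orthogonal projection onto the line spanned by a nonzero vector, as a point of `Gr 1`. -/
def lineOf (v : Hil) (hv : v ≠ 0) : Gr 1 :=
  ⟨(ℂ ∙ v).starProjection, isStarProjection_starProjection, by
    rw [Submodule.range_starProjection]
    exact ⟨inferInstance, finrank_span_singleton hv⟩⟩

/-- The vector `(t₁ - 1/3 + i (t₂ - 1/3)) e₀ + t₀ t₁ t₂ e₁`. -/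
def bubbleVector (t : Simplex 2) : Hil :=
  lp.single 2 0 (((t 1 - 1 / 3 : ℝ) : ℂ) + ((t 2 - 1 / 3 : ℝ) : ℂ) * Complex.I) +
    lp.single 2 1 ((t 0 * t 1 * t 2 : ℝ) : ℂ)

theorem bubbleVector_ne_zero (t : Simplex 2) : bubbleVector t ≠ 0 := by
  intro h
  have h0 : ((t 1 - 1 / 3 : ℝ) : ℂ) + ((t 2 - 1 / 3 : ℝ) : ℂ) * Complex.I = 0 := by
    have := congrArg (fun f : Hil => f 0) h
    simpa [bubbleVector, lp.single_apply] using this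
  have h1 : ((t 0 * t 1 * t 2 : ℝ) : ℂ) = 0 := by
    have := congrArg (fun f : Hil => f 1) h
    simpa [bubbleVector, lp.single_apply] using this
  have hre := congrArg Complex.re h0
  have him := congrArg Complex.im h0
  simp only [Complex.add_re, Complex.add_im, Complex.mul_re, Complex.mul_im, Complex.ofReal_re,
    Complex.ofReal_im, Complex.I_re, Complex.I_im, Complex.zero_re, Complex.zero_im] at hre him
  have hsum : t 0 + t 1 + t 2 = 1 := by
    have := stdSimplex.sum_eq_one t
    rwa [Fin.sum_univ_three] at this
  have e1 : t 1 = 1 / 3 := by linarith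
  have e2 : t 2 = 1 / 3 := by linarith
  have e0 : t 0 = 1 / 3 := by linarith
  have h2 : t 0 * t 1 * t 2 = 0 := by exact_mod_cast h1
  rw [e0, e1, e2] at h2
  norm_num at h2

theorem continuous_bubbleVector : Continuous bubbleVector := by
  have hc : ∀ i : Fin 3, Continuous fun t : Simplex 2 => t i := fun i =>
    (continuous_apply i).comp continuous_subtype_val
  have hs : ∀ i : ℕ, Continuous fun z : ℂ => (lp.single 2 i z : Hil) := fun i =>
    (lp.isometry_single (E := fun _ : ℕ => ℂ) (p := 2) i).continuous
  have h0 := hc 0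
  have h1 := hc 1
  have h2 := hc 2
  refine ((hs 0).comp ?_).add ((hs 1).comp ?_)
  · exact ((Complex.continuous_ofReal.comp (h1.sub continuous_const))).add
      ((Complex.continuous_ofReal.comp (h2.sub continuous_const)).mul continuous_const)
  · exact Complex.continuous_ofReal.comp ((h0.mul h1).mul h2)

theorem continuous_lineOf_bubbleVector :
    Continuous fun t => lineOf (bubbleVector t) (bubbleVector_ne_zero t) := by
  refine Continuous.subtype_mk ?_ _
  have key : ∀ v : Hil, (ℂ ∙ v).starProjection =
      (((‖v‖ : ℂ) ^ 2)⁻¹) • ContinuousLinearMap.smulRightL ℂ Hil Hil (innerSL ℂ v) v := by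
    intro v
    ext1 w
    rw [Submodule.starProjection_singleton]
    simp [smul_smul, div_eq_inv_mul]
  simp_rw [key]
  have hv := continuous_bubbleVector
  have hi : Continuous fun t => ((‖bubbleVector t‖ : ℂ) ^ 2)⁻¹ := by
    refine Continuous.inv₀ ((Complex.continuous_ofReal.comp hv.norm).pow 2) fun t => ?_
    have := bubbleVector_ne_zero t
    simpa using this
  exact hi.smul (((ContinuousLinearMap.smulRightL ℂ Hil Hil).continuous.comp
      ((innerSL ℂ).continuous.comp hv)).clm_apply hv)

/-- The singular `2`-simplex `t ↦ ℂ · bubbleVector t`. It collapses the boundary of the simplex to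
the point `ℂ e₀` of `ℂP¹ = ℙ(ℂ e₀ + ℂ e₁)` and maps the interior homeomorphically, and preserving
the orientation, to the complement; so this simplex minus a constant one is a cycle that represents
the fundamental class of `ℂP¹`. -/
def bubble : C(Simplex 2, Gr 1) :=
  ⟨fun t => lineOf (bubbleVector t) (bubbleVector_ne_zero t), continuous_lineOf_bubbleVector⟩

/-- The Whitney sum formula and the normalization that characterize the universal Chern classes
`u n k ∈ H²ᵏ(BU(n); ℤ)`. -/
structure IsUniversalChernFamily (u : ∀ n k : ℕ, Cohomology (Gr n) (2 * k)) : Prop where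
  /-- `c₀ = 1` -/
  unit : ∀ n, Represents (fun _ => 1) (u n 0)
  /-- `cₖ = 0` above the rank -/
  vanish : ∀ n k, n < k → u n k = 0
  /-- `cₖ(E ⊕ F) = ∑_{i + j = k} cᵢ(E) ⌣ cⱼ(F)`, where `E`, `F` are the tautological bundles pulled
  back by two maps `P`, `Q` with orthogonal values, and `E ⊕ F` is pulled back by `P + Q`. -/
  whitney : ∀ (n m k : ℕ) (X : Type) [TopologicalSpace X]
    (P : C(X, Gr n)) (Q : C(X, Gr m)) (R : C(X, Gr (n + m))),
    (∀ x, (P x).1 * (Q x).1 = 0) → (∀ x, (R x).1 = (P x).1 + (Q x).1) →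
    ∀ (a : ∀ i, Cochain (Gr n) (2 * i)) (b : ∀ j, Cochain (Gr m) (2 * j))
      (c : Cochain (Gr (n + m)) (2 * k)),
      (∀ i, Represents (a i) (u n i)) → (∀ j, Represents (b j) (u m j)) →
      Represents c (u (n + m) k) →
      cochainPullback R (2 * k) c -
          ∑ i : Fin (k + 1),
            cup (p := 2 * (i : ℕ)) (q := 2 * (k - i)) (r := 2 * k) (by omega)
              (cochainPullback P _ (a i)) (cochainPullback Q _ (b (k - i)))
        ∈ coboundaries X (2 * k)
  /-- `⟨c₁(γ), [ℂP¹]⟩ = -1` for the tautological line bundle `γ`. -/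
  normalization : ∀ a : Cochain (Gr 1) 2, Represents a (u 1 1) →
    a bubble - a (ContinuousMap.const _ (bubble (stdSimplex.vertex 0))) = -1

open Classical in
/-- The universal Chern class `cₖ ∈ H²ᵏ(BU(n); ℤ)`: the one given by the unique family of classes
that satisfies the Whitney sum formula and the normalization. -/
def universalChern (n k : ℕ) : Cohomology (Gr n) (2 * k) :=
  if h : ∃ u, IsUniversalChernFamily u then h.choose n k else 0

/-! ### Contact structures -/

/-- The model space `ℝᵈ`. -/
abbrev Euc (d : ℕ) : Type := EuclideanSpace ℝ (Fin d)

section Contact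

variable {n : ℕ} {M : Type*} [TopologicalSpace M] [ChartedSpace (Euc (2 * n + 1)) M]
  [IsManifold (𝓡 (2 * n + 1)) ∞ M]

/-- A (not necessarily continuous) `1`-form on a `(2n+1)`-manifold. -/
abbrev OneForm (n : ℕ) (M : Type*) [TopologicalSpace M] [ChartedSpace (Euc (2 * n + 1)) M] :=
  ∀ x : M, TangentSpace (𝓡 (2 * n + 1)) x →L[ℝ] Bundle.Trivial M ℝ x

/-- Smoothness of a `1`-form, as a section of the cotangent bundle. -/
def OneForm.IsSmooth (α : OneForm n M) : Prop :=
  ContMDiff (𝓡 (2 * n + 1)) ((𝓡 (2 * n + 1)).prod 𝓘(ℝ, Euc (2 * n + 1) →L[ℝ] ℝ)) ∞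
    fun x => (TotalSpace.mk' (Euc (2 * n + 1) →L[ℝ] ℝ) x (α x) :
      TotalSpace (Euc (2 * n + 1) →L[ℝ] ℝ)
        (fun x : M => TangentSpace (𝓡 (2 * n + 1)) x →L[ℝ] Bundle.Trivial M ℝ x))

/-- The expression of a `1`-form in the preferred chart at `x₀`: the pull-back of the form under the
inverse of the chart. -/
def OneForm.inChart (α : OneForm n M) (x₀ : M) (y : Euc (2 * n + 1)) : Euc (2 * n + 1) →L[ℝ] ℝ :=
  (α ((extChartAt (𝓡 (2 * n + 1)) x₀).symm y)).comp
    (mfderiv 𝓘(ℝ, Euc (2 * n + 1)) (𝓡 (2 * n + 1)) (extChartAt (𝓡 (2 * n + 1)) x₀).symm y)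

/-- The exterior derivative `dα` at `x`, computed in the preferred chart at `x` (the one that
identifies the tangent space at `x` with the model space). -/
def OneForm.d (α : OneForm n M) (x : M) (u v : TangentSpace (𝓡 (2 * n + 1)) x) : ℝ :=
  fderiv ℝ (α.inChart x) (extChartAt (𝓡 (2 * n + 1)) x x) u v -
    fderiv ℝ (α.inChart x) (extChartAt (𝓡 (2 * n + 1)) x x) v u

/-- A contact form: a smooth nowhere vanishing `1`-form `α` such that `dα` is nondegenerate on
`ker α`; equivalently, `α ∧ (dα)ⁿ` vanishes nowhere. -/
structure OneForm.IsContact (α : OneForm n M) : Prop where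
  smooth : α.IsSmooth
  ne_zero : ∀ x, ∃ v, α x v ≠ 0
  nondegenerate : ∀ x u, α x u = 0 → (∀ v, α x v = 0 → α.d x u v = 0) → u = 0

/-- A (co-oriented) contact structure on a `(2n+1)`-manifold: a field of tangent hyperplanes,
together with the half spaces of positively transverse vectors, that is defined by a contact
form. -/
@[ext]
structure ContactStructure (n : ℕ) (M : Type*) [TopologicalSpace M]
    [ChartedSpace (Euc (2 * n + 1)) M] [IsManifold (𝓡 (2 * n + 1)) ∞ M] where
  /-- the contact hyperplanes -/
  hyperplane : ∀ x : M, Set (TangentSpace (𝓡 (2 * n + 1)) x)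
  /-- the vectors that are positively transverse to the contact hyperplanes -/
  positive : ∀ x : M, Set (TangentSpace (𝓡 (2 * n + 1)) x)
  exists_form : ∃ α : OneForm n M, α.IsContact ∧
    ∀ x, hyperplane x = {v | α x v = 0} ∧ positive x = {v | 0 < α x v}

/-- `α` is a contact form for the co-oriented contact structure `ξ`. -/
def ContactStructure.IsDefinedBy (ξ : ContactStructure n M) (α : OneForm n M) : Prop :=
  α.IsContact ∧ ∀ x, ξ.hyperplane x = {v | α x v = 0} ∧ ξ.positive x = {v | 0 < α x v}

/-- The set of points at which two co-oriented contact structures differ. -/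
def ContactStructure.diffSet (ξ ξ' : ContactStructure n M) : Set M :=
  {x | ¬ (ξ.hyperplane x = ξ'.hyperplane x ∧ ξ.positive x = ξ'.positive x)}

/-! ### Chern classes of a contact structure -/

/-- A continuous complex structure `J` on the vector bundle `ξ = ker α` that is compatible with the
symplectic form `dα|ξ`, that is, `dα(·, J ·)` is a positive definite inner product on `ξ`. (The
values of `J` off `ξ` are irrelevant; for definiteness `J` is an endomorphism of the whole tangent
bundle.) -/
structure IsCompatibleComplexStructure (α : OneForm n M)
    (J : ∀ x : M, TangentSpace (𝓡 (2 * n + 1)) x →L[ℝ] TangentSpace (𝓡 (2 * n + 1)) x) :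
    Prop where
  continuous : Continuous fun v : TangentBundle (𝓡 (2 * n + 1)) M =>
    (⟨v.1, J v.1 v.2⟩ : TangentBundle (𝓡 (2 * n + 1)) M)
  maps_to : ∀ x v, α x v = 0 → α x (J x v) = 0
  sq : ∀ x v, α x v = 0 → J x (J x v) = -v
  symm : ∀ x u v, α x u = 0 → α x v = 0 → α.d x u (J x v) = α.d x v (J x u)
  pos : ∀ x v, α x v = 0 → v ≠ 0 → 0 < α.d x v (J x v)

/-- `P : M → BU(n)` classifies the complex vector bundle `(ker α, J)`: there is a continuous family
`Φ` of complex linear isomorphisms from the fibres `(ker αₓ, Jₓ)` onto the fibres `range (P x)` of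
the tautological bundle. (Again, the values of `Φ` off `ker α` are irrelevant.) -/
def IsClassifyingMap (α : OneForm n M)
    (J : ∀ x : M, TangentSpace (𝓡 (2 * n + 1)) x →L[ℝ] TangentSpace (𝓡 (2 * n + 1)) x)
    (P : C(M, Gr n)) : Prop :=
  ∃ Φ : ∀ x : M, TangentSpace (𝓡 (2 * n + 1)) x →L[ℝ] Hil,
    (Continuous fun v : TangentBundle (𝓡 (2 * n + 1)) M => Φ v.1 v.2) ∧
    ∀ x, (∀ v, α x v = 0 → Φ x (J x v) = Complex.I • Φ x v) ∧
      Set.BijOn (Φ x) {v | α x v = 0} (P x).1.range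

/-- `c` is the `k`-th Chern class of `ξ`, that is, of the complex vector bundle `(ξ, J)` for a
complex structure `J` compatible with `dα`, where `α` is a contact form for `ξ`: the pull-back of
the universal Chern class under a classifying map. -/
def ContactStructure.IsChernClass (ξ : ContactStructure n M) (k : ℕ)
    (c : Cohomology M (2 * k)) : Prop :=
  ∃ α, ξ.IsDefinedBy α ∧ ∃ J, IsCompatibleComplexStructure α J ∧
    ∃ P : C(M, Gr n), IsClassifyingMap α J P ∧ pullback P (2 * k) (universalChern n k) = c

open Classical in
/-- The Chern class `cₖ(ξ) ∈ H²ᵏ(M; ℤ)`; it does not depend on the choices of `α`, `J` and the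
classifying map. -/
def ContactStructure.chernClass (ξ : ContactStructure n M) (k : ℕ) : Cohomology M (2 * k) :=
  if h : ∃ c, ξ.IsChernClass k c then h.choose else 0

/-! ### Isotropically parameterized families and their neighborhoods -/

variable {B : Type*} [TopologicalSpace B] [ChartedSpace (Euc (n - 1)) B]
  [IsManifold (𝓡 (n - 1)) ∞ B]

/-- `ψ : B × S¹ → M`, with `dim B = n - 1`, is an embedded isotropically parameterized family of
transverse curves in `(M, ξ)`. -/
structure IsEmbeddedIsotropicFamily (ξ : ContactStructure n M) (ψ : B × Circle → M) : Prop where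
  embedding : IsSmoothEmbedding ((𝓡 (n - 1)).prod (𝓡 1)) (𝓡 (2 * n + 1)) ∞ ψ
  /-- the curves `ψ({p} × S¹)` are transverse to `ξ` -/
  transverse : ∀ (p : B) (z : Circle) (w : TangentSpace (𝓡 1) z), w ≠ 0 →
    mfderiv (𝓡 1) (𝓡 (2 * n + 1)) (fun z => ψ (p, z)) z w ∉ ξ.hyperplane (ψ (p, z))
  /-- the submanifolds `ψ(B × {z})` are tangent to `ξ` -/
  isotropic : ∀ (p : B) (z : Circle) (u : TangentSpace (𝓡 (n - 1)) p),
    mfderiv (𝓡 (n - 1)) (𝓡 (2 * n + 1)) (fun p => ψ (p, z)) p u ∈ ξ.hyperplane (ψ (p, z))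

/-- `τ : E → M` is a tubular neighborhood of the embedding `ψ`, where `E` is (the total space of) a
smooth vector bundle over `B × S¹`: a diffeomorphism of `E` onto an open subset of `M` that extends
`ψ`, the base being identified with the zero section. -/
structure IsTubularNeighborhood {F : Type*} [NormedAddCommGroup F] [NormedSpace ℝ F]
    {E : B × Circle → Type*} [∀ b, AddCommGroup (E b)] [∀ b, Module ℝ (E b)]
    [∀ b, TopologicalSpace (E b)] [TopologicalSpace (TotalSpace F E)] [FiberBundle F E]
    [VectorBundle ℝ F E] [ContMDiffVectorBundle ∞ F E ((𝓡 (n - 1)).prod (𝓡 1))]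
    (ψ : B × Circle → M) (τ : TotalSpace F E → M) : Prop where
  injective : Function.Injective τ
  isLocalDiffeomorph : IsLocalDiffeomorph (((𝓡 (n - 1)).prod (𝓡 1)).prod 𝓘(ℝ, F))
    (𝓡 (2 * n + 1)) ∞ τ
  zeroSection : ∀ b, τ ⟨b, 0⟩ = ψ b

/-! ### Generalized Lutz twists -/

/-- The cotangent bundle `T*B` of a manifold of dimension `m`. -/
abbrev Cotangent (m : ℕ) (B : Type*) [TopologicalSpace B] [ChartedSpace (Euc m) B]
    [IsManifold (𝓡 m) ∞ B] :=
  TotalSpace (Euc m →L[ℝ] ℝ) (fun p : B => TangentSpace (𝓡 m) p →L[ℝ] Bundle.Trivial B ℝ p)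

/-- The model with corners of `T*B × S¹ × ℂ`. -/
abbrev lutzModel (m : ℕ) :=
  (((𝓡 m).prod 𝓘(ℝ, Euc m →L[ℝ] ℝ)).prod ((𝓡 1).prod 𝓘(ℝ, ℂ)))

/-- The `1`-form `x dy - y dx = r² dθ` on `ℂ`, evaluated at the point `z = x + iy` on the tangent
vector `v`. -/
def angular (z v : ℂ) : ℝ := z.re * v.im - z.im * v.re

/-- The `1`-form `λ_can + f(r) dφ + g(r) r² dθ` on `T*B × S¹ × ℂ`, where `λ_can` is the canonical
`1`-form on `T*B`, `φ` is the angular coordinate on `S¹` and `(r, θ)` are polar coordinates on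
`ℂ`. -/
def lutzForm {m : ℕ} {B : Type*} [TopologicalSpace B] [ChartedSpace (Euc m) B]
    [IsManifold (𝓡 m) ∞ B] (f g : ℝ → ℝ) (y : Cotangent m B × Circle × ℂ)
    (v : TangentSpace (lutzModel m) y) : ℝ :=
  y.1.2 (mfderiv ((𝓡 m).prod 𝓘(ℝ, Euc m →L[ℝ] ℝ)) (𝓡 m)
      (TotalSpace.proj : Cotangent m B → B) y.1 v.1) +
    f ‖y.2.2‖ * angular y.2.1 (mfderiv (𝓡 1) 𝓘(ℝ, ℂ) (fun z : Circle => (z : ℂ)) y.2.1 v.2.1) +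
    g ‖y.2.2‖ * angular y.2.2 v.2.2

/-- The functions `k`, `l` of a full Lutz twist on the solid torus of radius `b`: the form
`k(r) dφ + l(r) dθ` is a contact form, it is `dφ + r² dθ` near `r = 0` and near `r = b`, and the
curve `(k, l)` winds around the origin by one additional full turn. -/
structure IsLutzProfile (b : ℝ) (k l : ℝ → ℝ) : Prop where
  smooth : ContDiff ℝ ∞ k ∧ ContDiff ℝ ∞ l
  contact : ∀ r ∈ Ioc 0 b, 0 < k r * deriv l r - deriv k r * l r
  inner : ∃ δ > 0, ∀ r ∈ Icc 0 δ, k r = 1 ∧ l r = r ^ 2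
  outer : ∃ δ < b, ∀ r ∈ Icc δ b, k r = 1 ∧ l r = r ^ 2
  winding : ∃ Θ : ℝ → ℝ, ContinuousOn Θ (Icc 0 b) ∧ Θ 0 = 0 ∧
    Θ b = Real.arctan (b ^ 2) + 2 * Real.pi ∧
    ∀ r ∈ Icc 0 b, ∃ ρ > 0, k r = ρ * Real.cos (Θ r) ∧ l r = ρ * Real.sin (Θ r)

/-- `ξ'` is the result of a generalized Lutz twist of `ξ` along `ψ : B × S¹ → M`. There are an open
embedding `e` of `T*B × S¹ × ℂ` that extends `ψ`, a neighborhood `N` of the zero section of `T*B`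
and `b > 0` such that `e` is a contact embedding of `N × S¹ × D_b`, with the contact structure
`ker (λ_can + dφ + r² dθ)`, into `(M, ξ)`; the contact structure `ξ'` agrees with `ξ` outside the
image of this set and near its boundary, and on a smaller neighborhood `N' × S¹ × D_b` it is
`ker (λ_can + k(r) dφ + l(r) dθ)`, where `(k, l)` is the profile of a full Lutz twist. -/
def IsLutzTwist (ψ : B × Circle → M) (ξ ξ' : ContactStructure n M) : Prop :=
  ∃ (e : Cotangent (n - 1) B × Circle × ℂ → M) (N N' : Set (Cotangent (n - 1) B)) (b : ℝ)
    (k l : ℝ → ℝ),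
    Function.Injective e ∧
    IsLocalDiffeomorph (lutzModel (n - 1)) (𝓡 (2 * n + 1)) ∞ e ∧
    (∀ p z, e (⟨p, 0⟩, z, 0) = ψ (p, z)) ∧
    0 < b ∧ N' ⊆ N ∧ (∀ p : B, N' ∈ 𝓝 (⟨p, 0⟩ : Cotangent (n - 1) B)) ∧
    IsLutzProfile b k l ∧
    (∀ y ∈ N ×ˢ (univ : Set Circle) ×ˢ Metric.closedBall (0 : ℂ) b, ∀ v,
      mfderiv (lutzModel (n - 1)) (𝓡 (2 * n + 1)) e y v ∈ ξ.hyperplane (e y) ↔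
        lutzForm (fun _ => 1) (fun _ => 1) y v = 0) ∧
    closure (ξ.diffSet ξ') ⊆
      e '' (interior N ×ˢ (univ : Set Circle) ×ˢ Metric.ball (0 : ℂ) b) ∧
    (∀ y ∈ N' ×ˢ (univ : Set Circle) ×ˢ Metric.closedBall (0 : ℂ) b, ∀ v,
      mfderiv (lutzModel (n - 1)) (𝓡 (2 * n + 1)) e y v ∈ ξ'.hyperplane (e y) ↔
        lutzForm k (fun r => l r / r ^ 2) y v = 0)

end Contact

end ContactChern

end

open ContactChern

/-!
The two contact structures agree away from a compact subset `D` of a tube around a submanifold of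
codimension `n + 1`, and the Chern class `cₖ` lives in degree `2k ≤ n`, where it cannot see a set of
codimension `n + 1`. The universal Chern class enters only as *some* class in `H²ᵏ(BU(n); ℤ)`.

**Agreement off `D`.** The set where the structures differ has compact closure in the tube; `D` is the
union of the segments that join its points to the zero section, and `A` is the complement of `D`.
Over `A` the hyperplane fields agree, so the exterior derivatives of the two contact forms are
positive multiples of each other on the hyperplanes (`OneForm.IsContact.exists_d_eq_mul`), and for
compatible complex structures `J`, `J'` the map `1 - J'J` is an isomorphism of the complex vector
bundles (`homotopic_of_agree`). Two classifying maps of isomorphic bundles are homotopic, because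
`ℓ²` has room for two independent copies of itself (`exists_complementary_shifts`,
`IsComplexEmbedding.homotopic_of_same_bundle`). By homotopy invariance (`pullback_eq_of_homotopic`)
the Chern classes have the same restriction to `A`.

**Injectivity of the restriction.** A singular simplex of dimension `i < n + 1` with boundary in `A`
can be pushed into `A` relative to its boundary: in general position it misses the zero section, and
then it is moved out of the fibrewise star-shaped compact set `D` along the rays of the fibres
(`compressible_compl_image`). Carrying this out compatibly for all simplices gives the injectivity
of `Hʲ(M) → Hʲ(A)` for `j ≤ n` (`pullback_inclusionMap_injective`).

**Existence.** The Chern class is defined by a choice among the classes that satisfy its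
characterization, so compatible complex structures and classifying maps have to be shown to exist.
An embedding of `TM` into a trivial bundle `ℝᴺ` represents `dα` on the contact hyperplanes by skew
operators; the orthogonal factor of the polar decomposition (`exists_continuous_polar`) is a
compatible `J`, and `v ↦ v - iJv` embeds the bundle into `ℂᴺ ⊆ ℓ²`
(`ContactStructure.isChernClass_chernClass`).

Part (b) is the case of the trivial enlargement `T*B × S¹ × ℂ` of the cotangent bundle, whose fibre
`ℝⁿ⁻¹ × ℂ` has dimension `n + 1 > 2`.
-/

noncomputable section

namespace ContactChern

/-! ### Chain homotopies from face-compatible families of homotopies -/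

@[simp]
theorem simplexMap_apply {p q : ℕ} (f : Fin (p + 1) → Fin (q + 1)) (t : Simplex p)
    (j : Fin (q + 1)) : simplexMap f t j = ∑ i, if f i = j then t i else 0 := by
  change stdSimplex.map f t j = _
  rw [stdSimplex.map_coe, FunOnFinite.linearMap_apply_apply]
  simp [Finset.sum_filter]

theorem simplexMap_comp {p q r : ℕ} (f : Fin (q + 1) → Fin (r + 1)) (g : Fin (p + 1) → Fin (q + 1)) :
    (simplexMap f).comp (simplexMap g) = simplexMap (f ∘ g) := by
  ext1 t
  exact stdSimplex.map_comp_apply g f t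

theorem simplexMap_comp_apply {p q r : ℕ} (f : Fin (q + 1) → Fin (r + 1))
    (g : Fin (p + 1) → Fin (q + 1)) (t : Simplex p) :
    simplexMap f (simplexMap g t) = simplexMap (f ∘ g) t :=
  stdSimplex.map_comp_apply g f t

theorem simplexMap_id_apply {p : ℕ} (t : Simplex p) : simplexMap id t = t :=
  stdSimplex.map_id_apply t

theorem val_succAbove {m : ℕ} (c : Fin (m + 1)) (b : Fin m) :
    (c.succAbove b : ℕ) = if (b : ℕ) < c then (b : ℕ) else b + 1 := by
  simp only [Fin.succAbove, Fin.lt_def, Fin.val_castSucc]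
  split_ifs <;> simp

theorem val_predAbove {m : ℕ} (l : Fin m) (b : Fin (m + 1)) :
    (l.predAbove b : ℕ) = if (l : ℕ) < b then (b : ℕ) - 1 else b := by
  simp only [Fin.predAbove, Fin.lt_def, Fin.val_castSucc]
  split_ifs <;> simp

/-- The cancellation behind the prism operator, for double sequences of integers. -/
theorem prism_sum (A B : ℕ → ℕ → ℤ) (m : ℕ)
    (hlt : ∀ l c, l ≤ m → c < l → A l c = B (l - 1) c)
    (hgt : ∀ l c, c ≤ m + 1 → l + 1 < c → A l c = B l (c - 1))
    (hdiag : ∀ l, l < m → A l (l + 1) = A (l + 1) (l + 1)) :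
    ∑ l ∈ Finset.range (m + 1), (-1 : ℤ) ^ l * ∑ c ∈ Finset.range (m + 2), (-1 : ℤ) ^ c * A l c =
      A 0 0 - A m (m + 1) -
        ∑ c ∈ Finset.range (m + 1), (-1 : ℤ) ^ c * ∑ l ∈ Finset.range m, (-1 : ℤ) ^ l * B l c := by
  have hpow : ∀ l : ℕ, ((-1 : ℤ)) ^ l * (-1) ^ l = 1 := fun l => by
    rw [← mul_pow]; simp
  -- split each inner sum at the two diagonal terms
  have hsplit : ∀ l ∈ Finset.range (m + 1),
      (-1 : ℤ) ^ l * ∑ c ∈ Finset.range (m + 2), (-1 : ℤ) ^ c * A l c =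
      (A l l - A l (l + 1)) +
        (∑ c ∈ Finset.range l, (-1 : ℤ) ^ l * ((-1) ^ c * B (l - 1) c) -
          ∑ c ∈ Finset.Ico (l + 1) (m + 1), (-1 : ℤ) ^ l * ((-1) ^ c * B l c)) := by
    intro l hl
    have hl' : l ≤ m := by simpa [Nat.lt_succ_iff] using hl
    rw [← Finset.sum_range_add_sum_Ico _ (show l ≤ m + 2 by omega),
      Finset.sum_eq_sum_Ico_succ_bot (show l < m + 2 by omega),
      Finset.sum_eq_sum_Ico_succ_bot (show l + 1 < m + 2 by omega), mul_add, mul_add, mul_add]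
    have h1 : (-1 : ℤ) ^ l * ∑ c ∈ Finset.range l, (-1) ^ c * A l c =
        ∑ c ∈ Finset.range l, (-1 : ℤ) ^ l * ((-1) ^ c * B (l - 1) c) := by
      rw [Finset.mul_sum]
      refine Finset.sum_congr rfl fun c hc => ?_
      rw [hlt l c hl' (by simpa using hc)]
    have h2 : (-1 : ℤ) ^ l * ∑ c ∈ Finset.Ico (l + 1 + 1) (m + 2), (-1) ^ c * A l c =
        - ∑ c ∈ Finset.Ico (l + 1) (m + 1), (-1 : ℤ) ^ l * ((-1) ^ c * B l c) := by
      rw [← Finset.sum_Ico_add' (fun c => (-1 : ℤ) ^ c * A l c) (l + 1) (m + 1) 1, Finset.mul_sum,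
        ← Finset.sum_neg_distrib]
      refine Finset.sum_congr rfl fun c hc => ?_
      rw [Finset.mem_Ico] at hc
      rw [hgt l (c + 1) (by omega) (by omega), Nat.add_sub_cancel]
      ring
    rw [h1, h2, ← mul_assoc, hpow, pow_succ, ← mul_assoc, ← mul_assoc, hpow]
    ring
  rw [Finset.sum_congr rfl hsplit, Finset.sum_add_distrib,
    Finset.sum_sub_distrib (f := fun l => ∑ c ∈ Finset.range l, _)]
  have htel : ∑ l ∈ Finset.range (m + 1), (A l l - A l (l + 1)) = A 0 0 - A m (m + 1) := by
    have : ∀ k, k ≤ m → ∑ l ∈ Finset.range (k + 1), (A l l - A l (l + 1)) = A 0 0 - A k (k + 1) := by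
      intro k
      induction k with
      | zero => simp
      | succ k ih =>
        intro hk
        rw [Finset.sum_range_succ, ih (by omega), hdiag k (by omega)]
        ring
    exact this m le_rfl
  rw [htel]
  have h3 : ∑ l ∈ Finset.range (m + 1), ∑ c ∈ Finset.range l, (-1 : ℤ) ^ l * ((-1) ^ c * B (l - 1) c) =
      - ∑ l ∈ Finset.range m, ∑ c ∈ Finset.range (l + 1), (-1 : ℤ) ^ l * ((-1) ^ c * B l c) := by
    rw [Finset.sum_range_succ']
    simp only [Finset.range_zero, Finset.sum_empty, add_zero, Nat.add_sub_cancel,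
      ← Finset.sum_neg_distrib]
    refine Finset.sum_congr rfl fun l _ => Finset.sum_congr rfl fun c _ => ?_
    ring
  have h4 : ∑ l ∈ Finset.range (m + 1), ∑ c ∈ Finset.Ico (l + 1) (m + 1),
        (-1 : ℤ) ^ l * ((-1) ^ c * B l c) =
      ∑ l ∈ Finset.range m, ∑ c ∈ Finset.Ico (l + 1) (m + 1), (-1 : ℤ) ^ l * ((-1) ^ c * B l c) := by
    rw [Finset.sum_range_succ]; simp
  have h5 : ∑ c ∈ Finset.range (m + 1), (-1 : ℤ) ^ c * ∑ l ∈ Finset.range m, (-1 : ℤ) ^ l * B l c =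
      ∑ l ∈ Finset.range m, (∑ c ∈ Finset.range (l + 1), (-1 : ℤ) ^ l * ((-1) ^ c * B l c) +
        ∑ c ∈ Finset.Ico (l + 1) (m + 1), (-1 : ℤ) ^ l * ((-1) ^ c * B l c)) := by
    simp only [Finset.mul_sum]
    rw [Finset.sum_comm]
    refine Finset.sum_congr rfl fun l hl => ?_
    have := Finset.mem_range.1 hl
    rw [Finset.sum_range_add_sum_Ico _ (show l + 1 ≤ m + 1 by omega)]
    refine Finset.sum_congr rfl fun c _ => ?_
    ring
  rw [h3, h4, h5, Finset.sum_add_distrib]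
  ring

section Prism

variable {X Y : Type*} [TopologicalSpace X] [TopologicalSpace Y]

/-- The affine map of the `(m+1)`-simplex onto the `l`-th simplex of the standard subdivision of the
prism `[0, T] × Δᵐ`; the vertices `0, …, l` go to the bottom and the others to the top. -/
def prismMap (T : ℝ) {m : ℕ} (l : Fin (m + 1)) : C(Simplex (m + 1), ℝ × Simplex m) where
  toFun t := (T * ∑ a : Fin (m + 2), if (l : ℕ) < a then t a else 0, simplexMap l.predAbove t)
  continuous_toFun := by
    refine Continuous.prodMk (continuous_const.mul (continuous_finsetSum _ fun a _ => ?_))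
      (simplexMap _).continuous
    split_ifs
    · exact (continuous_apply a).comp continuous_subtype_val
    · exact continuous_const

theorem prismMap_simplexMap (T : ℝ) {m p : ℕ} (l : Fin (m + 1)) (f : Fin (p + 1) → Fin (m + 2))
    (t : Simplex p) : prismMap T l (simplexMap f t) =
      (T * ∑ a, if (l : ℕ) < f a then t a else 0, simplexMap (l.predAbove ∘ f) t) := by
  refine Prod.ext ?_ (simplexMap_comp_apply _ _ t)
  change T * _ = T * _
  congr 1
  simp only [simplexMap_apply]
  have : ∀ a : Fin (m + 2), (if (l : ℕ) < a then ∑ i, if f i = a then t i else 0 else 0) =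
      ∑ i, if f i = a then (if (l : ℕ) < f i then t i else 0) else 0 := by
    intro a
    split_ifs with h
    · refine Finset.sum_congr rfl fun i _ => ?_
      split_ifs with h1 h2
      · rfl
      · exact absurd (h1 ▸ h) h2
      · rfl
    · symm
      refine Finset.sum_eq_zero fun i _ => ?_
      split_ifs with h1 h2
      · exact absurd (h1 ▸ h2) h
      all_goals rfl
  rw [Finset.sum_congr rfl fun a _ => this a, Finset.sum_comm]
  simp

/-- The face relations of the prism decomposition: two faces `f`, `g` of the prism simplices `l`,
`l'` agree if they do so on the vertices. -/
theorem prismMap_comp_eq (T : ℝ) {m p : ℕ} {l l' : Fin (m + 1)} {f g : Fin (p + 1) → Fin (m + 2)}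
    (h1 : ∀ a, (l : ℕ) < f a ↔ (l' : ℕ) < g a) (h2 : l.predAbove ∘ f = l'.predAbove ∘ g) :
    (prismMap T l).comp (simplexMap f) = (prismMap T l').comp (simplexMap g) := by
  ext1 t
  simp only [ContinuousMap.comp_apply, prismMap_simplexMap, h1, h2]

/-- The prism operator on cochains. -/
def prismCochain (T : ℝ) {m : ℕ} (G : C(Simplex m, X) → C(ℝ × Simplex m, Y)) (a : Cochain Y (m + 1)) :
    Cochain X m :=
  fun σ => ∑ l : Fin (m + 1), (-1 : ℤ) ^ (l : ℕ) * a ((G σ).comp (prismMap T l))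

/-- The homotopy at a fixed time. -/
def atTime {Z : Type*} [TopologicalSpace Z] (s : ℝ) (H : C(ℝ × Z, Y)) : C(Z, Y) :=
  H.comp ⟨fun t => (s, t), by fun_prop⟩

@[simp] theorem atTime_apply {Z : Type*} [TopologicalSpace Z] (s : ℝ) (H : C(ℝ × Z, Y)) (z : Z) :
    atTime s H z = H (s, z) := rfl

theorem prism_bottom_top (T : ℝ) {m : ℕ} (H : C(ℝ × Simplex m, Y)) :
    (H.comp (prismMap T 0)).comp (simplexMap (Fin.succAbove 0)) = atTime T H ∧
    (H.comp (prismMap T (Fin.last m))).comp (simplexMap (Fin.succAbove (Fin.last (m + 1)))) =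
      atTime 0 H := by
  constructor
  · ext1 t
    simp only [ContinuousMap.comp_apply, prismMap_simplexMap, atTime_apply]
    congr 2
    · have := stdSimplex.sum_eq_one t
      simp [this]
    · rw [show Fin.predAbove _ ∘ Fin.succAbove _ = id from funext fun a => by simp,
        simplexMap_id_apply]
  · ext1 t
    simp only [ContinuousMap.comp_apply, prismMap_simplexMap, atTime_apply]
    congr 2
    · have : ∀ a : Fin (m + 1), ¬ (m < (a : ℕ)) := fun a => by omega
      simp [this]
    · rw [show Fin.predAbove _ ∘ Fin.succAbove _ = id from funext fun a => by simp,
        simplexMap_id_apply]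

/-- A family of homotopies of the singular simplices of `X` in `Y`, compatible with faces, does not
change the cohomology class of a cocycle evaluated at the ends of the homotopies. -/
theorem sub_atTime_mem_coboundaries (T : ℝ) (m : ℕ)
    (G : ∀ i, C(Simplex i, X) → C(ℝ × Simplex i, Y))
    (hG : ∀ i, i + 1 = m → ∀ (σ : C(Simplex (i + 1), X)) (l : Fin (i + 2)) (s : ℝ) (t : Simplex i),
      G (i + 1) σ (s, simplexMap l.succAbove t) = G i (σ.comp (simplexMap l.succAbove)) (s, t))
    {a : Cochain Y m} (ha : a ∈ cocycles Y m) :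
    (fun σ => a (atTime T (G m σ)) - a (atTime 0 (G m σ))) ∈ coboundaries X m := by
  have hd : ∀ (σ : C(Simplex m, X)) (l : Fin (m + 1)), ∑ c : Fin (m + 2), (-1 : ℤ) ^ (c : ℕ) *
      a (((G m σ).comp (prismMap T l)).comp (simplexMap c.succAbove)) = 0 := fun σ l =>
    congrFun (show coboundary Y m a = 0 from ha) ((G m σ).comp (prismMap T l))
  -- the faces of the prism simplices, indexed by natural numbers
  let A : C(Simplex m, X) → ℕ → ℕ → ℤ := fun σ l c =>
    if h : l < m + 1 ∧ c < m + 2 then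
      a (((G m σ).comp (prismMap T ⟨l, h.1⟩)).comp (simplexMap (Fin.succAbove ⟨c, h.2⟩))) else 0
  have hA : ∀ σ (l : Fin (m + 1)) (c : Fin (m + 2)),
      A σ l c = a (((G m σ).comp (prismMap T l)).comp (simplexMap c.succAbove)) := fun σ l c => by
    rw [show A σ l c = _ from dif_pos ⟨l.2, c.2⟩]
  have hsum : ∀ σ, ∑ l ∈ Finset.range (m + 1),
      (-1 : ℤ) ^ l * ∑ c ∈ Finset.range (m + 2), (-1 : ℤ) ^ c * A σ l c = 0 := by
    intro σ
    rw [Finset.sum_range]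
    refine Finset.sum_eq_zero fun l _ => ?_
    rw [Finset.sum_range, Finset.sum_congr rfl fun c _ => by rw [hA σ l c], hd, mul_zero]
  have htop : ∀ σ, A σ 0 0 = a (atTime T (G m σ)) := fun σ => by
    rw [← (prism_bottom_top T (G m σ)).1]
    exact hA σ 0 0
  have hbot : ∀ σ, A σ m (m + 1) = a (atTime 0 (G m σ)) := fun σ => by
    rw [← (prism_bottom_top T (G m σ)).2]
    exact hA σ (Fin.last m) (Fin.last (m + 1))
  have hdiag : ∀ σ l, l < m → A σ l (l + 1) = A σ (l + 1) (l + 1) := by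
    intro σ l hl
    have e1 := hA σ ⟨l, by omega⟩ ⟨l + 1, by omega⟩
    have e2 := hA σ ⟨l + 1, by omega⟩ ⟨l + 1, by omega⟩
    simp only at e1 e2
    rw [e1, e2, ContinuousMap.comp_assoc, ContinuousMap.comp_assoc]
    congr 2
    refine prismMap_comp_eq T (fun b => ?_) (funext fun b => ?_)
    · simp only [val_succAbove]
      split_ifs <;> omega
    · ext
      simp only [Function.comp_apply, val_succAbove, val_predAbove]
      split_ifs <;> omega
  cases m with
  | zero =>
    change _ = _
    funext σ
    have := prism_sum (A σ) (fun _ _ => 0) 0 (by omega) (by omega) (by omega)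
    rw [hsum] at this
    simp only [Finset.range_zero, mul_zero, Finset.sum_const_zero, sub_zero] at this
    rw [← htop, ← hbot, ← this]
    rfl
  | succ m =>
    refine ⟨prismCochain T (G m) a, funext fun σ => ?_⟩
    let B : ℕ → ℕ → ℤ := fun l c =>
      if h : l < m + 1 ∧ c < m + 2 then
        a ((G m (σ.comp (simplexMap (Fin.succAbove ⟨c, h.2⟩)))).comp (prismMap T ⟨l, h.1⟩)) else 0
    have hB : ∀ (l : Fin (m + 1)) (c : Fin (m + 2)), B l c =
        a ((G m (σ.comp (simplexMap c.succAbove))).comp (prismMap T l)) := fun l c => by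
      rw [show B l c = _ from dif_pos ⟨l.2, c.2⟩]
    have hface : ∀ (l : Fin (m + 1)) (c : Fin (m + 2)) (l' : Fin (m + 2)) (c' : Fin (m + 3)),
        (∀ b, (l' : ℕ) < c'.succAbove b ↔ (l : ℕ) < b) →
        (∀ b, l'.predAbove (c'.succAbove b) = c.succAbove (l.predAbove b)) →
        A σ l' c' = B l c := by
      intro l c l' c' h1 h2
      rw [hA, hB]
      congr 1
      ext1 t
      simp only [ContinuousMap.comp_apply, prismMap_simplexMap]
      have hp : prismMap T l t = (T * ∑ b : Fin (m + 2), if (l : ℕ) < b then t b else 0,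
          simplexMap l.predAbove t) :=
        rfl
      rw [hp, ← hG m rfl σ c, simplexMap_comp_apply]
      simp only [h1]
      congr 4
      funext b
      exact h2 b
    have key := prism_sum (A σ) B (m + 1) ?_ ?_ (hdiag σ)
    · rw [hsum, htop, hbot] at key
      rw [eq_comm, sub_eq_zero] at key
      rw [key]
      change ∑ c : Fin (m + 2), (-1 : ℤ) ^ (c : ℕ) * ∑ l : Fin (m + 1), (-1 : ℤ) ^ (l : ℕ) * _ = _
      rw [Finset.sum_range]
      refine Finset.sum_congr rfl fun c _ => ?_
      rw [Finset.sum_range]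
      congr 1
      exact Finset.sum_congr rfl fun l _ => by rw [hB]
    · intro l c hl hc
      refine hface ⟨l - 1, by omega⟩ ⟨c, by omega⟩ ⟨l, by omega⟩ ⟨c, by omega⟩ (fun b => ?_) fun b => ?_
      · simp only [val_succAbove]
        split_ifs <;> omega
      · ext
        simp only [val_succAbove, val_predAbove]
        split_ifs <;> omega
    · intro l c hc hl
      refine hface ⟨l, by omega⟩ ⟨c - 1, by omega⟩ ⟨l, by omega⟩ ⟨c, by omega⟩ (fun b => ?_) fun b => ?_
      · simp only [val_succAbove]
        split_ifs <;> omega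
      · ext
        simp only [val_succAbove, val_predAbove]
        split_ifs <;> omega

/-- Homotopic maps induce the same homomorphism in singular cohomology. -/
theorem pullback_eq_of_homotopic {f g : C(X, Y)} (h : f.Homotopic g) (m : ℕ) :
    pullback f m = pullback g m := by
  obtain ⟨H⟩ := h
  refine AddMonoidHom.ext fun x => ?_
  obtain ⟨⟨a, ha⟩, rfl⟩ := QuotientAddGroup.mk_surjective x
  let K : C(ℝ × X, Y) :=
    ⟨fun p => H (Set.projIcc 0 1 zero_le_one p.1, p.2), by fun_prop⟩
  have key := sub_atTime_mem_coboundaries 1 m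
    (fun i (σ : C(Simplex i, X)) => K.comp ⟨fun p : ℝ × Simplex i => (p.1, σ p.2), by fun_prop⟩)
    (fun _ _ _ _ _ _ => rfl) ha
  symm
  refine QuotientAddGroup.eq.2 ?_
  rw [AddSubgroup.mem_addSubgroupOf]
  convert neg_mem key using 1
  funext σ
  change -(a (g.comp σ)) + a (f.comp σ) = -(_ - _)
  rw [neg_sub, sub_eq_neg_add]
  congr 3
  · ext1 t
    exact (H.apply_one (σ t)).symm.trans (by simp [K])
  · ext1 t
    exact (H.apply_zero (σ t)).symm.trans (by simp [K])

end Prism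

/-! ### Compressing singular simplices into a subspace -/

/-- The boundary of the standard simplex. -/
def simplexBoundary (m : ℕ) : Set (Simplex m) := {t | ∃ l, t l = 0}

theorem continuous_simplex_apply {m : ℕ} (l : Fin (m + 1)) : Continuous fun t : Simplex m => t l :=
  (continuous_apply l).comp continuous_subtype_val

theorem isClosed_simplexBoundary (m : ℕ) : IsClosed (simplexBoundary m) := by
  have : simplexBoundary m = ⋃ l, {t : Simplex m | t l = 0} := by ext t; simp [simplexBoundary]
  rw [this]
  exact isClosed_iUnion_of_finite fun l => isClosed_eq (continuous_simplex_apply l) continuous_const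

theorem simplexMap_apply_of_injective {p q : ℕ} {f : Fin (p + 1) → Fin (q + 1)}
    (hf : Function.Injective f) (t : Simplex p) (i : Fin (p + 1)) : simplexMap f t (f i) = t i := by
  rw [simplexMap_apply]
  simp [hf.eq_iff]

theorem simplexMap_apply_of_notMem {p q : ℕ} {f : Fin (p + 1) → Fin (q + 1)} (t : Simplex p)
    {j : Fin (q + 1)} (hj : j ∉ range f) : simplexMap f t j = 0 := by
  rw [simplexMap_apply]
  exact Finset.sum_eq_zero fun i _ => if_neg fun h => hj ⟨i, h⟩

theorem simplexMap_injective {p q : ℕ} {f : Fin (p + 1) → Fin (q + 1)}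
    (hf : Function.Injective f) : Function.Injective (simplexMap f) := by
  intro s t h
  refine stdSimplex.ext (funext fun i => ?_)
  rw [← simplexMap_apply_of_injective hf s i, h, simplexMap_apply_of_injective hf t i]

theorem face_apply_self {m : ℕ} (l : Fin (m + 2)) (p : Simplex m) :
    simplexMap l.succAbove p l = 0 :=
  simplexMap_apply_of_notMem p (by simp)

theorem face_mem_simplexBoundary {m : ℕ} (l : Fin (m + 2)) (p : Simplex m) :
    simplexMap l.succAbove p ∈ simplexBoundary (m + 1) :=
  ⟨l, face_apply_self l p⟩

/-- The affine map that collapses the standard simplex onto its `l`-th face. -/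
def collapse {m : ℕ} (l : Fin (m + 2)) : C(Simplex (m + 1), Simplex m) :=
  simplexMap (Function.invFun l.succAbove)

theorem collapse_face {m : ℕ} (l : Fin (m + 2)) (p : Simplex m) :
    collapse l (simplexMap l.succAbove p) = p := by
  rw [collapse, simplexMap_comp_apply, Function.invFun_comp Fin.succAbove_right_injective,
    simplexMap_id_apply]

theorem face_collapse {m : ℕ} (l : Fin (m + 2)) {t : Simplex (m + 1)} (ht : t l = 0) :
    simplexMap l.succAbove (collapse l t) = t := by
  refine stdSimplex.ext (funext fun j => ?_)
  rcases Fin.eq_self_or_eq_succAbove l j with rfl | ⟨i, rfl⟩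
  · rw [face_apply_self, ht]
  · rw [simplexMap_apply_of_injective Fin.succAbove_right_injective, collapse, simplexMap_apply,
      Fin.sum_univ_succAbove _ l, ht, ite_self, zero_add]
    simp [Function.leftInverse_invFun Fin.succAbove_right_injective _]

/-- A point that lies on two faces of a simplex lies on their common codimension two face. -/
theorem exists_common_face {m : ℕ} {l l' : Fin (m + 3)} (h : l ≠ l') {p p' : Simplex (m + 1)}
    (hp : simplexMap l.succAbove p = simplexMap l'.succAbove p') :
    ∃ (u u' : Fin (m + 2)) (r : Simplex m), p = simplexMap u.succAbove r ∧
      p' = simplexMap u'.succAbove r ∧ l.succAbove ∘ u.succAbove = l'.succAbove ∘ u'.succAbove := by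
  obtain ⟨u, hu⟩ := Fin.exists_succAbove_eq h.symm
  obtain ⟨u', hu'⟩ := Fin.exists_succAbove_eq h
  have e1 : p u = 0 := by
    rw [← simplexMap_apply_of_injective (f := l.succAbove) Fin.succAbove_right_injective p u, hp, hu,
      face_apply_self]
  have e2 : p' u' = 0 := by
    rw [← simplexMap_apply_of_injective (f := l'.succAbove) Fin.succAbove_right_injective p' u', ← hp,
      hu', face_apply_self]
  have hcomp : l.succAbove ∘ u.succAbove = l'.succAbove ∘ u'.succAbove := by
    funext b
    ext
    have h1 := congrArg Fin.val hu
    have h2 := congrArg Fin.val hu'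
    simp only [Function.comp_apply, val_succAbove] at h1 h2 ⊢
    split_ifs at h1 h2 ⊢ <;> omega
  refine ⟨u, u', collapse u p, (face_collapse u e1).symm, ?_, hcomp⟩
  apply simplexMap_injective (f := l'.succAbove) Fin.succAbove_right_injective
  rw [simplexMap_comp_apply, ← hcomp, ← simplexMap_comp_apply, face_collapse u e1, hp]

section Retraction

variable {m : ℕ}

/-- The least barycentric coordinate, normalized to be `1` at the barycenter. -/
def depth (t : Simplex m) : ℝ :=
  (m + 1) * Finset.univ.inf' Finset.univ_nonempty fun l => t l

theorem continuous_depth : Continuous (depth (m := m)) :=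
  continuous_const.mul (Continuous.finset_inf'_apply _ fun l _ => continuous_simplex_apply l)

theorem depth_le (t : Simplex m) (l : Fin (m + 1)) : depth t ≤ (m + 1) * t l :=
  mul_le_mul_of_nonneg_left (Finset.inf'_le _ (Finset.mem_univ l)) (by positivity)

theorem exists_depth_eq (t : Simplex m) : ∃ l, depth t = (m + 1) * t l := by
  obtain ⟨l, _, hl⟩ := Finset.exists_mem_eq_inf' Finset.univ_nonempty fun l => t l
  exact ⟨l, by rw [depth, hl]⟩

theorem depth_nonneg (t : Simplex m) : 0 ≤ depth t := by
  obtain ⟨l, hl⟩ := exists_depth_eq t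
  rw [hl]
  exact mul_nonneg (by positivity) (stdSimplex.zero_le t l)

theorem depth_eq_zero {t : Simplex m} (ht : t ∈ simplexBoundary m) : depth t = 0 := by
  obtain ⟨l, hl⟩ := ht
  refine le_antisymm ?_ (depth_nonneg t)
  simpa [hl] using depth_le t l

/-- The contraction ratio used to project `[0, ∞) × Δ` onto its bottom and sides. -/
def shrinkRatio (s : ℝ) (t : Simplex m) : ℝ := max (1 - depth t) (1 / (1 + |s|))

theorem shrinkRatio_pos (s : ℝ) (t : Simplex m) : 0 < shrinkRatio s t :=
  lt_max_of_lt_right (by positivity)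

theorem continuous_shrinkRatio : Continuous fun p : ℝ × Simplex m => shrinkRatio p.1 p.2 := by
  refine (continuous_const.sub (continuous_depth.comp continuous_snd)).max
    (continuous_const.div (by fun_prop) fun p => ?_)
  positivity

theorem shrinkRatio_boundary (s : ℝ) {t : Simplex m} (ht : t ∈ simplexBoundary m) :
    shrinkRatio s t = 1 := by
  rw [shrinkRatio, depth_eq_zero ht, sub_zero, max_eq_left]
  rw [div_le_one (by positivity)]
  simp

theorem shrinkRatio_zero (t : Simplex m) : shrinkRatio 0 t = 1 := by
  rw [shrinkRatio, max_eq_right] <;> simp [depth_nonneg]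

/-- The simplex component of the projection of `[0, ∞) × Δ` onto its bottom and sides. -/
def pushPoint (s : ℝ) (t : Simplex m) : Simplex m :=
  ⟨fun l => 1 / (m + 1) + (t l - 1 / (m + 1)) / shrinkRatio s t, fun l => by
    have h1 := shrinkRatio_pos s t
    have h2 : 1 - depth t ≤ shrinkRatio s t := le_max_left _ _
    have h3 := depth_le t l
    have h4 : (0 : ℝ) < m + 1 := by positivity
    change 0 ≤ 1 / ((m : ℝ) + 1) + (t l - 1 / ((m : ℝ) + 1)) / shrinkRatio s t
    have : 1 / ((m : ℝ) + 1) + (t l - 1 / ((m : ℝ) + 1)) / shrinkRatio s t =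
        (shrinkRatio s t + ((m + 1) * t l - 1)) / ((m + 1) * shrinkRatio s t) := by
      field_simp
    rw [this]
    exact div_nonneg (by linarith) (by positivity), by
    have h1 := (shrinkRatio_pos s t).ne'
    have h2 : ∑ l, t l = 1 := stdSimplex.sum_eq_one t
    have h4 : (0 : ℝ) < m + 1 := by positivity
    rw [Finset.sum_add_distrib, ← Finset.sum_div (f := fun l => t l - 1 / ((m : ℝ) + 1)),
      Finset.sum_sub_distrib (f := fun l => t l), h2]
    simp
    field_simp
    simp⟩

theorem pushPoint_apply (s : ℝ) (t : Simplex m) (l : Fin (m + 1)) :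
    pushPoint s t l = 1 / (m + 1) + (t l - 1 / (m + 1)) / shrinkRatio s t := rfl

theorem continuous_pushPoint : Continuous fun p : ℝ × Simplex m => pushPoint p.1 p.2 := by
  refine Continuous.subtype_mk (continuous_pi fun l => ?_) _
  exact continuous_const.add ((((continuous_simplex_apply l).comp continuous_snd).sub
    continuous_const).div continuous_shrinkRatio fun p => (shrinkRatio_pos _ _).ne')

theorem pushPoint_of_ratio {s : ℝ} {t : Simplex m} (h : shrinkRatio s t = 1) : pushPoint s t = t :=
  stdSimplex.ext (funext fun l => by rw [pushPoint_apply, h]; ring)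

/-- The height component of the projection of `[0, ∞) × Δ` onto its bottom and sides. -/
def pushHeight (s : ℝ) (t : Simplex m) : ℝ := (1 + |s|) * shrinkRatio s t - 1

theorem continuous_pushHeight : Continuous fun p : ℝ × Simplex m => pushHeight p.1 p.2 := by
  have := continuous_shrinkRatio (m := m)
  unfold pushHeight
  fun_prop

theorem pushHeight_nonneg (s : ℝ) (t : Simplex m) : 0 ≤ pushHeight s t := by
  have h : 1 / (1 + |s|) ≤ shrinkRatio s t := le_max_right _ _
  rw [div_le_iff₀ (by positivity)] at h
  rw [pushHeight]
  linarith

theorem pushHeight_eq_zero_or (s : ℝ) (t : Simplex m) :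
    pushHeight s t = 0 ∨ ∃ l, pushPoint s t l = 0 := by
  have hpos := shrinkRatio_pos s t
  rcases max_choice (1 - depth t) (1 / (1 + |s|)) with h | h
  · right
    obtain ⟨l, hl⟩ := exists_depth_eq t
    refine ⟨l, ?_⟩
    have h' : shrinkRatio s t = 1 - (m + 1) * t l := by rw [← hl]; exact h
    have h4 : (m : ℝ) + 1 ≠ 0 := by positivity
    have : t l = (1 - shrinkRatio s t) / (m + 1) := by rw [h']; field_simp; ring
    rw [pushPoint_apply, this]
    field_simp
    ring
  · left
    have h' : shrinkRatio s t = 1 / (1 + |s|) := h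
    have : (0 : ℝ) < 1 + |s| := by positivity
    rw [pushHeight, h']
    field_simp
    ring

variable {M : Type*} [TopologicalSpace M]

/-- The homotopy extension property of the boundary of a simplex: compatible homotopies of the faces
of a singular simplex extend to a homotopy of the simplex. -/
theorem exists_homotopy_extension (σ : C(Simplex (m + 1), M)) (g : Fin (m + 2) → C(ℝ × Simplex m, M))
    (h0 : ∀ l p, g l (0, p) = σ (simplexMap l.succAbove p))
    (hg : ∀ l l' p p', simplexMap l.succAbove p = simplexMap l'.succAbove p' →
      ∀ s, 0 ≤ s → g l (s, p) = g l' (s, p')) :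
    ∃ H : C(ℝ × Simplex (m + 1), M), (∀ t, H (0, t) = σ t) ∧
      ∀ l s p, 0 ≤ s → H (s, simplexMap l.succAbove p) = g l (s, p) := by
  classical
  let F : ℝ × Simplex (m + 1) → M := fun x =>
    if h : ∃ l, pushPoint x.1 x.2 l = 0 then
      g h.choose (pushHeight x.1 x.2, collapse h.choose (pushPoint x.1 x.2))
    else σ (pushPoint x.1 x.2)
  have hside : ∀ l x, pushPoint x.1 x.2 l = 0 →
      F x = g l (pushHeight x.1 x.2, collapse l (pushPoint x.1 x.2)) := by
    intro l x hl
    have h : ∃ l, pushPoint x.1 x.2 l = 0 := ⟨l, hl⟩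
    rw [show F x = _ from dif_pos h]
    refine hg _ _ _ _ ?_ _ (pushHeight_nonneg _ _)
    rw [face_collapse _ h.choose_spec, face_collapse _ hl]
  have hbot : ∀ x, pushHeight x.1 x.2 = 0 → F x = σ (pushPoint x.1 x.2) := by
    intro x hx
    by_cases h : ∃ l, pushPoint x.1 x.2 l = 0
    · obtain ⟨l, hl⟩ := h
      rw [hside l x hl, hx, h0, face_collapse l hl]
    · exact dif_neg h
  have hF : Continuous F := by
    let S : Option (Fin (m + 2)) → Set (ℝ × Simplex (m + 1)) := fun o =>
      o.elim {x | pushHeight x.1 x.2 = 0} fun l => {x | pushPoint x.1 x.2 l = 0}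
    refine (locallyFinite_of_finite S).continuous ?_ ?_ ?_
    · refine eq_univ_of_forall fun x => ?_
      rcases pushHeight_eq_zero_or x.1 x.2 with h | ⟨l, h⟩
      · exact mem_iUnion.2 ⟨none, h⟩
      · exact mem_iUnion.2 ⟨some l, h⟩
    · rintro (_ | l)
      · exact isClosed_eq continuous_pushHeight continuous_const
      · exact isClosed_eq ((continuous_simplex_apply l).comp continuous_pushPoint) continuous_const
    · rintro (_ | l)
      · exact (σ.continuous.comp continuous_pushPoint).continuousOn.congr fun x hx => hbot x hx
      · refine ContinuousOn.congr (Continuous.continuousOn ?_) fun x hx => hside l x hx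
        exact (g l).continuous.comp
          (continuous_pushHeight.prodMk ((collapse l).continuous.comp continuous_pushPoint))
  refine ⟨⟨F, hF⟩, fun t => ?_, fun l s p hs => ?_⟩
  · have hr := shrinkRatio_zero t
    refine (hbot (0, t) (by simp [pushHeight, hr])).trans ?_
    rw [pushPoint_of_ratio hr]
  · have hr := shrinkRatio_boundary s (face_mem_simplexBoundary l p)
    have hq := pushPoint_of_ratio hr
    refine (hside l (s, _) (by rw [hq, face_apply_self])).trans ?_
    rw [hq, collapse_face, pushHeight, hr, abs_of_nonneg hs]
    congr 2
    ring

end Retraction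

section Compression

variable {M : Type*} [TopologicalSpace M]

/-- The pair `(M, A)` has the compression property in dimension `i`: a singular simplex with
boundary in `A` is homotopic, relative to the boundary, to one in `A`. -/
def Compressible (A : Set M) (i : ℕ) : Prop :=
  ∀ σ : C(Simplex i, M), (∀ t ∈ simplexBoundary i, σ t ∈ A) →
    ∃ σ' : C(Simplex i, M), σ.HomotopicRel σ' (simplexBoundary i) ∧ ∀ t, σ' t ∈ A

/-- A family of homotopies that moves all singular `i`-simplices into `A` and is stationary from
time `i + 1` on. -/
def IsCompressing (A : Set M) (i : ℕ) (G : C(Simplex i, M) → C(ℝ × Simplex i, M)) : Prop :=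
  ∀ σ, (∀ t, G σ (0, t) = σ t) ∧ (∀ s : ℝ, i + 1 ≤ s → ∀ t, G σ (s, t) ∈ A) ∧
    ∀ s : ℝ, i + 1 ≤ s → ∀ t, G σ (s, t) = G σ (i + 1, t)

/-- Compatibility with faces of families of homotopies in two successive dimensions. -/
def FaceCompatible (i : ℕ) (G : C(Simplex i, M) → C(ℝ × Simplex i, M))
    (G' : C(Simplex (i + 1), M) → C(ℝ × Simplex (i + 1), M)) : Prop :=
  ∀ σ (l : Fin (i + 2)) (s : ℝ), 0 ≤ s → ∀ p,
    G' σ (s, simplexMap l.succAbove p) = G (σ.comp (simplexMap l.succAbove)) (s, p)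

theorem exists_isCompressing_zero {A : Set M} (h : Compressible A 0) :
    ∃ G, IsCompressing A 0 G := by
  have : ∀ σ : C(Simplex 0, M), ∃ H : C(ℝ × Simplex 0, M), (∀ t, H (0, t) = σ t) ∧
      (∀ s : ℝ, ((0 : ℕ) : ℝ) + 1 ≤ s → ∀ t, H (s, t) ∈ A) ∧
        ∀ s : ℝ, ((0 : ℕ) : ℝ) + 1 ≤ s → ∀ t, H (s, t) = H (((0 : ℕ) : ℝ) + 1, t) := by
    intro σ
    obtain ⟨σ', ⟨K⟩, hA⟩ := h σ (by
      rintro t ⟨l, hl⟩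
      have := stdSimplex.sum_eq_one t
      rw [Fin.sum_univ_one, show (0 : Fin 1) = l by omega, hl] at this
      norm_num at this)
    have hK1 : ∀ s : ℝ, ((0 : ℕ) : ℝ) + 1 ≤ s → projIcc (0 : ℝ) 1 zero_le_one s = 1 := fun s hs =>
      projIcc_of_right_le zero_le_one (by simpa using hs)
    refine ⟨⟨fun x => K (projIcc 0 1 zero_le_one x.1, x.2), by fun_prop⟩, fun t => ?_,
      fun s hs t => ?_, fun s hs t => ?_⟩
    · change K (projIcc 0 1 zero_le_one 0, t) = _
      rw [projIcc_left]
      exact K.apply_zero t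
    · change K (projIcc 0 1 zero_le_one s, t) ∈ A
      rw [hK1 s hs, K.apply_one]
      exact hA t
    · change K (projIcc 0 1 zero_le_one s, t) = K (projIcc 0 1 zero_le_one _, t)
      rw [hK1 s hs, hK1 _ le_rfl]
  choose G hG using this
  exact ⟨G, hG⟩

theorem exists_isCompressing_succ {A : Set M} {i : ℕ} (h : Compressible A (i + 1))
    {G : C(Simplex i, M) → C(ℝ × Simplex i, M)} (hG : IsCompressing A i G)
    (hface : ∀ k (e : i = k + 1), ∃ G₀ : C(Simplex k, M) → C(ℝ × Simplex k, M),
      FaceCompatible k G₀ (e ▸ G)) :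
    ∃ G', IsCompressing A (i + 1) G' ∧ FaceCompatible i G G' := by
  have : ∀ σ : C(Simplex (i + 1), M), ∃ H : C(ℝ × Simplex (i + 1), M), ((∀ t, H (0, t) = σ t) ∧
      (∀ s : ℝ, ((i + 1 : ℕ) : ℝ) + 1 ≤ s → ∀ t, H (s, t) ∈ A) ∧
        ∀ s : ℝ, ((i + 1 : ℕ) : ℝ) + 1 ≤ s → ∀ t, H (s, t) = H (((i + 1 : ℕ) : ℝ) + 1, t)) ∧
      ∀ (l : Fin (i + 2)) (s : ℝ), 0 ≤ s → ∀ p,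
        H (s, simplexMap l.succAbove p) = G (σ.comp (simplexMap l.succAbove)) (s, p) := by
    intro σ
    obtain ⟨H₁, hH0, hHf⟩ := exists_homotopy_extension σ
      (fun l => G (σ.comp (simplexMap l.succAbove))) (fun l p => (hG _).1 p) (by
        intro l l' p p' hp s hs
        by_cases hl : l = l'
        · subst hl
          rw [simplexMap_injective Fin.succAbove_right_injective hp]
        cases i with
        | zero =>
          exfalso
          have h1 := face_apply_self l p
          have h2 := face_apply_self l' p'
          rw [← hp] at h2
          have h3 := stdSimplex.sum_eq_one (simplexMap l.succAbove p)
          rw [Fin.sum_univ_two] at h3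
          have hz : ∀ j : Fin 2, simplexMap l.succAbove p j = 0 := by
            intro j
            have : j = l ∨ j = l' := by omega
            rcases this with rfl | rfl <;> assumption
          rw [hz, hz] at h3
          norm_num at h3
        | succ k =>
          obtain ⟨G₀, hG₀⟩ := hface k rfl
          obtain ⟨u, u', r, rfl, rfl, hu⟩ := exists_common_face hl hp
          rw [hG₀ _ u s hs r, hG₀ _ u' s hs r, ContinuousMap.comp_assoc, ContinuousMap.comp_assoc,
            simplexMap_comp, simplexMap_comp, hu])
    have hpos : (0 : ℝ) ≤ i + 1 := by positivity
    obtain ⟨σ₂, ⟨K⟩, hA⟩ := h (atTime (i + 1) H₁) (by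
      rintro t ⟨l, hl⟩
      rw [← face_collapse l hl, atTime_apply, hHf l _ _ hpos]
      exact (hG _).2.1 _ le_rfl _)
    -- run the extended homotopy up to time `i + 1`, then the compression, then rest
    let H : C(ℝ × Simplex (i + 1), M) :=
      ⟨fun x => if x.1 ≤ i + 1 then H₁ x else K (projIcc 0 1 zero_le_one (x.1 - (i + 1)), x.2), by
        refine Continuous.if_le (by fun_prop) (by fun_prop) continuous_fst continuous_const ?_
        intro x hx
        rw [hx, sub_self, projIcc_left]
        refine Eq.trans ?_ (K.apply_zero x.2).symm
        rw [atTime_apply, ← hx]⟩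
    have hlate : ∀ s : ℝ, ((i + 1 : ℕ) : ℝ) + 1 ≤ s → ∀ t, H (s, t) = σ₂ t := by
      intro s hs t
      push_cast at hs
      change (if s ≤ i + 1 then _ else K (projIcc 0 1 zero_le_one (s - (i + 1)), t)) = _
      rw [if_neg (by linarith), projIcc_of_right_le zero_le_one (by linarith)]
      exact K.apply_one t
    refine ⟨H, ⟨fun t => ?_, fun s hs t => ?_, fun s hs t => ?_⟩, fun l s hs p => ?_⟩
    · exact (if_pos hpos).trans (hH0 t)
    · rw [hlate s hs]
      exact hA t
    · rw [hlate s hs, hlate _ le_rfl]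
    · by_cases hsi : s ≤ i + 1
      · exact (if_pos hsi).trans (hHf l s p hs)
      · refine (if_neg hsi).trans ?_
        rw [show K (projIcc 0 1 zero_le_one (s - (i + 1)), simplexMap l.succAbove p) = _ from
          K.eq_fst _ (face_mem_simplexBoundary l p), atTime_apply, hHf l _ _ hpos]
        exact ((hG _).2.2 s (le_of_not_ge hsi) p).symm
  choose G' hG' using this
  exact ⟨G', fun σ => (hG' σ).1, fun σ => (hG' σ).2⟩

theorem exists_compressing_family {A : Set M} (j : ℕ) (h : ∀ i ≤ j, Compressible A i) :
    ∃ G : ∀ i, C(Simplex i, M) → C(ℝ × Simplex i, M), (∀ i ≤ j, IsCompressing A i (G i)) ∧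
      ∀ i < j, FaceCompatible i (G i) (G (i + 1)) := by
  induction j with
  | zero =>
    obtain ⟨G₀, hG₀⟩ := exists_isCompressing_zero (h 0 le_rfl)
    refine ⟨fun i => match i with
      | 0 => G₀
      | _ + 1 => fun σ => σ.comp ⟨Prod.snd, continuous_snd⟩, fun i hi => ?_, by omega⟩
    obtain rfl : i = 0 := by omega
    exact hG₀
  | succ j ih =>
    obtain ⟨G, hG, hf⟩ := ih fun i hi => h i (by omega)
    obtain ⟨G', hG', hf'⟩ := exists_isCompressing_succ (h (j + 1) le_rfl) (hG j le_rfl) (by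
      rintro k rfl
      exact ⟨G k, hf k (by omega)⟩)
    refine ⟨Function.update G (j + 1) G', fun i hi => ?_, fun i hi => ?_⟩
    · rcases eq_or_ne i (j + 1) with rfl | hne
      · rwa [Function.update_self]
      · rw [Function.update_of_ne hne]
        exact hG i (by omega)
    · rw [Function.update_of_ne (show i ≠ j + 1 by omega)]
      rcases eq_or_ne i j with rfl | hne
      · rwa [Function.update_self]
      · rw [Function.update_of_ne (by omega)]
        exact hf i (by omega)

/-- The inclusion of a subset. -/
def inclusionMap (A : Set M) : C(A, M) := ⟨Subtype.val, continuous_subtype_val⟩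

/-- If singular simplices of dimension at most `j` can be compressed into `A`, then the restriction
of cohomology classes of degree `j` to `A` is injective. -/
theorem pullback_inclusionMap_injective {A : Set M} {j : ℕ} (h : ∀ i ≤ j, Compressible A i) :
    Function.Injective (pullback (inclusionMap A) j) := by
  rw [injective_iff_map_eq_zero]
  intro x hx
  obtain ⟨⟨a, ha⟩, rfl⟩ := QuotientAddGroup.mk_surjective x
  obtain ⟨G, hG, hf⟩ := exists_compressing_family j h
  have hx' : cochainPullback (inclusionMap A) j a ∈ coboundaries A j := by
    have := (QuotientAddGroup.eq_zero_iff _).1 hx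
    exact AddSubgroup.mem_addSubgroupOf.1 this
  have key := sub_atTime_mem_coboundaries (j + 1) j
    (fun i σ => (G i σ).comp ⟨fun x : ℝ × Simplex i => (|x.1|, x.2), by fun_prop⟩)
    (fun i hi σ l s t => hf i (by omega) σ l |s| (abs_nonneg s) t) ha
  rw [QuotientAddGroup.eq_zero_iff]
  refine AddSubgroup.mem_addSubgroupOf.2 ?_
  -- the simplices at the end of the homotopies, as simplices of `A`
  have habs : ∀ i : ℕ, |(i : ℝ) + 1| = i + 1 := fun i => abs_of_nonneg (by positivity)
  let φ : ∀ i, i ≤ j → C(Simplex i, M) → C(Simplex i, A) := fun i hi σ =>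
    ⟨fun t => ⟨G i σ (j + 1, t), (hG i hi σ).2.1 _ (by simpa using hi) t⟩, by fun_prop⟩
  have hφ : (fun σ => a (atTime (j + 1)
      ((G j σ).comp ⟨fun x : ℝ × Simplex j => (|x.1|, x.2), by fun_prop⟩))) ∈ coboundaries M j := by
    have e : (fun σ => a (atTime (j + 1)
        ((G j σ).comp ⟨fun x : ℝ × Simplex j => (|x.1|, x.2), by fun_prop⟩))) =
        fun σ => cochainPullback (inclusionMap A) j a (φ j le_rfl σ) := by
      funext σ
      change _ = a ((inclusionMap A).comp _)
      congr 1
      ext1 t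
      simp only [atTime_apply, ContinuousMap.comp_apply, ContinuousMap.coe_mk, habs]
      rfl
    rw [e]
    cases j with
    | zero =>
      have h0 : cochainPullback (inclusionMap A) 0 a = 0 := hx'
      rw [h0]
      exact zero_mem _
    | succ j =>
      obtain ⟨b, hb⟩ := hx'
      refine ⟨fun τ => b (φ j (by omega) τ), funext fun σ => ?_⟩
      rw [← hb]
      change ∑ c : Fin (j + 2), (-1 : ℤ) ^ (c : ℕ) * b _ = ∑ c : Fin (j + 2), (-1 : ℤ) ^ (c : ℕ) * b _
      refine Finset.sum_congr rfl fun c _ => ?_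
      congr 2
      ext1 t
      exact Subtype.ext (hf j (by omega) σ c _ (by positivity) t).symm
  have := sub_mem hφ key
  convert this using 1
  funext σ
  simp only [Pi.sub_apply, sub_sub_cancel]
  congr 1
  ext1 t
  simp only [atTime_apply, ContinuousMap.comp_apply, ContinuousMap.coe_mk, abs_zero]
  exact ((hG j le_rfl σ).1 t).symm

end Compression

/-! ### General position -/

/-- A continuous function on a closed part of an `i`-simplex with values in a space of dimension
greater than `i` can be made nowhere zero by adding a small continuous function. -/
theorem exists_small_add_ne_zero {F : Type*} [NormedAddCommGroup F] [NormedSpace ℝ F]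
    [FiniteDimensional ℝ F] {i : ℕ} (hi : i < Module.finrank ℝ F) {C : Set (Simplex i)}
    (hC : IsClosed C) (v : C(C, F)) {ε : ℝ} (hε : 0 < ε) :
    ∃ w : C(Simplex i, F), ‖w‖ < ε ∧ ∀ t : C, v t + w t ≠ 0 := by
  -- forgetting the first barycentric coordinate embeds the simplex into `ℝⁱ`
  let J : C(Simplex i, Fin i → ℝ) :=
    ⟨fun t a => t a.succ, continuous_pi fun a => continuous_simplex_apply _⟩
  have hJ : Function.Injective J := by
    intro s t h
    have h1 : ∀ a : Fin i, s a.succ = t a.succ := fun a => congrFun h a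
    have hs := stdSimplex.sum_eq_one s
    have ht := stdSimplex.sum_eq_one t
    rw [Fin.sum_univ_succ] at hs ht
    simp only [h1] at hs
    refine stdSimplex.ext (funext fun a => ?_)
    refine Fin.cases ?_ h1 a
    linarith
  have hJC : IsClosedEmbedding (fun t : C => J t) :=
    (J.continuous.isClosedEmbedding hJ).comp hC.isClosedEmbedding_subtypeVal
  have : TietzeExtension F := TietzeExtension.of_tvs ℝ
  obtain ⟨V, hV⟩ := ContinuousMap.exists_extension' hJC v
  have hopen : IsOpen {G : C(Fin i → ℝ, F) | dist (G.comp J) (V.comp J) < ε / 2} :=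
    isOpen_lt ((ContinuousMap.continuous_precomp J).dist continuous_const) continuous_const
  obtain ⟨G, hG, hGs⟩ := (ContinuousMap.dense_setOfPred_contDiff (E := Fin i → ℝ) (F := F)).exists_mem_open
    hopen ⟨V, by simpa using half_pos hε⟩
  have hGs' : ContDiff ℝ 1 G := ContDiff.of_le (n := ∞) ‹_› (by norm_cast)
  obtain ⟨c, hc, hcε⟩ := (ContDiff.dense_compl_range_of_finrank_lt_finrank hGs'
    (by simpa using hi)).exists_mem_open Metric.isOpen_ball ⟨0, Metric.mem_ball_self (half_pos hε)⟩
  refine ⟨G.comp J - V.comp J - ContinuousMap.const _ c, ?_, fun t => ?_⟩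
  · have h1 : ‖G.comp J - V.comp J‖ < ε / 2 := by rw [← dist_eq_norm]; assumption
    have h2 : ‖ContinuousMap.const (Simplex i) c‖ < ε / 2 := by
      refine (ContinuousMap.norm_lt_iff _ (half_pos hε)).2 fun _ => ?_
      simpa using hcε
    linarith [norm_sub_le (G.comp J - V.comp J) (ContinuousMap.const (Simplex i) c)]
  · have h3 : V (J t) = v t := congrFun hV t
    simp only [ContinuousMap.sub_apply, ContinuousMap.comp_apply, ContinuousMap.const_apply, h3]
    intro h
    refine hc ⟨J t, ?_⟩
    have : v t + (G (J t) - v t - c) = G (J t) - c := by abel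
    rw [this] at h
    exact sub_eq_zero.1 h

/-- Gluing a family of modifications of a map that are supported in a closed set `K`, where `K` is
contained in the open set `U`, with the map itself. -/
theorem continuous_modification {Q Δ M : Type*} [TopologicalSpace Q] [TopologicalSpace Δ]
    [TopologicalSpace M] {σ : Δ → M} (hσ : Continuous σ) {U K : Set Δ} (hU : IsOpen U)
    (hK : IsClosed K) (hKU : K ⊆ U) {h : Q × Δ → M} (hc : ContinuousOn h (univ ×ˢ U))
    (hh : ∀ q, ∀ t ∈ U, t ∉ K → h (q, t) = σ t) [DecidablePred (· ∈ U)] :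
    Continuous fun x : Q × Δ => if x.2 ∈ U then h x else σ x.2 := by
  rw [continuous_iff_continuousAt]
  rintro ⟨q, t⟩
  by_cases ht : t ∈ U
  · have hn : (univ : Set Q) ×ˢ U ∈ 𝓝 (q, t) := (isOpen_univ.prod hU).mem_nhds ⟨trivial, ht⟩
    refine (hc.continuousAt hn).congr ?_
    filter_upwards [hn] with x hx
    exact (if_pos hx.2).symm
  · have hn : (univ : Set Q) ×ˢ Kᶜ ∈ 𝓝 (q, t) :=
      (isOpen_univ.prod hK.isOpen_compl).mem_nhds ⟨trivial, fun h => ht (hKU h)⟩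
    refine (hσ.comp continuous_snd).continuousAt.congr ?_
    filter_upwards [hn] with x hx
    split_ifs with hxU
    · exact (hh x.1 x.2 hxU hx.2).symm
    · rfl

/-- A cut-off function between a closed set and an open neighborhood in a normal space. -/
theorem exists_cutoff {X : Type*} [TopologicalSpace X] [NormalSpace X] {C U : Set X}
    (hC : IsClosed C) (hU : IsOpen U) (hCU : C ⊆ U) :
    ∃ (r : C(X, ℝ)) (K : Set X), IsClosed K ∧ K ⊆ U ∧ (∀ x ∈ C, r x = 1) ∧ (∀ x ∉ K, r x = 0) ∧
      ∀ x, 0 ≤ r x := by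
  obtain ⟨V, hV, hCV, hVU⟩ := normal_exists_closure_subset hC hU hCU
  obtain ⟨r, h0, h1, h01⟩ := exists_continuous_zero_one_of_isClosed hV.isClosed_compl hC
    (disjoint_left.2 fun x hx hx' => hx (hCV hx'))
  exact ⟨r, closure V, isClosed_closure, hVU, fun x hx => h1 hx,
    fun x hx => h0 fun hxV => hx (subset_closure hxV), fun x => (h01 x).1⟩

section Scaling

variable {Y : Type*} [TopologicalSpace Y]

/-- A local fibre coordinate `φ : W → F` of a vector bundle with total space `Y`, given through the
fibrewise multiplication by scalars and the fibrewise translations `add`; the open set `W` is a union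
of fibres. Two points belong to the same fibre iff they agree after multiplication by `0`. -/
structure IsFibreCoordinate {F : Type*} [NormedAddCommGroup F] [NormedSpace ℝ F]
    (scale : ℝ → Y → Y) (W : Set Y) (φ : Y → F) (add : Y → F → Y) : Prop where
  isOpen : IsOpen W
  saturated : ∀ y y', scale 0 y = scale 0 y' → y ∈ W → y' ∈ W
  continuousOn : ContinuousOn φ W
  continuousOn_add : ContinuousOn (fun x : Y × F => add x.1 x.2) (W ×ˢ univ)
  coord_scale : ∀ y ∈ W, ∀ c, φ (scale c y) = c • φ y
  coord_add : ∀ y ∈ W, ∀ w, φ (add y w) = φ y + w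
  base_add : ∀ y ∈ W, ∀ w, scale 0 (add y w) = scale 0 y
  add_zero : ∀ y ∈ W, add y 0 = y
  zero_of_coord : ∀ y ∈ W, φ y = 0 → scale 0 y = y

/-- The multiplication by real scalars in the fibres of a vector bundle with total space `Y` and
typical fibre `F`, described without reference to the base. -/
structure IsFibreScaling (F : Type*) [NormedAddCommGroup F] [NormedSpace ℝ F]
    (scale : ℝ → Y → Y) : Prop where
  continuous : Continuous fun x : ℝ × Y => scale x.1 x.2
  scale_scale : ∀ c d y, scale c (scale d y) = scale (c * d) y
  one_scale : ∀ y, scale 1 y = y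
  exists_coordinate : ∀ y, ∃ (W : Set Y) (φ : Y → F) (add : Y → F → Y), y ∈ W ∧
    IsFibreCoordinate scale W φ add

variable {F : Type*} [NormedAddCommGroup F] [NormedSpace ℝ F] {scale : ℝ → Y → Y}

theorem IsFibreScaling.base_scale (h : IsFibreScaling F scale) (c : ℝ) (y : Y) :
    scale 0 (scale c y) = scale 0 y := by rw [h.scale_scale, zero_mul]

theorem IsFibreCoordinate.scale_mem {W : Set Y} {φ : Y → F} {add : Y → F → Y}
    (h : IsFibreScaling F scale) (hW : IsFibreCoordinate scale W φ add) {c : ℝ} {y : Y} :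
    scale c y ∈ W ↔ y ∈ W :=
  ⟨hW.saturated _ _ (h.base_scale c y), hW.saturated _ _ (h.base_scale c y).symm⟩

theorem IsFibreCoordinate.coord_eq_zero_iff {W : Set Y} {φ : Y → F} {add : Y → F → Y}
    (hW : IsFibreCoordinate scale W φ add) {y : Y} (hy : y ∈ W) : φ y = 0 ↔ scale 0 y = y := by
  refine ⟨hW.zero_of_coord y hy, fun h => ?_⟩
  rw [← h, hW.coord_scale y hy, zero_smul]

/-- Nonzero vectors are eventually moved out of a compact set by large multiples. -/
theorem IsFibreScaling.exists_scale_notMem (h : IsFibreScaling F scale) {D : Set Y}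
    (hD : IsCompact D) {y : Y} (hy : scale 0 y ≠ y) : ∃ c : ℝ, 0 ≤ c ∧ scale c y ∉ D := by
  by_contra! hall
  obtain ⟨z, _, hz⟩ := hD.exists_mapClusterPt (f := Filter.atTop) (u := fun k : ℕ => scale k y)
    (Filter.tendsto_principal.2 (Filter.Eventually.of_forall fun k => hall k (by positivity)))
  obtain ⟨W, φ, add, hzW, hW⟩ := h.exists_coordinate z
  have hyW : y ∈ W := by
    obtain ⟨k, hk⟩ := ((mapClusterPt_iff_frequently.1 hz) W (hW.isOpen.mem_nhds hzW)).exists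
    exact (hW.scale_mem h).1 hk
  have hφ : φ y ≠ 0 := fun h0 => hy (hW.zero_of_coord y hyW h0)
  have hcont : ContinuousAt (fun y => ‖φ y‖) z :=
    (hW.continuousOn.continuousAt (hW.isOpen.mem_nhds hzW)).norm
  have hev : ∀ᶠ y' in 𝓝 z, ‖φ y'‖ < ‖φ z‖ + 1 :=
    hcont.eventually (Iio_mem_nhds (lt_add_one _))
  have hfr := (mapClusterPt_iff_frequently.1 hz) _ hev
  have htop : ∀ᶠ k : ℕ in Filter.atTop, ‖φ z‖ + 1 ≤ (k : ℝ) * ‖φ y‖ :=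
    (tendsto_natCast_atTop_atTop.atTop_mul_const (norm_pos_iff.2 hφ)).eventually_ge_atTop _
  obtain ⟨k, hk1, hk2⟩ := (hfr.and_eventually htop).exists
  have hk1' : ‖φ (scale k y)‖ < ‖φ z‖ + 1 := hk1
  rw [hW.coord_scale y hyW, norm_smul, Real.norm_natCast] at hk1'
  linarith

/-- The fibrewise star-shaped hull of a compact set. -/
theorem IsFibreScaling.isCompact_hull (h : IsFibreScaling F scale) {K : Set Y} (hK : IsCompact K) :
    IsCompact ((fun x : ℝ × Y => scale x.1 x.2) '' (Icc 0 1 ×ˢ K)) :=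
  (isCompact_Icc.prod hK).image h.continuous

variable {M : Type*} [TopologicalSpace M] {e : Y → M}

/-- A singular simplex can be moved by an arbitrarily small homotopy in the fibres so that it does
not meet the zero section on a given compact set, on which a fibre coordinate exists. -/
theorem exists_homotopicRel_ne_zero [FiniteDimensional ℝ F] (he : IsOpenEmbedding e)
    {i : ℕ} (hi : i < Module.finrank ℝ F) {W : Set Y} {φ : Y → F} {add : Y → F → Y}
    (hW : IsFibreCoordinate scale W φ add) (σ : C(Simplex i, M)) {C S : Set (Simplex i)}
    (hC : IsClosed C) (hS : IsClosed S) (hCW : ∀ t ∈ C, σ t ∈ e '' W) (hCS : Disjoint C S)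
    {N : Set C(Simplex i, M)} (hN : N ∈ 𝓝 σ) :
    ∃ σ' ∈ N, σ.HomotopicRel σ' S ∧ (∀ t ∈ C, ∀ y, σ' t = e y → scale 0 y ≠ y) ∧
      ∀ t y, σ t = e y → ∃ y', σ' t = e y' ∧ scale 0 y' = scale 0 y := by
  classical
  rcases C.eq_empty_or_nonempty with rfl | ⟨t₀, ht₀⟩
  · exact ⟨σ, mem_of_mem_nhds hN, .refl σ, by simp, fun t y hy => ⟨y, hy, rfl⟩⟩
  have : Nonempty Y := by obtain ⟨y, _⟩ := hCW t₀ ht₀; exact ⟨y⟩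
  let g : Simplex i → Y := fun t => (he.toOpenPartialHomeomorph e).symm (σ t)
  have hgr : ∀ t, σ t ∈ range e → e (g t) = σ t := fun t ht =>
    (he.toOpenPartialHomeomorph e).right_inv (by simpa using ht)
  have hge : ∀ t y, σ t = e y → g t = y := fun t y h => by
    change (he.toOpenPartialHomeomorph e).symm (σ t) = y
    rw [h]
    exact (he.toOpenPartialHomeomorph e).left_inv (by simp)
  have hgc : ContinuousOn g (σ ⁻¹' range e) :=
    (he.toOpenPartialHomeomorph e).continuousOn_symm.comp σ.continuous.continuousOn
      fun t ht => by simpa using ht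
  let U : Set (Simplex i) := σ ⁻¹' (e '' W) ∩ Sᶜ
  have hU : IsOpen U :=
    ((he.isOpenMap _ hW.isOpen).preimage σ.continuous).inter hS.isOpen_compl
  have hUr : ∀ t ∈ U, σ t ∈ range e := fun t ht => image_subset_range e W ht.1
  have hUW : ∀ t ∈ U, g t ∈ W := fun t ht => by
    obtain ⟨y, hy, hy'⟩ := ht.1
    rwa [hge t y hy'.symm]
  have hCU : C ⊆ U := fun t ht => ⟨hCW t ht, disjoint_left.1 hCS ht⟩
  obtain ⟨r, K, hK, hKU, hr1, hr0, -⟩ := exists_cutoff hC hU hCU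
  let h : C(Simplex i, F) × Simplex i → M := fun x => e (add (g x.2) (r x.2 • x.1 x.2))
  have hh : ∀ q, ∀ t ∈ U, t ∉ K → h (q, t) = σ t := fun q t htU htK => by
    change e (add (g t) (r t • q t)) = σ t
    rw [hr0 t htK, zero_smul, hW.add_zero _ (hUW t htU), hgr t (hUr t htU)]
  have hcont : ContinuousOn h (univ ×ˢ U) := by
    refine he.continuous.comp_continuousOn ?_
    refine hW.continuousOn_add.comp (f := fun x : C(Simplex i, F) × Simplex i =>
      (g x.2, r x.2 • x.1 x.2)) (t := W ×ˢ univ) ?_ fun x hx => ⟨hUW _ hx.2, trivial⟩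
    refine ContinuousOn.prodMk (hgc.comp continuous_snd.continuousOn fun x hx => hUr _ hx.2) ?_
    fun_prop
  let Ξ : C(C(Simplex i, F), C(Simplex i, M)) := ContinuousMap.curry
    ⟨_, continuous_modification σ.continuous hU hK hKU hcont hh⟩
  have hΞ : ∀ w t, Ξ w t = if t ∈ U then h (w, t) else σ t := fun _ _ => rfl
  have hΞ0 : Ξ 0 = σ := by
    ext1 t
    rw [hΞ]
    split_ifs with ht
    · change e (add (g t) (r t • (0 : F))) = σ t
      rw [smul_zero, hW.add_zero _ (hUW t ht), hgr t (hUr t ht)]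
    · rfl
  obtain ⟨ε, hε, hεN⟩ := Metric.mem_nhds_iff.1 (Ξ.continuous.continuousAt (x := 0)
    (show N ∈ 𝓝 (Ξ 0) by rwa [hΞ0]))
  obtain ⟨w, hw, hw0⟩ := exists_small_add_ne_zero hi hC
    ⟨fun t : C => φ (g t), (hW.continuousOn.comp (hgc.mono hUr) hUW).comp_continuous
      continuous_subtype_val fun t => hCU t.2⟩ hε
  refine ⟨Ξ w, hεN (by simpa using hw), ?_, fun t ht y hy h0 => ?_, fun t y hy => ?_⟩
  · refine ⟨⟨⟨⟨fun x => Ξ ((x.1 : ℝ) • w) x.2, by fun_prop⟩, fun t => ?_, fun t => ?_⟩,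
      fun s t ht => ?_⟩⟩
    · simp [hΞ0]
    · simp
    · change Ξ ((s : ℝ) • w) t = σ t
      rw [hΞ, if_neg fun hU => hU.2 ht]
  · rw [hΞ, if_pos (hCU ht)] at hy
    have hy' : add (g t) (r t • w t) = y := he.injective hy
    rw [hr1 t ht, one_smul] at hy'
    have hgW := hUW t (hCU ht)
    have hyW : y ∈ W := hy' ▸ hW.saturated _ _ (hW.base_add _ hgW _).symm hgW
    have := (hW.coord_eq_zero_iff hyW).2 h0
    rw [← hy', hW.coord_add _ hgW] at this
    exact hw0 ⟨t, ht⟩ this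
  · by_cases ht : t ∈ U
    · refine ⟨add (g t) (r t • w t), ?_, ?_⟩
      · rw [hΞ, if_pos ht]
      · rw [hW.base_add _ (hUW t ht), hge t y hy]
    · exact ⟨y, by rw [hΞ, if_neg ht, hy], rfl⟩

/-- A singular simplex that meets the compact set `D` only in nonzero vectors, and not at all on
`S`, can be pushed out of the fibrewise star-shaped compact set `D` along the fibres. -/
theorem exists_homotopicRel_push (h : IsFibreScaling F scale) (he : IsOpenEmbedding e) [T2Space M]
    {D : Set Y} (hD : IsCompact D) (hstar : ∀ y ∈ D, ∀ c ∈ Icc (0 : ℝ) 1, scale c y ∈ D)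
    {i : ℕ} (σ : C(Simplex i, M)) {S : Set (Simplex i)} (hS : IsClosed S)
    (hSD : ∀ t ∈ S, σ t ∉ e '' D) (hne : ∀ t, ∀ y ∈ D, σ t = e y → scale 0 y ≠ y) :
    ∃ σ' : C(Simplex i, M), σ.HomotopicRel σ' S ∧ ∀ t, σ' t ∉ e '' D := by
  classical
  have hDc : IsClosed (e '' D) := (hD.image he.continuous).isClosed
  let C : Set (Simplex i) := σ ⁻¹' (e '' D)
  have hC : IsClosed C := hDc.preimage σ.continuous
  rcases C.eq_empty_or_nonempty with hCe | ⟨t₀, y₀, hy₀, -⟩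
  · exact ⟨σ, .refl σ, fun t ht => (hCe ▸ (show t ∈ C from ht) : t ∈ (∅ : Set _))⟩
  have : Nonempty Y := ⟨y₀⟩
  let g : Simplex i → Y := fun t => (he.toOpenPartialHomeomorph e).symm (σ t)
  have hgr : ∀ t, σ t ∈ range e → e (g t) = σ t := fun t ht =>
    (he.toOpenPartialHomeomorph e).right_inv (by simpa using ht)
  have hge : ∀ t y, σ t = e y → g t = y := fun t y h => by
    change (he.toOpenPartialHomeomorph e).symm (σ t) = y
    rw [h]
    exact (he.toOpenPartialHomeomorph e).left_inv (by simp)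
  have hgc : ContinuousOn g (σ ⁻¹' range e) :=
    (he.toOpenPartialHomeomorph e).continuousOn_symm.comp σ.continuous.continuousOn
      fun t ht => by simpa using ht
  have hro : IsOpen (σ ⁻¹' range e) := he.isOpen_range.preimage σ.continuous
  let U : Set (Simplex i) := σ ⁻¹' range e ∩ Sᶜ
  have hU : IsOpen U := hro.inter hS.isOpen_compl
  have hCU : C ⊆ U := fun t ht => ⟨image_subset_range e D ht, fun hS => hSD t hS ht⟩
  obtain ⟨r, K, hK, hKU, hr1, hr0, hrn⟩ := exists_cutoff hC hU hCU
  -- multiples that leave `D` stay outside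
  have hmono : ∀ y (c d : ℝ), 0 ≤ c → c ≤ d → scale c y ∉ D → scale d y ∉ D := by
    intro y c d hc hcd hy hy'
    rcases hcd.eq_or_lt with rfl | hlt
    · exact hy hy'
    have hd : 0 < d := hc.trans_lt hlt
    refine hy ?_
    have := hstar _ hy' (c / d) ⟨div_nonneg hc hd.le, (div_le_one hd).2 hcd⟩
    rwa [h.scale_scale, div_mul_cancel₀ _ hd.ne'] at this
  -- a multiple that works for all points of `C` at once
  have hunif : ∃ c : ℕ, ∀ t ∈ C, scale c (g t) ∉ D := by
    have hgC : ContinuousOn g C := hgc.mono fun t ht => (hCU ht).1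
    have hcov : ∀ t ∈ C, ∃ c : ℕ, ∀ᶠ t' in 𝓝[C] t, scale c (g t') ∉ D := by
      intro t ht
      obtain ⟨y, hy, hyt⟩ := id ht
      have hg : g t = y := hge t y hyt.symm
      obtain ⟨c, hc0, hc⟩ := h.exists_scale_notMem hD (hne t y hy hyt.symm)
      obtain ⟨k, hk⟩ := exists_nat_ge c
      refine ⟨k, ?_⟩
      have hk' : scale k (g t) ∉ D := hg ▸ hmono y c k hc0 hk hc
      have hDY : IsClosed D := by
        rw [← preimage_image_eq D he.injective]
        exact hDc.preimage he.continuous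
      have : ContinuousWithinAt (fun t' => scale k (g t')) C t :=
        (h.continuous.comp (Continuous.prodMk_right (k : ℝ))).continuousAt.comp_continuousWithinAt
          (hgC t ht)
      exact this.eventually (hDY.isOpen_compl.mem_nhds hk')
    choose! c hc using hcov
    obtain ⟨s, hs, hsC⟩ := hC.isCompact.elim_nhdsWithin_subcover (fun t => {t' | scale (c t) (g t') ∉ D})
      fun t ht => hc t ht
    refine ⟨s.sup c, fun t ht => ?_⟩
    obtain ⟨t', ht', hmem⟩ := mem_iUnion₂.1 (hsC ht)
    exact hmono _ (c t') _ (by positivity) (by exact_mod_cast Finset.le_sup ht') hmem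
  obtain ⟨c, hc⟩ := hunif
  let k : ℝ × Simplex i → M := fun x => e (scale (1 + x.1 * (c * r x.2)) (g x.2))
  have hk : ∀ q, ∀ t ∈ U, t ∉ K → k (q, t) = σ t := fun q t htU htK => by
    change e (scale (1 + q * (c * r t)) (g t)) = σ t
    rw [hr0 t htK, mul_zero, mul_zero, add_zero, h.one_scale, hgr t htU.1]
  have hkc : ContinuousOn k (univ ×ˢ U) := by
    refine he.continuous.comp_continuousOn (h.continuous.comp_continuousOn (f := fun x : ℝ × Simplex i =>
      (1 + x.1 * (c * r x.2), g x.2)) ?_)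
    refine ContinuousOn.prodMk (Continuous.continuousOn (by fun_prop)) ?_
    exact hgc.comp continuous_snd.continuousOn fun x hx => hx.2.1
  let H : C(ℝ × Simplex i, M) := ⟨_, continuous_modification σ.continuous hU hK hKU hkc hk⟩
  have hH : ∀ q t, H (q, t) = if t ∈ U then k (q, t) else σ t := fun _ _ => rfl
  refine ⟨atTime 1 H, ⟨⟨⟨⟨fun x => H (x.1, x.2), by fun_prop⟩, fun t => ?_, fun t => rfl⟩,
    fun s t ht => ?_⟩⟩, fun t => ?_⟩
  · change H (0, t) = σ t
    rw [hH]
    split_ifs with ht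
    · change e (scale (1 + 0 * (c * r t)) (g t)) = σ t
      rw [zero_mul, add_zero, h.one_scale, hgr t ht.1]
    · rfl
  · change H (s, t) = σ t
    rw [hH, if_neg fun hU => hU.2 ht]
  · rw [atTime_apply, hH]
    split_ifs with ht
    · rintro ⟨y, hy, hye⟩
      have hye' : y = scale (1 + 1 * (c * r t)) (g t) := he.injective hye
      have hnn : 0 ≤ (c : ℝ) * r t := mul_nonneg (by positivity) (hrn t)
      by_cases htC : t ∈ C
      · refine hmono (g t) c (1 + 1 * (c * r t)) (by positivity) ?_ (hc t htC) (hye' ▸ hy)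
        rw [hr1 t htC]
        linarith
      · refine hmono (g t) 1 (1 + 1 * (c * r t)) zero_le_one (by linarith) ?_ (hye' ▸ hy)
        rw [h.one_scale]
        exact fun hgD => htC ⟨g t, hgD, hgr t ht.1⟩
    · exact fun htC => ht (hCU htC)

/-- General position: in the complement of a compact fibrewise star-shaped subset of a vector bundle
whose rank exceeds `i`, singular `i`-simplices can be compressed. -/
theorem compressible_compl_image [FiniteDimensional ℝ F] (h : IsFibreScaling F scale)
    (he : IsOpenEmbedding e) [T2Space M] {D : Set Y} (hD : IsCompact D)
    (hstar : ∀ y ∈ D, ∀ c ∈ Icc (0 : ℝ) 1, scale c y ∈ D) {i : ℕ}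
    (hi : i < Module.finrank ℝ F) : Compressible (e '' D)ᶜ i := by
  intro σ hσ
  have hS := isClosed_simplexBoundary i
  have hDc : IsClosed (e '' D) := (hD.image he.continuous).isClosed
  let C : Set (Simplex i) := σ ⁻¹' (e '' D)
  have hC : IsClosed C := hDc.preimage σ.continuous
  have hCS : C ⊆ (simplexBoundary i)ᶜ := fun t ht ht' => hσ t ht' ht
  -- each point of `C` has a closed neighborhood on which a fibre coordinate is defined
  have hloc : ∀ t ∈ C, ∃ Q : Set (Simplex i), Q ∈ 𝓝 t ∧ IsClosed Q ∧ Disjoint Q (simplexBoundary i) ∧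
      ∃ (W : Set Y) (φ : Y → F) (add : Y → F → Y), IsFibreCoordinate scale W φ add ∧
        ∀ t' ∈ Q, σ t' ∈ e '' W := by
    rintro t ht
    obtain ⟨y, hy, hyt⟩ := id ht
    obtain ⟨W, φ, add, hyW, hW⟩ := h.exists_coordinate y
    have hn : σ ⁻¹' (e '' W) ∩ (simplexBoundary i)ᶜ ∈ 𝓝 t :=
      Filter.inter_mem (((he.isOpenMap _ hW.isOpen).preimage σ.continuous).mem_nhds ⟨y, hyW, hyt⟩)
        (hS.isOpen_compl.mem_nhds (hCS ht))
    obtain ⟨Q, hQ, hQc, hQs⟩ := exists_mem_nhds_isClosed_subset hn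
    exact ⟨Q, hQ, hQc, disjoint_left.2 fun t' ht' => (hQs ht').2, W, φ, add, hW, fun t' ht' =>
      (hQs ht').1⟩
  choose! Q hQ hQc hQS W φ add hW hQW using hloc
  obtain ⟨s, hsC⟩ := hC.isCompact.elim_nhds_subcover' (fun t _ => interior (Q t))
    fun t ht => interior_mem_nhds.2 (hQ t ht)
  -- the open conditions that the perturbed simplex has to satisfy
  let O : Set (Simplex i) := ⋃ t ∈ s, interior (Q t)
  have hO : IsOpen O := isOpen_biUnion fun _ _ => isOpen_interior
  let V : Set M := e '' {y | scale 0 y ≠ y}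
  have hV : IsOpen V := by
    have : T2Space Y := T2Space.of_injective_continuous he.injective he.continuous
    exact he.isOpenMap _
      (isOpen_ne_fun (h.continuous.comp (Continuous.prodMk_right (0 : ℝ))) continuous_id)
  have step : ∀ s' : Finset C, s' ⊆ s → ∃ σ' : C(Simplex i, M),
      σ.HomotopicRel σ' (simplexBoundary i) ∧ (∀ t ∈ Oᶜ, σ' t ∈ (e '' D)ᶜ) ∧
      (∀ t ∈ s', ∀ t' ∈ Q t, σ' t' ∈ V) ∧
      ∀ t y, σ t = e y → ∃ y', σ' t = e y' ∧ scale 0 y' = scale 0 y := by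
    classical
    intro s'
    induction s' using Finset.induction_on with
    | empty =>
      intro _
      refine ⟨σ, .refl σ, fun t ht htC => ht ?_, by simp, fun t y hy => ⟨y, hy, rfl⟩⟩
      simpa [O] using hsC htC
    | insert a s' ha ih =>
      intro hs'
      obtain ⟨σ₁, hhom, hout, hin, hbase⟩ := ih fun x hx => hs' (Finset.mem_insert_of_mem hx)
      have hN1 : {τ : C(Simplex i, M) | MapsTo τ Oᶜ (e '' D)ᶜ} ∈ 𝓝 σ₁ :=
        (ContinuousMap.isOpen_setOfPred_mapsTo hO.isClosed_compl.isCompact hDc.isOpen_compl).mem_nhds hout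
      have hN2 : {τ : C(Simplex i, M) | MapsTo τ (⋃ t ∈ s', Q t) V} ∈ 𝓝 σ₁ := by
        refine (ContinuousMap.isOpen_setOfPred_mapsTo (IsClosed.isCompact ?_) hV).mem_nhds ?_
        · exact s'.finite_toSet.isClosed_biUnion fun t _ => hQc t t.2
        · intro t' ht'
          obtain ⟨t, ht, htQ⟩ := mem_iUnion₂.1 ht'
          exact hin t ht t' htQ
      obtain ⟨σ₂, ⟨hσ1, hσ2⟩, hhom₂, hne, hbase₂⟩ := exists_homotopicRel_ne_zero he hi (hW a a.2) σ₁
        (hQc a a.2) hS (fun t' ht' => by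
          obtain ⟨y, hy, hyt⟩ := hQW a a.2 t' ht'
          obtain ⟨y', hy', hb⟩ := hbase t' y hyt.symm
          exact ⟨y', (hW a a.2).saturated _ _ hb.symm hy, hy'.symm⟩) (hQS a a.2)
        (Filter.inter_mem hN1 hN2)
      refine ⟨σ₂, hhom.trans hhom₂, hσ1, fun t ht t' ht' => ?_, fun t y hy => ?_⟩
      · rcases Finset.mem_insert.1 ht with rfl | ht
        · obtain ⟨y, hy, hyt⟩ := hQW t t.2 t' ht'
          obtain ⟨y', hy', -⟩ := hbase t' y hyt.symm
          obtain ⟨y'', hy'', -⟩ := hbase₂ t' y' hy'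
          exact ⟨y'', hne t' ht' y'' hy'', hy''.symm⟩
        · exact hσ2 (mem_iUnion₂.2 ⟨t, ht, ht'⟩)
      · obtain ⟨y', hy', hb⟩ := hbase t y hy
        obtain ⟨y'', hy'', hb'⟩ := hbase₂ t y' hy'
        exact ⟨y'', hy'', hb'.trans hb⟩
  obtain ⟨σ₁, hhom, hout, hin, -⟩ := step s le_rfl
  obtain ⟨σ₂, hhom₂, hσ₂⟩ := exists_homotopicRel_push h he hD hstar σ₁ hS
    (fun t ht => by rw [← hhom.fst_eq_snd ht]; exact hσ t ht) (by
      intro t y hy hty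
      by_cases ht : t ∈ O
      · obtain ⟨a, ha, hta⟩ := mem_iUnion₂.1 ht
        obtain ⟨y', hy', hye⟩ := hin a ha t (interior_subset hta)
        rw [hty] at hye
        rwa [← he.injective hye]
      · exact absurd ⟨y, hy, hty.symm⟩ (hout t ht))
  exact ⟨σ₂, hhom.trans hhom₂, hσ₂⟩

end Scaling

/-! ### Frames and orthogonal projections -/

section Frame

variable {𝕜 E : Type*} [RCLike 𝕜] [NormedAddCommGroup E] [InnerProductSpace 𝕜 E] [CompleteSpace E]
  {m : ℕ}

/-- The operator `𝕜ᵐ → E` that sends the standard basis to the vectors `b`. -/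
def frameMap (b : Fin m → E) : EuclideanSpace 𝕜 (Fin m) →L[𝕜] E :=
  ∑ j, (EuclideanSpace.proj j : EuclideanSpace 𝕜 (Fin m) →L[𝕜] 𝕜).smulRight (b j)

omit [CompleteSpace E] in
theorem frameMap_apply (b : Fin m → E) (v : EuclideanSpace 𝕜 (Fin m)) :
    frameMap b v = ∑ j, v j • b j := by
  simp [frameMap]

omit [CompleteSpace E] in
theorem frameMap_single (b : Fin m → E) (j : Fin m) :
    frameMap b (EuclideanSpace.single j (1 : 𝕜)) = b j := by
  classical
  rw [frameMap_apply, Finset.sum_eq_single j]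
  · simp
  · intro i _ hi
    simp [hi]
  · simp

/-- The pseudo-inverse `(T* T)⁻¹ T*` of the operator given by a frame. -/
def frameInv (b : Fin m → E) : E →L[𝕜] EuclideanSpace 𝕜 (Fin m) :=
  Ring.inverse (ContinuousLinearMap.adjoint (frameMap (𝕜 := 𝕜) b) ∘L frameMap b) ∘L
    ContinuousLinearMap.adjoint (frameMap b)

omit [CompleteSpace E] in
theorem frameMap_injective {b : Fin m → E} (hb : LinearIndependent 𝕜 b) :
    Function.Injective (frameMap (𝕜 := 𝕜) b) := by
  rw [injective_iff_map_eq_zero]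
  intro v hv
  rw [frameMap_apply] at hv
  ext j
  exact Fintype.linearIndependent_iff.1 hb _ hv j

theorem isUnit_gram {b : Fin m → E} (hb : LinearIndependent 𝕜 b) :
    IsUnit (ContinuousLinearMap.adjoint (frameMap (𝕜 := 𝕜) b) ∘L frameMap b) := by
  rw [ContinuousLinearMap.isUnit_iff_isUnit_toLinearMap, LinearMap.isUnit_iff_ker_eq_bot,
    LinearMap.ker_eq_bot']
  intro v hv
  have hv' : ContinuousLinearMap.adjoint (frameMap (𝕜 := 𝕜) b) (frameMap b v) = 0 := hv
  refine frameMap_injective hb ?_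
  rw [map_zero, ← inner_self_eq_zero (𝕜 := 𝕜), ← ContinuousLinearMap.adjoint_inner_left, hv',
    inner_zero_left]

theorem linearIndependent_of_isUnit_gram {b : Fin m → E}
    (hb : IsUnit (ContinuousLinearMap.adjoint (frameMap (𝕜 := 𝕜) b) ∘L frameMap b)) :
    LinearIndependent 𝕜 b := by
  rw [Fintype.linearIndependent_iff]
  intro g hg j
  have h0 : frameMap b (WithLp.toLp 2 g : EuclideanSpace 𝕜 (Fin m)) = 0 := by
    rw [frameMap_apply]
    exact hg
  have h1 := (ContinuousLinearMap.isUnit_iff_bijective.1 hb).1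
    (a₁ := (WithLp.toLp 2 g : EuclideanSpace 𝕜 (Fin m))) (a₂ := 0) (by simp [h0])
  exact congrArg (fun v : EuclideanSpace 𝕜 (Fin m) => v j) h1

theorem starProjection_span_range {b : Fin m → E} (hb : LinearIndependent 𝕜 b)
    [(Submodule.span 𝕜 (range b)).HasOrthogonalProjection] :
    (Submodule.span 𝕜 (range b)).starProjection = frameMap b ∘L frameInv b := by
  ext1 u
  refine (Submodule.eq_starProjection_of_mem_of_inner_eq_zero
    (K := Submodule.span 𝕜 (range b))
    (u := u) (v := (frameMap (𝕜 := 𝕜) b ∘L frameInv b) u) ?_ ?_)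
  · change frameMap b (frameInv b u) ∈ _
    rw [frameMap_apply]
    exact Submodule.sum_mem _ fun j _ => Submodule.smul_mem _ _ (Submodule.subset_span ⟨j, rfl⟩)
  · set z := u - (frameMap (𝕜 := 𝕜) b ∘L frameInv b) u with hz
    have h := congrArg (fun A : EuclideanSpace 𝕜 (Fin m) →L[𝕜] EuclideanSpace 𝕜 (Fin m) =>
      A (ContinuousLinearMap.adjoint (frameMap b) u)) (Ring.mul_inverse_cancel _ (isUnit_gram hb))
    have h' : ContinuousLinearMap.adjoint (frameMap (𝕜 := 𝕜) b) z = 0 := by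
      rw [hz, map_sub, sub_eq_zero]
      exact h.symm
    intro w hw
    refine Submodule.span_induction
      (p := fun w _ => inner 𝕜 z w = 0) ?_ ?_ ?_ ?_ hw
    · rintro _ ⟨j, rfl⟩
      rw [← frameMap_single (𝕜 := 𝕜) b j, ← ContinuousLinearMap.adjoint_inner_left, h',
        inner_zero_left]
    · simp
    · intro x y _ _ hx hy
      rw [inner_add_right, hx, hy, add_zero]
    · intro a x _ hx
      rw [inner_smul_right, hx, mul_zero]

section Continuity

variable {Y : Type*} [TopologicalSpace Y] {y₀ : Y} {b : Fin m → Y → E}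

omit [CompleteSpace E] in
theorem continuousAt_frameMap (hb : ∀ j, ContinuousAt (b j) y₀) :
    ContinuousAt (fun y => frameMap (𝕜 := 𝕜) fun j => b j y) y₀ := by
  unfold frameMap
  refine tendsto_finsetSum _ fun j _ => ?_
  exact ((ContinuousLinearMap.smulRightL 𝕜 (EuclideanSpace 𝕜 (Fin m)) E
    (EuclideanSpace.proj j)).continuous.continuousAt).comp (hb j)

theorem continuousAt_gram (hb : ∀ j, ContinuousAt (b j) y₀) :
    ContinuousAt (fun y => ContinuousLinearMap.adjoint (frameMap (𝕜 := 𝕜) fun j => b j y) ∘L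
      frameMap fun j => b j y) y₀ :=
  (((ContinuousLinearMap.adjoint (𝕜 := 𝕜)).continuous.continuousAt).comp
    (continuousAt_frameMap hb)).clm_comp (continuousAt_frameMap hb)

theorem eventually_linearIndependent (hb : ∀ j, ContinuousAt (b j) y₀)
    (hli : LinearIndependent 𝕜 fun j => b j y₀) :
    ∀ᶠ y in 𝓝 y₀, LinearIndependent 𝕜 fun j => b j y := by
  have := (continuousAt_gram (𝕜 := 𝕜) hb).eventually
    (Units.isOpen.mem_nhds (isUnit_gram hli))
  exact this.mono fun y hy => linearIndependent_of_isUnit_gram hy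

theorem continuousAt_frameInv (hb : ∀ j, ContinuousAt (b j) y₀)
    (hli : LinearIndependent 𝕜 fun j => b j y₀) :
    ContinuousAt (fun y => frameInv (𝕜 := 𝕜) fun j => b j y) y₀ := by
  obtain ⟨u, hu⟩ := isUnit_gram hli
  refine ContinuousAt.clm_comp ?_ (((ContinuousLinearMap.adjoint (𝕜 := 𝕜)).continuous.continuousAt).comp
    (continuousAt_frameMap hb))
  refine ContinuousAt.comp (g := Ring.inverse) ?_ (continuousAt_gram hb)
  rw [← hu]
  exact NormedRing.inverse_continuousAt u

end Continuity

end Frame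

/-! ### Maps to the Grassmannian -/

theorem Gr.starProjection_range {n : ℕ} (P : Gr n) : ∃ _ : P.1.range.HasOrthogonalProjection,
    P.1 = P.1.range.starProjection :=
  isStarProjection_iff_eq_starProjection_range.1 P.2.1

theorem Gr.ext_range {n : ℕ} {P Q : Gr n} (h : P.1.range = Q.1.range) : P = Q := by
  obtain ⟨_, hP⟩ := P.starProjection_range
  obtain ⟨_, hQ⟩ := Q.starProjection_range
  refine Subtype.ext ?_
  rw [hP, hQ]
  congr 1

theorem Gr.eq_of_range_le {n : ℕ} {P Q : Gr n} (h : P.1.range ≤ Q.1.range) : P = Q := by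
  have := Q.2.2.1
  exact Gr.ext_range (Submodule.eq_of_le_of_finrank_eq h (P.2.2.2.trans Q.2.2.2.symm))

/-- The point of the Grassmannian given by a subspace. -/
def Gr.ofSubmodule {n : ℕ} (S : Submodule ℂ Hil) [FiniteDimensional ℂ S]
    (h : Module.finrank ℂ S = n) : Gr n :=
  ⟨S.starProjection, isStarProjection_starProjection, by
    rw [Submodule.range_starProjection]
    exact ⟨inferInstance, h⟩⟩

theorem Gr.range_ofSubmodule {n : ℕ} (S : Submodule ℂ Hil) [FiniteDimensional ℂ S]
    (h : Module.finrank ℂ S = n) : (Gr.ofSubmodule S h).1.range = S :=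
  Submodule.range_starProjection S

/-- A map to the Grassmannian is continuous if every vector of the pulled back tautological bundle
extends locally to a continuous section. -/
theorem Gr.continuous_of_local_sections {n : ℕ} {Y : Type*} [TopologicalSpace Y] {Q : Y → Gr n}
    (h : ∀ y₀, ∀ w ∈ (Q y₀).1.range, ∃ b : Y → Hil, ContinuousAt b y₀ ∧ b y₀ = w ∧
      ∀ᶠ y in 𝓝 y₀, b y ∈ (Q y).1.range) : Continuous Q := by
  refine Continuous.subtype_mk (f := fun y => (Q y).1) ?_ fun y => (Q y).2
  rw [continuous_iff_continuousAt]
  intro y₀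
  have := (Q y₀).2.2.1
  let B := Module.finBasisOfFinrankEq ℂ (Q y₀).1.range (Q y₀).2.2.2
  choose b hbc hb0 hbm using fun j : Fin n => h y₀ (B j) (B j).2
  have hli : LinearIndependent ℂ fun j => b j y₀ := by
    simp only [hb0]
    exact B.linearIndependent.map' (Submodule.subtype _) (Submodule.ker_subtype _)
  have hcont : ContinuousAt (fun y => frameMap (𝕜 := ℂ) (fun j => b j y) ∘L frameInv fun j => b j y)
      y₀ := (continuousAt_frameMap hbc).clm_comp (continuousAt_frameInv hbc hli)
  refine hcont.congr ?_
  filter_upwards [eventually_linearIndependent hbc hli, Filter.eventually_all.2 hbm] with y hy hm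
  have := (Q y).2.2.1
  have hle : Submodule.span ℂ (range fun j => b j y) ≤ (Q y).1.range :=
    Submodule.span_le.2 (by rintro _ ⟨j, rfl⟩; exact hm j)
  have heq := Submodule.eq_of_le_of_finrank_eq hle (by
    rw [finrank_span_eq_card hy, (Q y).2.2.2, Fintype.card_fin])
  obtain ⟨_, hQ⟩ := (Q y).starProjection_range
  have : (Submodule.span ℂ (range fun j => b j y)).HasOrthogonalProjection := by rwa [heq]
  rw [← starProjection_span_range hy, hQ]
  congr 1

/-! ### Two embeddings of `ℓ²` with complementary ranges -/

/-- The operator of `ℓ²` that moves the `k`-th coordinate to the position `g k`. -/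
theorem exists_coordinate_shift (g : ℕ → ℕ) (hg : Function.Injective g) :
    ∃ S : Hil →L[ℂ] Hil, (∀ x k, S x (g k) = x k) ∧ ∀ x j, j ∉ range g → S x j = 0 := by
  have h0 : ∀ (x : Hil) j, j ∉ range g → Function.extend g x 0 j = 0 := fun x j hj =>
    Function.extend_apply' _ _ _ fun ⟨k, hk⟩ => hj ⟨k, hk⟩
  have h1 : ∀ (x : Hil) k, Function.extend g x 0 (g k) = x k := fun x k => hg.extend_apply _ _ _
  have h2 : (0 : ℝ) < (2 : ENNReal).toReal := by norm_num
  have h0' : ∀ (x : Hil) j, j ∉ range g →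
      ‖Function.extend g x (0 : ℕ → ℂ) j‖ ^ (2 : ENNReal).toReal = 0 := fun x j hj => by
    rw [h0 x j hj, norm_zero, Real.zero_rpow h2.ne']
  have hcomp : ∀ x : Hil, (fun j => ‖Function.extend g x (0 : ℕ → ℂ) j‖ ^ (2 : ENNReal).toReal) ∘ g =
      fun k => ‖x k‖ ^ (2 : ENNReal).toReal := fun x => funext fun k => by
    simp only [Function.comp_apply, h1]
  have hmem : ∀ x : Hil, Memℓp (E := fun _ : ℕ => ℂ) (Function.extend g x 0) 2 := fun x => by
    refine memℓp_gen ?_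
    rw [← hg.summable_iff (h0' x), hcomp]
    exact (lp.memℓp x).summable h2
  let S : Hil →ₗ[ℂ] Hil :=
    { toFun := fun x => ⟨Function.extend g x 0, hmem x⟩
      map_add' := fun x y => by
        ext j
        change Function.extend g _ 0 j = Function.extend g x 0 j + Function.extend g y 0 j
        by_cases hj : j ∈ range g
        · obtain ⟨k, rfl⟩ := hj
          rw [h1, h1, h1]
          rfl
        · rw [h0 _ j hj, h0 _ j hj, h0 _ j hj, add_zero]
      map_smul' := fun c x => by
        ext j
        change Function.extend g _ 0 j = c * Function.extend g x 0 j
        by_cases hj : j ∈ range g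
        · obtain ⟨k, rfl⟩ := hj
          rw [h1, h1]
          rfl
        · rw [h0 _ j hj, h0 _ j hj, mul_zero] }
  refine ⟨S.mkContinuous 1 fun x => ?_, h1, h0⟩
  rw [one_mul]
  refine le_of_eq ((Real.rpow_left_inj (norm_nonneg _) (norm_nonneg _) h2.ne').1 ?_)
  rw [lp.norm_rpow_eq_tsum h2, lp.norm_rpow_eq_tsum h2, ← hcomp x]
  exact (hg.tsum_eq fun j hj => by_contra fun h => hj (h0' x j h)).symm

/-- Two endomorphisms of `ℓ²` with independent ranges, each of which can be joined to the identity
by a segment of injective operators. -/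
theorem exists_complementary_shifts : ∃ S₀ S₁ : Hil →L[ℂ] Hil,
    (∀ x y, S₀ x + S₁ y = 0 → x = 0 ∧ y = 0) ∧
    (∀ (t : ℝ) x, (1 - t) • x + t • S₀ x = 0 → x = 0) ∧
    ∀ (t : ℝ) x, (1 - t) • x + t • S₁ x = 0 → x = 0 := by
  obtain ⟨S₀, h0, h0'⟩ := exists_coordinate_shift (fun k => 2 * k) fun a b h => by simpa using h
  obtain ⟨S₁, h1, h1'⟩ := exists_coordinate_shift (fun k => 2 * k + 1) fun a b h => by simpa using h
  have hodd : ∀ k, 2 * k + 1 ∉ range fun k : ℕ => 2 * k := by rintro k ⟨l, hl⟩; simp only at hl; omega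
  have heven : ∀ k, 2 * k ∉ range fun k : ℕ => 2 * k + 1 := by
    rintro k ⟨l, hl⟩; simp only at hl; omega
  -- the coordinates of a solution vanish successively
  have key : ∀ (S : Hil →L[ℂ] Hil), (∀ x, S x = 0 → x = 0) →
      (∀ x : Hil, (∀ j, x j = 0 ∨ S x j = 0 ∨ (S x j = x j ∧ j = 0) ∨ ∃ k < j, S x j = x k)) →
      ∀ (t : ℝ) x, (1 - t) • x + t • S x = 0 → x = 0 := by
    intro S hS hcoord t x h
    rcases eq_or_ne t 1 with rfl | ht
    · exact hS x (by simpa using h)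
    have hj : ∀ j, ((1 - t : ℝ) : ℂ) * x j + (t : ℂ) * S x j = 0 := fun j => by
      have := congrArg (fun f : Hil => f j) h
      change (1 - t) • x j + t • S x j = 0 at this
      simpa only [Complex.real_smul] using this
    have ht' : ((1 - t : ℝ) : ℂ) ≠ 0 := by
      exact_mod_cast sub_ne_zero.2 ht.symm
    ext j
    change x j = 0
    induction j using Nat.strong_induction_on with
    | _ j ih =>
      have hz : S x j = 0 → x j = 0 := fun hs => by
        have := hj j
        rw [hs, mul_zero, add_zero] at this
        exact (mul_eq_zero.1 this).resolve_left ht'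
      rcases hcoord x j with h | h | ⟨h, -⟩ | ⟨k, hk, h⟩
      · exact h
      · exact hz h
      · have := hj j
        rw [h, ← add_mul] at this
        push_cast at this
        simpa using this
      · exact hz (h.trans (ih k hk))
  refine ⟨S₀, S₁, fun x y h => ⟨?_, ?_⟩, key S₀ (fun x hx => ?_) fun x j => ?_,
    key S₁ (fun x hx => ?_) fun x j => ?_⟩
  · ext k
    have := congrArg (fun f : Hil => f (2 * k)) h
    simpa [h0 x k, h1' y _ (heven k)] using this
  · ext k
    have := congrArg (fun f : Hil => f (2 * k + 1)) h
    simpa [h1 y k, h0' x _ (hodd k)] using this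
  · ext k
    rw [← h0 x k, hx]
    rfl
  · obtain ⟨k, rfl | rfl⟩ := Nat.even_or_odd' j
    · rcases k.eq_zero_or_pos with rfl | hk
      · exact Or.inr (Or.inr (Or.inl ⟨h0 x 0, rfl⟩))
      · exact Or.inr (Or.inr (Or.inr ⟨k, by omega, h0 x k⟩))
    · exact Or.inr (Or.inl (h0' x _ (hodd k)))
  · ext k
    rw [← h1 x k, hx]
    rfl
  · obtain ⟨k, rfl | rfl⟩ := Nat.even_or_odd' j
    · exact Or.inr (Or.inl (h1' x _ (heven k)))
    · exact Or.inr (Or.inr (Or.inr ⟨k, by omega, h1 x k⟩))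

/-! ### Local sections of hyperplane fields and the exterior derivative -/

section Sections

variable {n : ℕ} {M : Type*} [TopologicalSpace M] [ChartedSpace (Euc (2 * n + 1)) M]
  [IsManifold (𝓡 (2 * n + 1)) ∞ M]

local notation "TM" => TangentBundle (𝓡 (2 * n + 1)) M
local notation "𝓘ₙ" => 𝓡 (2 * n + 1)

/-- The local vector field that has constant components `v` in the preferred chart at `x₀`. -/
def constField (x₀ : M) (v : Euc (2 * n + 1)) (x : M) : TangentSpace 𝓘ₙ x :=
  (trivializationAt (Euc (2 * n + 1)) (TangentSpace 𝓘ₙ) x₀).symmL ℝ x v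

/-- The components of a tangent vector in the preferred chart at `x₀`. -/
def components (x₀ x : M) : TangentSpace 𝓘ₙ x →L[ℝ] Euc (2 * n + 1) :=
  (trivializationAt (Euc (2 * n + 1)) (TangentSpace 𝓘ₙ) x₀).continuousLinearMapAt ℝ x

theorem mem_baseSet_tangent {x₀ x : M} :
    x ∈ (trivializationAt (Euc (2 * n + 1)) (TangentSpace 𝓘ₙ) x₀).baseSet ↔
      x ∈ (chartAt (Euc (2 * n + 1)) x₀).source := by
  rw [TangentBundle.trivializationAt_baseSet]

theorem components_constField {x₀ x : M} (hx : x ∈ (chartAt (Euc (2 * n + 1)) x₀).source)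
    (v : Euc (2 * n + 1)) : components x₀ x (constField x₀ v x) = v :=
  Trivialization.continuousLinearMapAt_symmL _ (mem_baseSet_tangent.2 hx) v

theorem constField_components {x₀ x : M} (hx : x ∈ (chartAt (Euc (2 * n + 1)) x₀).source)
    (v : TangentSpace 𝓘ₙ x) : constField x₀ (components x₀ x v) x = v :=
  Trivialization.symmL_continuousLinearMapAt _ (mem_baseSet_tangent.2 hx) v

omit [IsManifold (𝓡 (2 * n + 1)) ∞ M] in
theorem source_mem_nhds (x₀ : M) : (chartAt (Euc (2 * n + 1)) x₀).source ∈ 𝓝 x₀ :=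
  (chartAt (Euc (2 * n + 1)) x₀).open_source.mem_nhds (mem_chart_source _ x₀)

theorem continuousAt_constField {x₀ x : M} (hx : x ∈ (chartAt (Euc (2 * n + 1)) x₀).source)
    {Y : Type*} [TopologicalSpace Y] {y : Y} {f : Y → M} (hf : ContinuousAt f y) (hfy : f y = x)
    {φ : Y → Euc (2 * n + 1)} (hφ : ContinuousAt φ y) :
    ContinuousAt (fun y => (⟨f y, constField x₀ (φ y) (f y)⟩ : TM)) y := by
  subst hfy
  have hb := mem_baseSet_tangent.2 hx
  set e := trivializationAt (Euc (2 * n + 1)) (TangentSpace 𝓘ₙ) x₀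
  have h1 : ContinuousAt (fun y => e.toOpenPartialHomeomorph.symm (f y, φ y)) y := by
    refine ContinuousAt.comp (g := e.toOpenPartialHomeomorph.symm) (f := fun y => (f y, φ y))
      (e.toOpenPartialHomeomorph.continuousAt_symm ?_) (hf.prodMk hφ)
    exact e.mk_mem_target.2 hb
  refine h1.congr ?_
  filter_upwards [hf.preimage_mem_nhds (e.open_baseSet.mem_nhds hb)] with z hz
  rw [← e.mk_symm hz (φ z), constField, e.symmL_apply hz]

theorem continuousAt_components {x₀ x : M} (hx : x ∈ (chartAt (Euc (2 * n + 1)) x₀).source)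
    {Y : Type*} [TopologicalSpace Y] {y : Y} {V : Y → TM} (hV : ContinuousAt V y)
    (hy : (V y).1 = x) : ContinuousAt (fun y => components x₀ (V y).1 (V y).2) y := by
  subst hy
  have hb := mem_baseSet_tangent.2 hx
  set e := trivializationAt (Euc (2 * n + 1)) (TangentSpace 𝓘ₙ) x₀
  have hs : V y ∈ e.source := e.mem_source.2 hb
  have h1 : ContinuousAt (fun y => (e (V y)).2) y :=
    (ContinuousAt.comp (g := e) (e.continuousAt hs) hV).snd
  refine h1.congr ?_
  have : ∀ᶠ z in 𝓝 y, (V z).1 ∈ e.baseSet :=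
    (hV.eventually (e.open_source.mem_nhds hs)).mono fun z hz => e.mem_source.1 hz
  filter_upwards [this] with z hz
  exact (e.continuousLinearMapAt_apply_of_mem (R := ℝ) hz (V z).2).symm

theorem OneForm.IsSmooth.continuousAt_apply {α : OneForm n M} (hα : α.IsSmooth)
    {Y : Type*} [TopologicalSpace Y] {y : Y} {V : Y → TM} (hV : ContinuousAt V y) :
    ContinuousAt (fun y => (α (V y).1 (V y).2 : ℝ)) y := by
  have h1 : ContinuousAt (fun z : Y => (V z).1) y :=
    (FiberBundle.continuous_proj (Euc (2 * n + 1)) (TangentSpace 𝓘ₙ)).continuousAt.comp hV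
  have h2 : ContinuousAt (fun z => (TotalSpace.mk' (Euc (2 * n + 1) →L[ℝ] ℝ) (V z).1 (α (V z).1) :
      TotalSpace (Euc (2 * n + 1) →L[ℝ] ℝ)
        (fun x : M => TangentSpace 𝓘ₙ x →L[ℝ] Bundle.Trivial M ℝ x))) y :=
    ContinuousAt.comp (g := fun x => (TotalSpace.mk' (Euc (2 * n + 1) →L[ℝ] ℝ) x (α x) :
      TotalSpace (Euc (2 * n + 1) →L[ℝ] ℝ)
        (fun x : M => TangentSpace 𝓘ₙ x →L[ℝ] Bundle.Trivial M ℝ x))) hα.continuous.continuousAt h1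
  have h3 := ContinuousAt.clm_bundle_apply (F₁ := Euc (2 * n + 1)) (F₂ := ℝ)
    (E₁ := fun x : M => TangentSpace 𝓘ₙ x) (E₂ := Bundle.Trivial M ℝ) (b := fun z => (V z).1)
    (ϕ := fun z => α (V z).1) (v := fun z => (V z).2) h2 hV
  exact ((Bundle.Trivial.homeomorphProd M ℝ).continuous.snd.continuousAt).comp h3

theorem constField_self (x : M) (v : TangentSpace 𝓘ₙ x) : constField x v x = v := by
  have h : (trivializationAt (Euc (2 * n + 1)) (TangentSpace 𝓘ₙ) x).symmL ℝ x =
      ContinuousLinearMap.id ℝ _ := by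
    rw [TangentBundle.symmL_trivializationAt (mem_chart_source _ x)]
    exact mfderivWithin_range_extChartAt_symm
  change (trivializationAt (Euc (2 * n + 1)) (TangentSpace 𝓘ₙ) x).symmL ℝ x v = v
  rw [h]
  rfl

/-- A vector of the hyperplane field `ker α` extends to a continuous local section. -/
theorem OneForm.exists_local_section {α : OneForm n M} (hα : α.IsSmooth)
    (hne : ∀ x, ∃ v, α x v ≠ 0) (x₀ : M) {w : TangentSpace 𝓘ₙ x₀} (hw : α x₀ w = 0) :
    ∃ φ : M → Euc (2 * n + 1), ContinuousAt φ x₀ ∧ constField x₀ (φ x₀) x₀ = w ∧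
      ∀ᶠ x in 𝓝 x₀, α x (constField x₀ (φ x) x) = 0 := by
  obtain ⟨r, hr⟩ := hne x₀
  have hc : ∀ v : Euc (2 * n + 1), ContinuousAt (fun x => (α x (constField x₀ v x) : ℝ)) x₀ := fun v =>
    hα.continuousAt_apply
      (continuousAt_constField (mem_chart_source _ x₀) continuousAt_id rfl continuousAt_const)
  have hlin : ∀ x (u v : Euc (2 * n + 1)) (c : ℝ), (α x (constField x₀ (u - c • v) x) : ℝ) =
      α x (constField x₀ u x) - c * α x (constField x₀ v x) := fun x u v c => by
    simp only [constField, map_sub, map_smul]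
    rfl
  have hr0 : (α x₀ (constField x₀ r x₀) : ℝ) ≠ 0 := by rwa [constField_self]
  have hw0 : (α x₀ (constField x₀ w x₀) : ℝ) = 0 := by rwa [constField_self]
  let c : M → ℝ := fun x => (α x (constField x₀ w x) : ℝ) / (α x (constField x₀ r x) : ℝ)
  refine ⟨fun x => (w : Euc (2 * n + 1)) - c x • (r : Euc (2 * n + 1)), ?_, ?_, ?_⟩
  · exact continuousAt_const.sub (((hc w).div (hc r) hr0).smul continuousAt_const)
  · have : c x₀ = 0 := by simp only [c, hw0, zero_div]
    simp only [this, zero_smul, sub_zero]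
    exact constField_self x₀ w
  · filter_upwards [(hc r).eventually_ne hr0] with x hx
    refine (hlin x w r (c x)).trans ?_
    simp only [c]
    rw [div_mul_cancel₀ _ hx, sub_self]

omit [IsManifold (𝓡 (2 * n + 1)) ∞ M] in
theorem mem_chart_source_symm {x₀ : M} {y : Euc (2 * n + 1)} (hy : y ∈ (extChartAt 𝓘ₙ x₀).target) :
    (extChartAt 𝓘ₙ x₀).symm y ∈ (chartAt (Euc (2 * n + 1)) x₀).source := by
  rw [← extChartAt_source 𝓘ₙ]
  exact (extChartAt 𝓘ₙ x₀).map_target hy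

theorem OneForm.inChart_apply (α : OneForm n M) {x₀ : M} {y : Euc (2 * n + 1)}
    (hy : y ∈ (extChartAt 𝓘ₙ x₀).target) (v : Euc (2 * n + 1)) :
    α.inChart x₀ y v =
      α ((extChartAt 𝓘ₙ x₀).symm y) (constField x₀ v ((extChartAt 𝓘ₙ x₀).symm y)) := by
  have h := TangentBundle.symmL_trivializationAt (I := 𝓘ₙ) (mem_chart_source_symm hy)
  rw [(extChartAt 𝓘ₙ x₀).right_inv hy] at h
  rw [constField, h, ModelWithCorners.Boundaryless.range_eq_univ, mfderivWithin_univ]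
  rfl

theorem contMDiffOn_constField (x₀ : M) (v : Euc (2 * n + 1)) :
    ContMDiffOn 𝓘ₙ ((𝓘ₙ).prod 𝓘(ℝ, Euc (2 * n + 1))) ∞ (fun x => (⟨x, constField x₀ v x⟩ : TM))
      (chartAt (Euc (2 * n + 1)) x₀).source := by
  set e := trivializationAt (Euc (2 * n + 1)) (TangentSpace 𝓘ₙ) x₀ with he
  have h1 := e.contMDiffOn_symm (IB := 𝓘ₙ) (n := ∞)
  have h2 : ContMDiffOn 𝓘ₙ ((𝓘ₙ).prod 𝓘(ℝ, Euc (2 * n + 1))) ∞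
      (fun x : M => (x, v)) (chartAt (Euc (2 * n + 1)) x₀).source :=
    (contMDiff_id.prodMk contMDiff_const).contMDiffOn
  refine (h1.comp h2 fun x hx => e.mk_mem_target.2 (mem_baseSet_tangent.2 hx)).congr fun x hx => ?_
  have hx' := mem_baseSet_tangent.2 hx
  rw [Function.comp_apply, ← e.mk_symm hx' v, ← e.symmL_apply (R := ℝ) hx']
  rfl

theorem OneForm.IsSmooth.contDiffOn_inChart {α : OneForm n M} (hα : α.IsSmooth) (x₀ : M) :
    ContDiffOn ℝ ∞ (α.inChart x₀) (extChartAt 𝓘ₙ x₀).target := by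
  rw [contDiffOn_clm_apply]
  intro v
  have h1 : ContMDiffOn 𝓘ₙ ((𝓘ₙ).prod 𝓘(ℝ, ℝ)) ∞
      (fun x => (⟨x, α x (constField x₀ v x)⟩ : TotalSpace ℝ (Bundle.Trivial M ℝ)))
      (chartAt (Euc (2 * n + 1)) x₀).source :=
    ContMDiffOn.clm_bundle_apply (F₁ := Euc (2 * n + 1)) (F₂ := ℝ)
      (E₁ := fun x : M => TangentSpace 𝓘ₙ x) (E₂ := Bundle.Trivial M ℝ) (b := fun x => x)
      (ϕ := fun x => α x) (v := fun x => constField x₀ v x) hα.contMDiffOn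
      (contMDiffOn_constField x₀ v)
  have h2 : ContMDiffOn 𝓘ₙ 𝓘(ℝ, ℝ) ∞ (fun x => (α x (constField x₀ v x) : ℝ))
      (chartAt (Euc (2 * n + 1)) x₀).source := fun x hx =>
    ((contMDiffWithinAt_totalSpace (F := ℝ) (E := Bundle.Trivial M ℝ)).1 (h1 x hx)).2
  rw [← contMDiffOn_iff_contDiffOn]
  refine (h2.comp (contMDiffOn_extChartAt_symm x₀) fun y hy => mem_chart_source_symm hy).congr
    fun y hy => ?_
  exact α.inChart_apply hy v

omit [IsManifold (𝓡 (2 * n + 1)) ∞ M] in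
theorem extChart_target_mem_nhds {x₀ x : M} (hx : x ∈ (chartAt (Euc (2 * n + 1)) x₀).source) :
    (extChartAt 𝓘ₙ x₀).target ∈ 𝓝 (extChartAt 𝓘ₙ x₀ x) :=
  (isOpen_extChartAt_target x₀).mem_nhds ((extChartAt 𝓘ₙ x₀).map_source (by rwa [extChartAt_source]))

theorem OneForm.IsSmooth.contDiffAt_inChart {α : OneForm n M} (hα : α.IsSmooth) {x₀ x : M}
    (hx : x ∈ (chartAt (Euc (2 * n + 1)) x₀).source) :
    ContDiffAt ℝ ∞ (α.inChart x₀) (extChartAt 𝓘ₙ x₀ x) :=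
  (hα.contDiffOn_inChart x₀).contDiffAt (extChart_target_mem_nhds hx)

theorem OneForm.inChart_self (α : OneForm n M) (x : M) (v : TangentSpace 𝓘ₙ x) :
    α.inChart x (extChartAt 𝓘ₙ x x) v = α x v := by
  have hx : (extChartAt 𝓘ₙ x).symm (extChartAt 𝓘ₙ x x) = x :=
    (extChartAt 𝓘ₙ x).left_inv (mem_extChartAt_source x)
  refine (α.inChart_apply (mem_of_mem_nhds (extChart_target_mem_nhds (mem_chart_source _ x)))
    v).trans ?_
  rw [hx, constField_self]

/-- The exterior derivative of `1`-forms on a vector space commutes with pull-back. -/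
theorem fderiv_pullback_antisymm {E : Type*} [NormedAddCommGroup E] [NormedSpace ℝ E]
    {a : E → E →L[ℝ] ℝ} {τ : E → E} {p : E} (ha : DifferentiableAt ℝ a (τ p))
    (hτ : ContDiffAt ℝ 2 τ p) (u v : E) :
    fderiv ℝ (fun y => (a (τ y)).comp (fderiv ℝ τ y)) p u v -
        fderiv ℝ (fun y => (a (τ y)).comp (fderiv ℝ τ y)) p v u =
      fderiv ℝ a (τ p) (fderiv ℝ τ p u) (fderiv ℝ τ p v) -
        fderiv ℝ a (τ p) (fderiv ℝ τ p v) (fderiv ℝ τ p u) := by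
  have h1 : HasFDerivAt τ (fderiv ℝ τ p) p :=
    (hτ.differentiableAt (by norm_num)).hasFDerivAt
  have h2 : HasFDerivAt (fderiv ℝ τ) (fderiv ℝ (fderiv ℝ τ) p) p :=
    ((hτ.fderiv_right (m := 1) (by norm_num)).differentiableAt (by norm_num)).hasFDerivAt
  have h3 : HasFDerivAt (fun y => a (τ y)) ((fderiv ℝ a (τ p)).comp (fderiv ℝ τ p)) p :=
    ha.hasFDerivAt.comp p h1
  rw [(h3.clm_comp h2).fderiv]
  have hsymm : fderiv ℝ (fderiv ℝ τ) p u v = fderiv ℝ (fderiv ℝ τ) p v u :=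
    (hτ.isSymmSndFDerivAt (by simp)).eq u v
  simp [hsymm]

/-- The exterior derivative can be computed in the preferred chart at any nearby point. -/
theorem OneForm.IsSmooth.d_eq {α : OneForm n M} (hα : α.IsSmooth) {x₀ x : M}
    (hx : x ∈ (chartAt (Euc (2 * n + 1)) x₀).source) (u v : Euc (2 * n + 1)) :
    α.d x (constField x₀ u x) (constField x₀ v x) =
      fderiv ℝ (α.inChart x₀) (extChartAt 𝓘ₙ x₀ x) u v -
        fderiv ℝ (α.inChart x₀) (extChartAt 𝓘ₙ x₀ x) v u := by
  let τ : Euc (2 * n + 1) → Euc (2 * n + 1) := extChartAt 𝓘ₙ x₀ ∘ (extChartAt 𝓘ₙ x).symm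
  set p := extChartAt 𝓘ₙ x x with hp
  have hpx : (extChartAt 𝓘ₙ x).symm p = x := (extChartAt 𝓘ₙ x).left_inv (mem_extChartAt_source x)
  have hτp : τ p = extChartAt 𝓘ₙ x₀ x := congrArg (extChartAt 𝓘ₙ x₀) hpx
  have hnear : ∀ᶠ y in 𝓝 p, y ∈ (extChartAt 𝓘ₙ x).target ∧
      (extChartAt 𝓘ₙ x).symm y ∈ (chartAt (Euc (2 * n + 1)) x₀).source := by
    refine Filter.Eventually.and (p := fun y => y ∈ (extChartAt 𝓘ₙ x).target)
      (extChart_target_mem_nhds (mem_chart_source _ x)) ?_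
    refine (continuousAt_extChartAt_symm x).eventually ?_
    rw [hpx]
    exact (chartAt (Euc (2 * n + 1)) x₀).open_source.mem_nhds hx
  -- the derivative of the change of charts is the change of components
  have hD : ∀ y, y ∈ (extChartAt 𝓘ₙ x).target →
      (extChartAt 𝓘ₙ x).symm y ∈ (chartAt (Euc (2 * n + 1)) x₀).source → ∀ w,
      fderiv ℝ τ y w = components x₀ ((extChartAt 𝓘ₙ x).symm y)
        (constField x w ((extChartAt 𝓘ₙ x).symm y)) := by
    intro y hy hy0 w
    have hy1 := mem_chart_source_symm hy
    rw [components, constField, TangentBundle.continuousLinearMapAt_trivializationAt hy0,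
      TangentBundle.symmL_trivializationAt hy1, (extChartAt 𝓘ₙ x).right_inv hy,
      ModelWithCorners.Boundaryless.range_eq_univ, mfderivWithin_univ, ← mfderiv_eq_fderiv]
    have hd1 : MDifferentiableAt 𝓘(ℝ, Euc (2 * n + 1)) 𝓘ₙ (extChartAt 𝓘ₙ x).symm y := by
      have := mdifferentiableWithinAt_extChartAt_symm (I := 𝓘ₙ) hy
      rwa [ModelWithCorners.Boundaryless.range_eq_univ, mdifferentiableWithinAt_univ] at this
    rw [mfderiv_comp y (mdifferentiableAt_extChartAt hy0) hd1]
    rfl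
  have hτ : ContDiffAt ℝ ∞ τ p := by
    have h1 : ContMDiffAt 𝓘(ℝ, Euc (2 * n + 1)) 𝓘ₙ ∞ (extChartAt 𝓘ₙ x).symm p :=
      (contMDiffOn_extChartAt_symm x).contMDiffAt (extChart_target_mem_nhds (mem_chart_source _ x))
    have h2 : ContMDiffAt 𝓘ₙ 𝓘(ℝ, Euc (2 * n + 1)) ∞ (extChartAt 𝓘ₙ x₀)
        ((extChartAt 𝓘ₙ x).symm p) := by
      rw [hpx]
      exact contMDiffAt_extChartAt' hx
    exact (h2.comp p h1).contDiffAt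
  have hin : α.inChart x =ᶠ[𝓝 p] fun y => (α.inChart x₀ (τ y)).comp (fderiv ℝ τ y) := by
    filter_upwards [hnear] with y hy
    have hs : (extChartAt 𝓘ₙ x).symm y ∈ (extChartAt 𝓘ₙ x₀).source := by
      rw [extChartAt_source]; exact hy.2
    have hτy : (extChartAt 𝓘ₙ x₀).symm (τ y) = (extChartAt 𝓘ₙ x).symm y :=
      (extChartAt 𝓘ₙ x₀).left_inv hs
    ext1 w
    refine (α.inChart_apply hy.1 w).trans ?_
    refine Eq.trans ?_ (α.inChart_apply (y := τ y) ((extChartAt 𝓘ₙ x₀).map_source hs)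
      (fderiv ℝ τ y w)).symm
    rw [hτy, hD y hy.1 hy.2, constField_components hy.2]
  have hDp : ∀ w, fderiv ℝ τ p (constField x₀ w x) = w := fun w => by
    have h := hD p hnear.self_of_nhds.1 hnear.self_of_nhds.2 (constField x₀ w x)
    rw [hpx, constField_self] at h
    exact h.trans (components_constField hx w)
  rw [OneForm.d, hin.fderiv_eq]
  have hd : DifferentiableAt ℝ (α.inChart x₀) (τ p) := by
    rw [hτp]
    exact (hα.contDiffAt_inChart hx).differentiableAt (by simp)
  refine (fderiv_pullback_antisymm hd (hτ.of_le (by norm_cast)) (constField x₀ u x)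
    (constField x₀ v x)).trans ?_
  rw [hτp]
  exact congrArg₂ (fun a b => fderiv ℝ (α.inChart x₀) (extChartAt 𝓘ₙ x₀ x) a b -
    fderiv ℝ (α.inChart x₀) (extChartAt 𝓘ₙ x₀ x) b a) (hDp u) (hDp v)

/-- The exterior derivative of a smooth form is continuous. -/
theorem OneForm.IsSmooth.continuousAt_d {α : OneForm n M} (hα : α.IsSmooth) {x₀ : M}
    {φ χ : M → Euc (2 * n + 1)} (hφ : ContinuousAt φ x₀) (hχ : ContinuousAt χ x₀) :
    ContinuousAt (fun x => α.d x (constField x₀ (φ x) x) (constField x₀ (χ x) x)) x₀ := by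
  have hx : x₀ ∈ (chartAt (Euc (2 * n + 1)) x₀).source := mem_chart_source _ x₀
  have h1 : ContinuousAt (fun x => fderiv ℝ (α.inChart x₀) (extChartAt 𝓘ₙ x₀ x)) x₀ :=
    ContinuousAt.comp (g := fderiv ℝ (α.inChart x₀))
      (((hα.contDiffAt_inChart hx).fderiv_right (m := 0) (by simp)).continuousAt)
      (continuousAt_extChartAt x₀)
  refine (((h1.clm_apply hφ).clm_apply hχ).sub ((h1.clm_apply hχ).clm_apply hφ)).congr ?_
  filter_upwards [source_mem_nhds (n := n) x₀] with x hx
  exact (hα.d_eq hx _ _).symm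

/-- If `ker a ⊆ ker a'` near `p` and `a'` is a positive multiple of `a` at `p`, then `da'` is a
positive multiple of `da` on `ker a` at `p`. -/
theorem exists_fderiv_antisymm_eq_mul {E : Type*} [NormedAddCommGroup E] [NormedSpace ℝ E]
    {a a' : E → E →L[ℝ] ℝ} {p : E} (ha : DifferentiableAt ℝ a p) (ha' : DifferentiableAt ℝ a' p)
    {r : E} (hr : 0 < a p r) (hr' : 0 < a' p r)
    (hker : ∀ᶠ y in 𝓝 p, ∀ w, a y w = 0 → a' y w = 0) :
    ∃ c : ℝ, 0 < c ∧ ∀ u v, a p u = 0 → a p v = 0 →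
      fderiv ℝ a' p u v - fderiv ℝ a' p v u = c * (fderiv ℝ a p u v - fderiv ℝ a p v u) := by
  have har : DifferentiableAt ℝ (fun y => a y r) p := ha.clm_apply (differentiableAt_const r)
  have har' : DifferentiableAt ℝ (fun y => a' y r) p := ha'.clm_apply (differentiableAt_const r)
  have hf : DifferentiableAt ℝ (fun y => a' y r / a y r) p :=
    har'.mul (har.inv hr.ne')
  have heq : a' =ᶠ[𝓝 p] (fun y => a' y r / a y r) • a := by
    filter_upwards [hker, har.continuousAt.eventually_ne hr.ne'] with y hy hyr
    ext1 w
    have := hy (w - (a y w / a y r) • r) (by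
      rw [map_sub, map_smul, smul_eq_mul, div_mul_cancel₀ _ hyr, sub_self])
    rw [map_sub, map_smul, smul_eq_mul, sub_eq_zero] at this
    rw [this, Pi.smul_apply', smul_apply, smul_eq_mul]
    ring
  refine ⟨a' p r / a p r, div_pos hr' hr, fun u v hu hv => ?_⟩
  rw [heq.fderiv_eq, (hf.hasFDerivAt.smul ha.hasFDerivAt).fderiv]
  simp only [add_apply, smul_apply,
    ContinuousLinearMap.smulRight_apply, smul_eq_mul, hu, hv, mul_zero, add_zero]
  ring

/-- If two forms define the same co-oriented hyperplane field near `x`, then their exterior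
derivatives on the hyperplane at `x` differ by a positive factor. -/
theorem OneForm.IsContact.exists_d_eq_mul {α α' : OneForm n M} (hα : α.IsContact)
    (hα' : α'.IsContact) {x : M} (h : ∀ᶠ y in 𝓝 x, {v | α y v = 0} = {v | α' y v = 0} ∧
      {v | (0 : ℝ) < α y v} = {v | (0 : ℝ) < α' y v}) :
    ∃ c : ℝ, 0 < c ∧ ∀ u v, α x u = 0 → α x v = 0 → α'.d x u v = c * α.d x u v := by
  obtain ⟨r, hr⟩ : ∃ r, (0 : ℝ) < α x r := by
    obtain ⟨v, hv⟩ := hα.ne_zero x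
    have hv' : (α x v : ℝ) ≠ 0 := hv
    rcases lt_or_gt_of_ne hv' with h | h
    · refine ⟨-v, ?_⟩
      rw [map_neg]
      exact neg_pos.2 h
    · exact ⟨v, h⟩
  have hr' : (0 : ℝ) < α' x r := by
    have : r ∈ {v | (0 : ℝ) < α' x v} := h.self_of_nhds.2 ▸ hr
    exact this
  have hx : x ∈ (chartAt (Euc (2 * n + 1)) x).source := mem_chart_source _ x
  have hnear : ∀ᶠ y in 𝓝 (extChartAt 𝓘ₙ x x), {v | α ((extChartAt 𝓘ₙ x).symm y) v = 0} =
      {v | α' ((extChartAt 𝓘ₙ x).symm y) v = 0} := by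
    have h1 := continuousAt_extChartAt_symm (I := 𝓘ₙ) x
    rw [ContinuousAt, (extChartAt 𝓘ₙ x).left_inv (mem_extChartAt_source x)] at h1
    exact h1.eventually (h.mono fun y hy => hy.1)
  have hker : ∀ᶠ y in 𝓝 (extChartAt 𝓘ₙ x x), ∀ w, α.inChart x y w = 0 → α'.inChart x y w = 0 := by
    filter_upwards [hnear, extChart_target_mem_nhds hx] with y hy hyt w hw
    rw [α.inChart_apply hyt] at hw
    rw [α'.inChart_apply hyt]
    have : constField x w ((extChartAt 𝓘ₙ x).symm y) ∈
        {v | α' ((extChartAt 𝓘ₙ x).symm y) v = 0} := hy ▸ hw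
    exact this
  obtain ⟨c, hc, hd⟩ := exists_fderiv_antisymm_eq_mul (a := α.inChart x) (a' := α'.inChart x)
    ((hα.smooth.contDiffAt_inChart hx).differentiableAt (by simp))
    ((hα'.smooth.contDiffAt_inChart hx).differentiableAt (by simp)) (r := r)
    (hr.trans_eq (α.inChart_self x r).symm) (hr'.trans_eq (α'.inChart_self x r).symm) hker
  exact ⟨c, hc, fun u v hu hv =>
    hd u v ((α.inChart_self x u).trans hu) ((α.inChart_self x v).trans hv)⟩

/-- The exterior derivative at a point, as a bilinear form. -/
def OneForm.dForm (α : OneForm n M) (x : M) :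
    TangentSpace 𝓘ₙ x →ₗ[ℝ] TangentSpace 𝓘ₙ x →ₗ[ℝ] ℝ :=
  let A := fderiv ℝ (α.inChart x) (extChartAt 𝓘ₙ x x)
  ((A - A.flip).toLinearMap₁₂ : Euc (2 * n + 1) →ₗ[ℝ] Euc (2 * n + 1) →ₗ[ℝ] ℝ)

omit [IsManifold (𝓡 (2 * n + 1)) ∞ M] in
theorem OneForm.d_swap (α : OneForm n M) (x : M) (u v : TangentSpace 𝓘ₙ x) :
    α.d x u v = -α.d x v u := by
  rw [OneForm.d, OneForm.d, neg_sub]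

end Sections

/-! ### Complex embeddings of a contact structure into `ℓ²` and their classifying maps -/

section Classifying

variable {n : ℕ} {M : Type*} [TopologicalSpace M] [ChartedSpace (Euc (2 * n + 1)) M]
  [IsManifold (𝓡 (2 * n + 1)) ∞ M]

local notation "𝓘ₙ" => 𝓡 (2 * n + 1)

/-- `Θ` is a continuous family, over a map `f : Y → M`, of complex linear embeddings of the fibres
of `(ker α, J)` into `ℓ²`. Continuity is tested on the local fields with constant components. -/
structure IsComplexEmbedding {Y : Type*} [TopologicalSpace Y] (α : OneForm n M)
    (J : ∀ x : M, TangentSpace 𝓘ₙ x →L[ℝ] TangentSpace 𝓘ₙ x) (f : Y → M)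
    (Θ : ∀ y : Y, TangentSpace 𝓘ₙ (f y) →L[ℝ] Hil) : Prop where
  continuousAt : ∀ y₀ (v : Euc (2 * n + 1)),
    ContinuousAt (fun y => Θ y (constField (f y₀) v (f y))) y₀
  map_J : ∀ y v, α (f y) v = 0 → Θ y (J (f y) v) = Complex.I • Θ y v
  injective : ∀ y v, α (f y) v = 0 → Θ y v = 0 → v = 0

omit [IsManifold (𝓡 (2 * n + 1)) ∞ M] in
theorem OneForm.finrank_ker (α : OneForm n M) {x : M} (hne : ∃ v, α x v ≠ 0) :
    Module.finrank ℝ (LinearMap.ker (α x).toLinearMap) = 2 * n := by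
  have : FiniteDimensional ℝ (TangentSpace 𝓘ₙ x) :=
    inferInstanceAs (FiniteDimensional ℝ (Euc (2 * n + 1)))
  have h0 : (α x).toLinearMap ≠ 0 := by
    obtain ⟨v, hv⟩ := hne
    exact fun h => hv (LinearMap.congr_fun h v)
  have h1 := Module.Dual.finrank_ker_add_one_of_ne_zero (K := ℝ) (f := (α x).toLinearMap) h0
  have h2 : Module.finrank ℝ (TangentSpace 𝓘ₙ x) = 2 * n + 1 :=
    (finrank_euclideanSpace (𝕜 := ℝ) (ι := Fin (2 * n + 1))).trans (Fintype.card_fin _)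
  omega

omit [IsManifold (𝓡 (2 * n + 1)) ∞ M] in
/-- The image of `ker α` under a complex linear embedding is an `n`-dimensional complex
subspace. -/
theorem exists_complex_image {α : OneForm n M} {x : M} (hne : ∃ v, α x v ≠ 0)
    {j : TangentSpace 𝓘ₙ x →L[ℝ] TangentSpace 𝓘ₙ x} (hj : ∀ v, α x v = 0 → α x (j v) = 0)
    {θ : TangentSpace 𝓘ₙ x →L[ℝ] Hil} (hθ : ∀ v, α x v = 0 → θ (j v) = Complex.I • θ v)
    (hinj : ∀ v, α x v = 0 → θ v = 0 → v = 0) :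
    ∃ P : Gr n, (P.1.range : Set Hil) = θ '' {v | α x v = 0} := by
  have : FiniteDimensional ℝ (TangentSpace 𝓘ₙ x) :=
    inferInstanceAs (FiniteDimensional ℝ (Euc (2 * n + 1)))
  let S : Submodule ℂ Hil :=
    { carrier := θ '' {v | α x v = 0}
      add_mem' := by
        rintro _ _ ⟨v, hv, rfl⟩ ⟨w, hw, rfl⟩
        exact ⟨v + w, ((α x).map_add v w).trans (by rw [hv, hw]; exact add_zero _), map_add _ _ _⟩
      zero_mem' := ⟨0, (α x).map_zero, map_zero _⟩
      smul_mem' := by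
        rintro c _ ⟨v, hv, rfl⟩
        have hv : α x v = 0 := hv
        refine ⟨c.re • v + c.im • j v, ?_, ?_⟩
        · have h2 := hj v hv
          change α x (c.re • v + c.im • j v) = 0
          rw [map_add, map_smul, map_smul, hv, h2, smul_zero, smul_zero, add_zero]
        · rw [map_add, map_smul, map_smul, hθ v hv]
          conv_rhs => rw [← Complex.re_add_im c]
          rw [add_smul, mul_smul]
          rfl }
  let g : LinearMap.ker (α x).toLinearMap →ₗ[ℝ] Hil :=
    θ.toLinearMap.comp (LinearMap.ker (α x).toLinearMap).subtype
  have hg : Function.Injective g := by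
    rw [← LinearMap.ker_eq_bot, LinearMap.ker_eq_bot']
    exact fun v hv => Subtype.ext (hinj v v.2 hv)
  have hrange : LinearMap.range g = S.restrictScalars ℝ := by
    ext w
    constructor
    · rintro ⟨v, rfl⟩
      exact ⟨v, v.2, rfl⟩
    · rintro ⟨v, hv, rfl⟩
      exact ⟨⟨v, hv⟩, rfl⟩
  have hfin : Module.finrank ℝ (S.restrictScalars ℝ) = 2 * n := by
    rw [← hrange, LinearMap.finrank_range_of_inj hg, α.finrank_ker hne]
  have hfd : FiniteDimensional ℝ (S.restrictScalars ℝ) := by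
    rw [← hrange]
    infer_instance
  have hfd' : FiniteDimensional ℂ S := by
    have : FiniteDimensional ℝ S := hfd
    exact FiniteDimensional.right ℝ ℂ S
  have hS : Module.finrank ℂ S = n := by
    have h1 : Module.finrank ℝ S = 2 * n := hfin
    have h2 : 2 * Module.finrank ℂ S = 2 * n := (finrank_real_of_complex S).symm.trans h1
    omega
  exact ⟨Gr.ofSubmodule S hS, congrArg (fun T : Submodule ℂ Hil => (T : Set Hil))
    (Gr.range_ofSubmodule S hS)⟩

variable {Y : Type*} [TopologicalSpace Y] {α : OneForm n M} {f : Y → M}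
  {J : ∀ x : M, TangentSpace (𝓡 (2 * n + 1)) x →L[ℝ] TangentSpace (𝓡 (2 * n + 1)) x}

theorem IsComplexEmbedding.continuousAt_section {Θ : ∀ y : Y, TangentSpace 𝓘ₙ (f y) →L[ℝ] Hil}
    (h : IsComplexEmbedding α J f Θ) {Z : Type*} [TopologicalSpace Z] {g : Z → Y} {z₀ : Z}
    (hg : ContinuousAt g z₀) {φ : Z → Euc (2 * n + 1)} (hφ : ContinuousAt φ z₀) :
    ContinuousAt (fun z => Θ (g z) (constField (f (g z₀)) (φ z) (f (g z)))) z₀ := by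
  let b := (EuclideanSpace.basisFun (Fin (2 * n + 1)) ℝ).toBasis
  have hsum : ∀ z, Θ (g z) (constField (f (g z₀)) (φ z) (f (g z))) =
      ∑ i, φ z i • Θ (g z) (constField (f (g z₀)) (b i) (f (g z))) := fun z => by
    conv_lhs => rw [← b.sum_repr (φ z)]
    simp only [constField, map_sum, map_smul]
    rfl
  simp only [hsum]
  refine tendsto_finsetSum _ fun i _ => ?_
  exact (((EuclideanSpace.proj i).continuous.continuousAt).comp hφ).smul
    (ContinuousAt.comp (g := fun y => Θ y (constField (f (g z₀)) (b i) (f y)))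
      (h.continuousAt (g z₀) (b i)) hg)

/-- A complex embedding of `ker α` into `ℓ²` has a continuous classifying map. -/
theorem IsComplexEmbedding.exists_map {Θ : ∀ y : Y, TangentSpace 𝓘ₙ (f y) →L[ℝ] Hil}
    (h : IsComplexEmbedding α J f Θ) (hα : α.IsSmooth) (hne : ∀ x, ∃ v, α x v ≠ 0)
    (hJ : ∀ x v, α x v = 0 → α x (J x v) = 0) (hf : Continuous f) :
    ∃ Q : C(Y, Gr n), ∀ y, ((Q y).1.range : Set Hil) = Θ y '' {v | α (f y) v = 0} := by
  choose Q hQ using fun y => exists_complex_image (hne (f y)) (hJ (f y)) (h.map_J y) (h.injective y)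
  refine ⟨⟨Q, Gr.continuous_of_local_sections fun y₀ w hw => ?_⟩, hQ⟩
  have hw' : w ∈ Θ y₀ '' {v | α (f y₀) v = 0} := by rw [← hQ]; exact hw
  obtain ⟨v, hv, rfl⟩ := hw'
  obtain ⟨φ, hφ, hφ0, hφk⟩ := OneForm.exists_local_section hα hne (f y₀) hv
  refine ⟨fun y => Θ y (constField (f y₀) (φ (f y)) (f y)),
    h.continuousAt_section (g := id) continuousAt_id
      (ContinuousAt.comp (g := φ) hφ hf.continuousAt), ?_, ?_⟩
  · simp only [hφ0]
  · filter_upwards [hf.continuousAt.eventually hφk] with y hy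
    have : Θ y (constField (f y₀) (φ (f y)) (f y)) ∈ ((Q y).1.range : Set Hil) := by
      rw [hQ]
      exact ⟨_, hy, rfl⟩
    exact this

/-- Complex embeddings that are joined by a segment of embeddings have homotopic classifying
maps. -/
theorem IsComplexEmbedding.homotopic {Θ₀ Θ₁ : ∀ y : Y, TangentSpace 𝓘ₙ (f y) →L[ℝ] Hil}
    (h₀ : IsComplexEmbedding α J f Θ₀) (h₁ : IsComplexEmbedding α J f Θ₁) (hα : α.IsSmooth)
    (hne : ∀ x, ∃ v, α x v ≠ 0) (hJ : ∀ x v, α x v = 0 → α x (J x v) = 0) (hf : Continuous f)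
    (hinj : ∀ (t : ℝ) y v, α (f y) v = 0 → (1 - t) • Θ₀ y v + t • Θ₁ y v = 0 → v = 0)
    {Q₀ Q₁ : C(Y, Gr n)}
    (hQ₀ : ∀ y, ((Q₀ y).1.range : Set Hil) = Θ₀ y '' {v | α (f y) v = 0})
    (hQ₁ : ∀ y, ((Q₁ y).1.range : Set Hil) = Θ₁ y '' {v | α (f y) v = 0}) :
    Q₀.Homotopic Q₁ := by
  let Θ : ∀ z : unitInterval × Y, TangentSpace 𝓘ₙ (f z.2) →L[ℝ] Hil := fun z =>
    (1 - (z.1 : ℝ)) • Θ₀ z.2 + (z.1 : ℝ) • Θ₁ z.2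
  have hΘ : ∀ z v, Θ z v = (1 - (z.1 : ℝ)) • Θ₀ z.2 v + (z.1 : ℝ) • Θ₁ z.2 v := fun z v => rfl
  have h : IsComplexEmbedding α J (fun z : unitInterval × Y => f z.2) Θ :=
    { continuousAt := fun z₀ v => by
        have ht : ContinuousAt (fun z : unitInterval × Y => (z.1 : ℝ)) z₀ :=
          (continuous_subtype_val.comp continuous_fst).continuousAt
        exact ((continuousAt_const.sub ht).smul
          (h₀.continuousAt_section continuousAt_snd continuousAt_const)).add
          (ht.smul (h₁.continuousAt_section continuousAt_snd continuousAt_const))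
      map_J := fun z v hv => by
        rw [hΘ, hΘ, h₀.map_J _ v hv, h₁.map_J _ v hv, smul_add, smul_comm (Complex.I),
          smul_comm (Complex.I)]
      injective := fun z v hv h => hinj z.1 z.2 v hv h }
  obtain ⟨Q, hQ⟩ := h.exists_map hα hne hJ (hf.comp continuous_snd)
  refine ⟨⟨Q, fun y => ?_, fun y => ?_⟩⟩
  · refine Gr.ext_range (SetLike.coe_injective ?_)
    rw [hQ₀]
    refine (hQ (0, y)).trans (image_congr fun v _ => ?_)
    rw [hΘ]
    simp
  · refine Gr.ext_range (SetLike.coe_injective ?_)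
    rw [hQ₁]
    refine (hQ (1, y)).trans (image_congr fun v _ => ?_)
    rw [hΘ]
    simp

theorem IsComplexEmbedding.comp_injective {Θ : ∀ y : Y, TangentSpace 𝓘ₙ (f y) →L[ℝ] Hil}
    (h : IsComplexEmbedding α J f Θ) {S : Hil →L[ℂ] Hil} (hS : ∀ x, S x = 0 → x = 0) :
    IsComplexEmbedding α J f fun y => (S.restrictScalars ℝ).comp (Θ y) where
  continuousAt y₀ v := S.continuous.continuousAt.comp (h.continuousAt y₀ v)
  map_J y v hv := by
    change S (Θ y (J (f y) v)) = Complex.I • S (Θ y v)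
    rw [h.map_J y v hv, map_smul]
  injective y v hv h0 := h.injective y v hv (hS _ h0)

/-- Any two classifying maps of a complex vector bundle are homotopic: the embeddings into `ℓ²` are
first pushed into independent subspaces, and then joined by a segment. -/
theorem IsComplexEmbedding.homotopic_of_same_bundle
    {Θ₀ Θ₁ : ∀ y : Y, TangentSpace 𝓘ₙ (f y) →L[ℝ] Hil}
    (h₀ : IsComplexEmbedding α J f Θ₀) (h₁ : IsComplexEmbedding α J f Θ₁) (hα : α.IsSmooth)
    (hne : ∀ x, ∃ v, α x v ≠ 0) (hJ : ∀ x v, α x v = 0 → α x (J x v) = 0) (hf : Continuous f)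
    {Q₀ Q₁ : C(Y, Gr n)}
    (hQ₀ : ∀ y, ((Q₀ y).1.range : Set Hil) = Θ₀ y '' {v | α (f y) v = 0})
    (hQ₁ : ∀ y, ((Q₁ y).1.range : Set Hil) = Θ₁ y '' {v | α (f y) v = 0}) :
    Q₀.Homotopic Q₁ := by
  obtain ⟨S₀, S₁, hS, hS₀, hS₁⟩ := exists_complementary_shifts
  have hi₀ : ∀ x, S₀ x = 0 → x = 0 := fun x hx => hS₀ 1 x (by rw [hx]; simp)
  have hi₁ : ∀ x, S₁ x = 0 → x = 0 := fun x hx => hS₁ 1 x (by rw [hx]; simp)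
  have h₀' := h₀.comp_injective hi₀
  have h₁' := h₁.comp_injective hi₁
  obtain ⟨R₀, hR₀⟩ := h₀'.exists_map hα hne hJ hf
  obtain ⟨R₁, hR₁⟩ := h₁'.exists_map hα hne hJ hf
  have e₀ : Q₀.Homotopic R₀ := h₀.homotopic h₀' hα hne hJ hf
    (fun t y v hv h => h₀.injective y v hv (hS₀ t _ h)) hQ₀ hR₀
  have e₁ : Q₁.Homotopic R₁ := h₁.homotopic h₁' hα hne hJ hf
    (fun t y v hv h => h₁.injective y v hv (hS₁ t _ h)) hQ₁ hR₁
  refine e₀.trans (ContinuousMap.Homotopic.trans ?_ e₁.symm)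
  refine h₀'.homotopic h₁' hα hne hJ hf (fun t y v hv h => ?_) hR₀ hR₁
  have h' : S₀ (((1 - t : ℝ) : ℂ) • Θ₀ y v) + S₁ (((t : ℝ) : ℂ) • Θ₁ y v) = 0 := by
    rw [map_smul, map_smul]
    exact h
  obtain ⟨h1, h2⟩ := hS _ _ h'
  rcases smul_eq_zero.1 h1 with h3 | h3
  · refine h₁.injective y v hv ((smul_eq_zero.1 h2).resolve_left fun h4 => ?_)
    have h3' : 1 - t = 0 := by exact_mod_cast h3
    have h4' : t = 0 := by exact_mod_cast h4
    linarith
  · exact h₀.injective y v hv h3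

/-- Near points where two co-oriented contact structures agree, their classifying maps are
homotopic: if `J'` is compatible with `c dα`, `c > 0`, then `1 - J'J` is a complex linear isomorphism
from `(ker α, J)` to `(ker α, J')`. -/
theorem homotopic_of_agree {α' : OneForm n M}
    {J' : ∀ x : M, TangentSpace (𝓡 (2 * n + 1)) x →L[ℝ] TangentSpace (𝓡 (2 * n + 1)) x}
    (hα : α.IsContact) (hα' : α'.IsContact) (hJ : IsCompatibleComplexStructure α J)
    (hJ' : IsCompatibleComplexStructure α' J') {P P' : C(M, Gr n)} (hP : IsClassifyingMap α J P)
    (hP' : IsClassifyingMap α' J' P') (g : C(Y, M))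
    (hagree : ∀ y, ∀ᶠ x in 𝓝 (g y), {v | α x v = 0} = {v | α' x v = 0} ∧
      {v | (0 : ℝ) < α x v} = {v | (0 : ℝ) < α' x v}) :
    (P.comp g).Homotopic (P'.comp g) := by
  obtain ⟨Φ, hΦc, hΦ⟩ := hP
  obtain ⟨Φ', hΦc', hΦ'⟩ := hP'
  have hker : ∀ y v, α (g y) v = 0 → α' (g y) v = 0 := fun y v hv => by
    have : v ∈ {v | α' (g y) v = 0} := (hagree y).self_of_nhds.1 ▸ hv
    exact this
  have hsec : ∀ y₀ (v : Euc (2 * n + 1)), ContinuousAt (fun y =>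
      (⟨g y, constField (g y₀) v (g y)⟩ : TangentBundle 𝓘ₙ M)) y₀ := fun y₀ v =>
    continuousAt_constField (mem_chart_source _ (g y₀)) g.continuous.continuousAt rfl
      continuousAt_const
  have h₀ : IsComplexEmbedding α J g fun y => Φ (g y) :=
    { continuousAt := fun y₀ v => hΦc.continuousAt.comp (hsec y₀ v)
      map_J := fun y v hv => (hΦ (g y)).1 v hv
      injective := fun y v hv h => (hΦ (g y)).2.injOn hv (α (g y)).map_zero
        (h.trans (map_zero _).symm) }
  have hinj' : ∀ x v, α' x v = 0 → Φ' x v = 0 → v = 0 := fun x v hv h =>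
    (hΦ' x).2.injOn hv (α' x).map_zero (h.trans (map_zero _).symm)
  let Θ : ∀ y : Y, TangentSpace 𝓘ₙ (g y) →L[ℝ] Hil := fun y =>
    Φ' (g y) - (Φ' (g y)).comp ((J' (g y)).comp (J (g y)))
  have hΘ : ∀ y v, Θ y v = Φ' (g y) v - Φ' (g y) (J' (g y) (J (g y) v)) := fun y v => rfl
  have h₁ : IsComplexEmbedding α J g Θ :=
    { continuousAt := fun y₀ v => (hΦc'.continuousAt.comp (hsec y₀ v)).sub
        ((hΦc'.comp (hJ'.continuous.comp hJ.continuous)).continuousAt.comp (hsec y₀ v))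
      map_J := fun y v hv => by
        have hJv := hker y _ (hJ.maps_to _ v hv)
        rw [hΘ, hΘ, hJ.sq _ v hv, (hΦ' (g y)).1 _ hJv, map_neg, map_neg,
          (hΦ' (g y)).1 v (hker y v hv), smul_sub, smul_smul, Complex.I_mul_I, neg_one_smul]
        abel
      injective := fun y v hv h => by
        by_contra hv0
        have hv' := hker y v hv
        have hJv := hker y _ (hJ.maps_to _ v hv)
        have h2 : α' (g y) (v - J' (g y) (J (g y) v)) = 0 := by
          rw [map_sub, hv', hJ'.maps_to _ _ hJv, sub_self]
        have h3 : v = J' (g y) (J (g y) v) := sub_eq_zero.1 (hinj' _ _ h2 (by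
          rw [map_sub]; exact h))
        have h4 : J' (g y) v = - J (g y) v := by
          conv_lhs => rw [h3]
          exact hJ'.sq _ _ hJv
        obtain ⟨c, hc, hd⟩ := hα.exists_d_eq_mul hα' (hagree y)
        have h5 := hJ'.pos (g y) v hv' hv0
        rw [h4, hd v _ hv (by rw [map_neg, hJ.maps_to _ v hv, neg_zero])] at h5
        have h6 := hJ.pos (g y) v hv hv0
        have h7 : α.d (g y) v (-J (g y) v) = - α.d (g y) v (J (g y) v) := by
          exact (α.dForm (g y) v).map_neg _
        rw [h7] at h5
        nlinarith }
  refine h₀.homotopic_of_same_bundle h₁ hα.smooth hα.ne_zero hJ.maps_to g.continuous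
    (fun y => ((hΦ (g y)).2.image_eq).symm) ?_
  obtain ⟨Q, hQ⟩ := h₁.exists_map hα.smooth hα.ne_zero hJ.maps_to g.continuous
  have hQP : ∀ y, Q y = (P'.comp g) y := fun y => by
    refine Gr.eq_of_range_le ?_
    intro w hw
    have hw' : w ∈ Θ y '' {v | α (g y) v = 0} := by rw [← hQ]; exact hw
    obtain ⟨v, hv, rfl⟩ := hw'
    have hJv := hker y _ (hJ.maps_to _ v hv)
    have : Θ y v = Φ' (g y) (v - J' (g y) (J (g y) v)) := by rw [map_sub]; rfl
    rw [this]
    refine (hΦ' (g y)).2.mapsTo ?_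
    change α' (g y) (v - J' (g y) (J (g y) v)) = 0
    rw [map_sub, hker y v hv, hJ'.maps_to _ _ hJv, sub_self]
  intro y
  rw [← hQP]
  exact hQ y

end Classifying

/-! ### The polar decomposition of a skew operator -/

section Polar

open scoped Matrix.Norms.L2Operator MatrixOrder

/-- Positive operators on `ℝᴺ` have positive square roots that depend continuously on the operator and
commute with everything that commutes with it. -/
theorem exists_continuous_sqrt (N : ℕ) :
    ∃ s : (EuclideanSpace ℝ (Fin N) →L[ℝ] EuclideanSpace ℝ (Fin N)) →
        (EuclideanSpace ℝ (Fin N) →L[ℝ] EuclideanSpace ℝ (Fin N)),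
      ContinuousOn s {T | T.IsPositive} ∧ ∀ T, T.IsPositive → (s T).IsPositive ∧ s T * s T = T ∧
        ∀ B, Commute T B → Commute (s T) B := by
  let φ := Matrix.toEuclideanCLM (n := Fin N) (𝕜 := ℝ)
  have hφ : Continuous φ :=
    (φ.toAlgEquiv.toLinearMap : Matrix (Fin N) (Fin N) ℝ →ₗ[ℝ] _).continuous_of_finiteDimensional
  have hφ' : Continuous φ.symm :=
    (φ.symm.toAlgEquiv.toLinearMap :
      (EuclideanSpace ℝ (Fin N) →L[ℝ] EuclideanSpace ℝ (Fin N)) →ₗ[ℝ] _).continuous_of_finiteDimensional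
  have hpos : ∀ A : Matrix (Fin N) (Fin N) ℝ, (φ A).IsPositive ↔ 0 ≤ A := fun A => by
    rw [Matrix.nonneg_iff_posSemidef, ← Matrix.isPositive_toEuclideanLin_iff]
    exact ContinuousLinearMap.isPositive_toLinearMap_iff (φ A)
  have hpos' : ∀ T, T.IsPositive → 0 ≤ φ.symm T := fun T hT => by
    rw [← hpos, φ.apply_symm_apply]
    exact hT
  refine ⟨fun T => φ (CFC.sqrt (φ.symm T)), ?_, fun T hT => ⟨?_, ?_, fun B hB => ?_⟩⟩
  · exact hφ.comp_continuousOn (CFC.continuousOn_sqrt.comp hφ'.continuousOn hpos')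
  · exact (hpos _).2 (CFC.sqrt_nonneg _)
  · rw [← map_mul, CFC.sqrt_mul_sqrt_self _ (hpos' T hT), φ.apply_symm_apply]
  · have h1 : Commute (φ.symm T) (φ.symm B) := hB.map φ.symm
    have h2 : Commute (CFC.sqrt (φ.symm T)) (φ.symm B) := h1.cfcₙ_nnreal _
    have h3 := h2.map φ
    rwa [φ.apply_symm_apply] at h3

variable {V : Type*} [NormedAddCommGroup V] [InnerProductSpace ℝ V]

/-- `Ω` is a skew operator that is supported, and nondegenerate, on the range of the orthogonal
projection `q`. -/
structure IsSkewOn (Ω q : V →L[ℝ] V) : Prop where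
  skew : ∀ u v, inner ℝ (Ω u) v = -inner ℝ u (Ω v)
  symm : ∀ u v, inner ℝ (q u) v = inner ℝ u (q v)
  idem : ∀ u, q (q u) = q u
  left : ∀ u, q (Ω u) = Ω u
  right : ∀ u, Ω (q u) = Ω u
  nondegenerate : ∀ u, q u = u → Ω u = 0 → u = 0

namespace IsSkewOn

variable {Ω q : V →L[ℝ] V}

theorem inner_apply_self (h : IsSkewOn Ω q) (v : V) :
    inner ℝ ((1 - q - Ω * Ω) v) v = ‖v - q v‖ ^ 2 + ‖Ω v‖ ^ 2 := by
  change inner ℝ (v - q v - Ω (Ω v)) v = _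
  rw [inner_sub_left, h.skew, ← real_inner_self_eq_norm_sq, ← real_inner_self_eq_norm_sq,
    sub_neg_eq_add]
  congr 1
  rw [inner_sub_right _ _ (q v), ← h.symm, map_sub, h.idem, sub_self, inner_zero_left, sub_zero]

theorem isPositive (h : IsSkewOn Ω q) : (1 - q - Ω * Ω).IsPositive := by
  rw [ContinuousLinearMap.isPositive_iff]
  refine ⟨fun u v => ?_, fun v => ?_⟩
  · change inner ℝ (u - q u - Ω (Ω u)) v = inner ℝ u (v - q v - Ω (Ω v))
    rw [inner_sub_left, inner_sub_left, inner_sub_right, inner_sub_right, h.symm, h.skew, h.skew,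
      neg_neg]
  · rw [h.inner_apply_self]
    positivity

theorem eq_zero_of_apply_eq_zero (h : IsSkewOn Ω q) {v : V} (hv : (1 - q - Ω * Ω) v = 0) :
    v = 0 := by
  have h1 := h.inner_apply_self v
  rw [hv, inner_zero_left] at h1
  have h2 : ‖v - q v‖ ^ 2 = 0 := by nlinarith [sq_nonneg ‖v - q v‖, sq_nonneg ‖Ω v‖]
  have h3 : ‖Ω v‖ ^ 2 = 0 := by nlinarith [sq_nonneg ‖v - q v‖, sq_nonneg ‖Ω v‖]
  refine h.nondegenerate v (sub_eq_zero.1 (norm_eq_zero.1 (pow_eq_zero_iff two_ne_zero |>.1 h2))).symm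
    (norm_eq_zero.1 (pow_eq_zero_iff two_ne_zero |>.1 h3))

end IsSkewOn

theorem isUnit_of_injective [FiniteDimensional ℝ V] {R : V →L[ℝ] V} (h : ∀ v, R v = 0 → v = 0) : IsUnit R := by
  rw [ContinuousLinearMap.isUnit_iff_isUnit_toLinearMap, LinearMap.isUnit_iff_ker_eq_bot,
    LinearMap.ker_eq_bot']
  exact h

/-- The orthogonal factor `Ω (-Ω²)^(-1/2)` of the polar decomposition of a nondegenerate skew
operator is a compatible complex structure, and depends continuously on the operator. -/
theorem exists_continuous_polar (N : ℕ) :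
    ∃ K : (EuclideanSpace ℝ (Fin N) →L[ℝ] EuclideanSpace ℝ (Fin N)) ×
        (EuclideanSpace ℝ (Fin N) →L[ℝ] EuclideanSpace ℝ (Fin N)) →
        (EuclideanSpace ℝ (Fin N) →L[ℝ] EuclideanSpace ℝ (Fin N)),
      ContinuousOn K {p | IsSkewOn p.1 p.2} ∧ ∀ Ω q, IsSkewOn Ω q →
        (∀ u, q (K (Ω, q) u) = K (Ω, q) u) ∧ (∀ v, q v = v → K (Ω, q) (K (Ω, q) v) = -v) ∧
        (∀ u v, q u = u → q v = v →
          inner ℝ (Ω u) (K (Ω, q) v) = (inner ℝ (Ω v) (K (Ω, q) u) : ℝ)) ∧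
        ∀ v, q v = v → v ≠ 0 → (0 : ℝ) < inner ℝ (Ω v) (K (Ω, q) v) := by
  obtain ⟨s, hsc, hs⟩ := exists_continuous_sqrt N
  have hunit : ∀ Ω q : EuclideanSpace ℝ (Fin N) →L[ℝ] EuclideanSpace ℝ (Fin N), IsSkewOn Ω q →
      ∀ v, s (1 - q - Ω * Ω) v = 0 → v = 0 := fun Ω q h v hv => by
    refine h.eq_zero_of_apply_eq_zero ?_
    rw [← (hs _ h.isPositive).2.1, mul_apply_eq_comp, hv, map_zero]
  refine ⟨fun p => p.1 * Ring.inverse (s (1 - p.2 - p.1 * p.1)), ?_, fun Ω q h => ?_⟩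
  · have h1 : ContinuousOn (fun p : (EuclideanSpace ℝ (Fin N) →L[ℝ] EuclideanSpace ℝ (Fin N)) ×
        (EuclideanSpace ℝ (Fin N) →L[ℝ] EuclideanSpace ℝ (Fin N)) => s (1 - p.2 - p.1 * p.1))
        {p | IsSkewOn p.1 p.2} :=
      hsc.comp (by fun_prop) fun p hp => IsSkewOn.isPositive hp
    refine continuousOn_fst.mul fun p hp => ?_
    obtain ⟨u, hu⟩ := isUnit_of_injective (hunit p.1 p.2 hp)
    refine ContinuousAt.comp_continuousWithinAt (g := Ring.inverse) ?_ (h1 p hp)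
    rw [← hu]
    exact NormedRing.inverse_continuousAt u
  · obtain ⟨hRpos, hRR, hcomm⟩ := hs _ h.isPositive
    have hinj := hunit Ω q h
    set T := 1 - q - Ω * Ω with hT
    set R := s T with hR
    have hu : IsUnit R := isUnit_of_injective hinj
    set Q := Ring.inverse R with hQ
    have hQR : ∀ v, Q (R v) = v := fun v =>
      congrArg (fun A : EuclideanSpace ℝ (Fin N) →L[ℝ] EuclideanSpace ℝ (Fin N) => A v)
        (Ring.inverse_mul_cancel _ hu)
    have hRQ : ∀ v, R (Q v) = v := fun v =>
      congrArg (fun A : EuclideanSpace ℝ (Fin N) →L[ℝ] EuclideanSpace ℝ (Fin N) => A v)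
        (Ring.mul_inverse_cancel _ hu)
    have hRT : ∀ v, R (R v) = v - q v - Ω (Ω v) := fun v =>
      congrArg (fun A : EuclideanSpace ℝ (Fin N) →L[ℝ] EuclideanSpace ℝ (Fin N) => A v) hRR
    have hQcomm : ∀ B, Commute T B → ∀ v, Q (B v) = B (Q v) := fun B hB v => by
      have h1 : R (B (Q v)) = B (R (Q v)) :=
        congrArg (fun A : EuclideanSpace ℝ (Fin N) →L[ℝ] EuclideanSpace ℝ (Fin N) => A (Q v))
          (hcomm B hB).eq
      rw [hRQ] at h1
      rw [← h1, hQR]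
    have hQΩ : ∀ v, Q (Ω v) = Ω (Q v) := hQcomm Ω (by
      ext1 v
      change Ω v - q (Ω v) - Ω (Ω (Ω v)) = Ω (v - q v - Ω (Ω v))
      rw [map_sub, map_sub, h.left, h.right])
    have hQq : ∀ v, Q (q v) = q (Q v) := hQcomm q (by
      ext1 v
      change q v - q (q v) - Ω (Ω (q v)) = q (v - q v - Ω (Ω v))
      rw [map_sub, map_sub, h.left, h.right])
    have hkey : ∀ u v, q v = v → inner ℝ (Ω u) (Ω (Q v)) = (inner ℝ u (R v) : ℝ) := fun u v hv => by
      have h1 := hRT (Q v)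
      rw [hRQ, ← hQq, hv, sub_self, zero_sub] at h1
      rw [h.skew, h1, inner_neg_right]
    refine ⟨fun u => h.left _, fun v hv => ?_, fun u v hu hv => ?_, fun v hv hv0 => ?_⟩
    · change Ω (Q (Ω (Q v))) = -v
      have h1 := hRT (Q (Q v))
      rw [hRQ, hRQ, ← hQq, ← hQq, hv, sub_self, zero_sub] at h1
      rw [hQΩ]
      exact (neg_eq_iff_eq_neg.2 h1).symm
    · refine (hkey u v hv).trans (Eq.trans ?_ (hkey v u hu).symm)
      rw [real_inner_comm]
      exact hRpos.isSymmetric v u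
    · refine (hkey v v hv).symm ▸ ?_
      obtain ⟨hXpos, hXX, -⟩ := hs R hRpos
      have h1 : R v = s R (s R v) := congrArg
        (fun A : EuclideanSpace ℝ (Fin N) →L[ℝ] EuclideanSpace ℝ (Fin N) => A v) hXX.symm
      have h2 : inner ℝ v (R v) = (inner ℝ (s R v) (s R v) : ℝ) := by
        rw [h1]
        exact (hXpos.isSymmetric v (s R v)).symm
      rw [h2, real_inner_self_eq_norm_sq]
      have h3 : s R v ≠ 0 := fun h4 => hv0 (hinj v (by rw [h1, h4, map_zero]))
      positivity

end Polar

/-! ### Existence of compatible complex structures and of classifying maps -/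

section Existence

variable {n : ℕ} {M : Type*} [TopologicalSpace M] [ChartedSpace (Euc (2 * n + 1)) M]
  [IsManifold (𝓡 (2 * n + 1)) ∞ M]

local notation "TM" => TangentBundle (𝓡 (2 * n + 1)) M
local notation "𝓘ₙ" => 𝓡 (2 * n + 1)

/-- The tangent bundle of a closed manifold embeds into a trivial bundle. -/
theorem exists_tangent_embedding (n : ℕ) (M : Type*) [TopologicalSpace M]
    [ChartedSpace (Euc (2 * n + 1)) M] [IsManifold (𝓡 (2 * n + 1)) ∞ M] [T2Space M]
    [CompactSpace M] :
    ∃ (N : ℕ) (ι : ∀ x : M, TangentSpace (𝓡 (2 * n + 1)) x →L[ℝ] Euc N),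
      (Continuous fun v : TangentBundle (𝓡 (2 * n + 1)) M => ι v.1 v.2) ∧
      ∀ x v, ι x v = 0 → v = 0 := by
  obtain ⟨N, e, he, -, hinj⟩ := exists_embedding_euclidean_of_compact (I := 𝓡 (2 * n + 1)) (M := M)
  refine ⟨N, fun x => mfderiv (𝓡 (2 * n + 1)) (𝓡 N) e x, ?_, fun x v hv =>
    hinj x (hv.trans (map_zero _).symm)⟩
  have h1 : Continuous (tangentMap (𝓡 (2 * n + 1)) (𝓡 N) e) :=
    he.continuous_tangentMap (by simp)
  exact continuous_snd.comp ((tangentBundleModelSpaceHomeomorph (𝓡 N)).continuous.comp h1)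

/-- The composition of the orthogonal projection onto `ι(K)` and the inverse of `ι` on `ι(K)`. -/
theorem exists_projection_inverse {V E : Type*} [AddCommGroup V] [Module ℝ V] [TopologicalSpace V]
    [IsTopologicalAddGroup V] [ContinuousSMul ℝ V] [NormedAddCommGroup E]
    [InnerProductSpace ℝ E] [FiniteDimensional ℝ E] (ι : V →L[ℝ] E) (hι : ∀ v, ι v = 0 → v = 0)
    (K : Submodule ℝ V) :
    ∃ p : E →L[ℝ] V, ∀ u, p u ∈ K ∧ ι (p u) = (K.map ι.toLinearMap).starProjection u := by
  obtain ⟨l, hl⟩ := ι.toLinearMap.exists_leftInverse_of_injective (LinearMap.ker_eq_bot'.2 hι)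
  have hl' : ∀ v, l (ι v) = v := LinearMap.congr_fun hl
  refine ⟨LinearMap.toContinuousLinearMap (l.comp (K.map ι.toLinearMap).starProjection.toLinearMap),
    fun u => ?_⟩
  change l ((K.map ι.toLinearMap).starProjection u) ∈ K ∧
    ι (l ((K.map ι.toLinearMap).starProjection u)) = (K.map ι.toLinearMap).starProjection u
  obtain ⟨v, hv, hvu⟩ : (K.map ι.toLinearMap).starProjection u ∈ K.map ι.toLinearMap :=
    Submodule.starProjection_apply_mem _ u
  have hvu' : ι v = (K.map ι.toLinearMap).starProjection u := hvu
  rw [← hvu', hl']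
  exact ⟨hv, rfl⟩

/-- The orthogonal projection onto the image of `ker α` in a trivial bundle, viewed as a map to
`ker α`, is continuous. -/
theorem continuous_projection_inverse {α : OneForm n M} (hα : α.IsContact) {N : ℕ}
    {ι : ∀ x : M, TangentSpace (𝓡 (2 * n + 1)) x →L[ℝ] Euc N}
    (hιc : Continuous fun v : TangentBundle (𝓡 (2 * n + 1)) M => ι v.1 v.2)
    (hι : ∀ x v, ι x v = 0 → v = 0)
    {p : ∀ x : M, Euc N →L[ℝ] TangentSpace (𝓡 (2 * n + 1)) x}
    (hp : ∀ x u, ι x (p x u) =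
      ((LinearMap.ker (α x).toLinearMap).map (ι x).toLinearMap).starProjection u) (u : Euc N) :
    Continuous fun x => (⟨x, p x u⟩ : TangentBundle (𝓡 (2 * n + 1)) M) := by
  rw [continuous_iff_continuousAt]
  intro x₀
  have hxs : x₀ ∈ (chartAt (Euc (2 * n + 1)) x₀).source := mem_chart_source _ x₀
  have : FiniteDimensional ℝ (TangentSpace 𝓘ₙ x₀) :=
    inferInstanceAs (FiniteDimensional ℝ (Euc (2 * n + 1)))
  let B := Module.finBasisOfFinrankEq ℝ _ (α.finrank_ker (hα.ne_zero x₀))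
  choose φ hφc hφ0 hφk using fun j => OneForm.exists_local_section hα.smooth hα.ne_zero x₀
    (w := (B j : TangentSpace (𝓡 (2 * n + 1)) x₀)) (B j).2
  let b : Fin (2 * n) → M → Euc N := fun j x => ι x (constField x₀ (φ j x) x)
  have hbc : ∀ j, ContinuousAt (b j) x₀ := fun j =>
    hιc.continuousAt.comp (continuousAt_constField hxs continuousAt_id rfl (hφc j))
  have hli : LinearIndependent ℝ fun j => b j x₀ := by
    have hb : (fun j => b j x₀) = (ι x₀).toLinearMap ∘ (Submodule.subtype _) ∘ B := by
      funext j
      simp only [b, hφ0]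
      rfl
    rw [hb]
    refine (B.linearIndependent.map' _ (Submodule.ker_subtype _)).map' _ ?_
    exact LinearMap.ker_eq_bot'.2 (hι x₀)
  have hF := continuousAt_frameInv (𝕜 := ℝ) hbc hli
  have hc : ContinuousAt (fun x => ∑ j, frameInv (𝕜 := ℝ) (fun j => b j x) u j • φ j x) x₀ := by
    refine tendsto_finsetSum _ fun j _ => ?_
    exact (((EuclideanSpace.proj j).continuous.continuousAt).comp
      (hF.clm_apply continuousAt_const)).smul (hφc j)
  refine (continuousAt_constField hxs continuousAt_id rfl hc).congr ?_
  filter_upwards [eventually_linearIndependent hbc hli, Filter.eventually_all.2 hφk] with x hx hk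
  have hcard : Module.finrank ℝ ((LinearMap.ker (α x).toLinearMap).map (ι x).toLinearMap) =
      2 * n :=
    (Submodule.equivMapOfInjective (ι x).toLinearMap
      (LinearMap.ker_eq_bot.1 (LinearMap.ker_eq_bot'.2 (hι x))) _).finrank_eq.symm.trans
      (α.finrank_ker (hα.ne_zero x))
  have hle : Submodule.span ℝ (range fun j => b j x) ≤
      (LinearMap.ker (α x).toLinearMap).map (ι x).toLinearMap :=
    Submodule.span_le.2 (by rintro _ ⟨j, rfl⟩; exact ⟨_, hk j, rfl⟩)
  have hspan := Submodule.eq_of_le_of_finrank_eq hle (by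
    rw [finrank_span_eq_card hx, Fintype.card_fin, hcard])
  have h1 : ι x (p x u) = ∑ j, frameInv (𝕜 := ℝ) (fun j => b j x) u j • b j x := by
    rw [hp, ← frameMap_apply]
    refine Eq.trans ?_ (congrArg (fun A : Euc N →L[ℝ] Euc N => A u) (starProjection_span_range hx))
    simp only [hspan]
  have h2 : ι x (constField x₀ (∑ j, frameInv (𝕜 := ℝ) (fun j => b j x) u j • φ j x) x) =
      ι x (p x u) := by
    rw [h1]
    simp only [constField, map_sum, map_smul]
    rfl
  have h3 := hι x _ ((map_sub (ι x) _ _).trans (sub_eq_zero.2 h2))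
  exact congrArg (fun w => (⟨x, w⟩ : TangentBundle (𝓡 (2 * n + 1)) M)) (sub_eq_zero.1 h3)

/-- The operator that represents a bilinear form. -/
def bilinOperator {N : ℕ} (b : Euc N →ₗ[ℝ] Euc N →ₗ[ℝ] ℝ) : Euc N →L[ℝ] Euc N :=
  ∑ i, (LinearMap.toContinuousLinearMap (b.flip (EuclideanSpace.basisFun (Fin N) ℝ i))).smulRight
    (EuclideanSpace.basisFun (Fin N) ℝ i)

theorem bilinOperator_apply {N : ℕ} (b : Euc N →ₗ[ℝ] Euc N →ₗ[ℝ] ℝ) (u : Euc N) :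
    bilinOperator b u = ∑ i, b u (EuclideanSpace.basisFun (Fin N) ℝ i) •
      EuclideanSpace.basisFun (Fin N) ℝ i := by
  rw [bilinOperator, sum_apply]
  rfl

theorem inner_bilinOperator {N : ℕ} (b : Euc N →ₗ[ℝ] Euc N →ₗ[ℝ] ℝ) (u w : Euc N) :
    inner ℝ (bilinOperator b u) w = b u w := by
  conv_rhs => rw [← (EuclideanSpace.basisFun (Fin N) ℝ).sum_repr' w]
  rw [bilinOperator_apply, sum_inner, map_sum]
  refine Finset.sum_congr rfl fun i _ => ?_
  rw [real_inner_smul_left, map_smul, smul_eq_mul, mul_comm]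

/-- A family of linear maps to the tangent spaces that is continuous on every vector is jointly
continuous. -/
theorem continuous_apply_of_forall {N : ℕ}
    {p : ∀ x : M, Euc N →L[ℝ] TangentSpace (𝓡 (2 * n + 1)) x}
    (hp : ∀ u, Continuous fun x => (⟨x, p x u⟩ : TangentBundle (𝓡 (2 * n + 1)) M))
    {Z : Type*} [TopologicalSpace Z] {g : Z → M} {w : Z → Euc N} (hg : Continuous g)
    (hw : Continuous w) :
    Continuous fun z => (⟨g z, p (g z) (w z)⟩ : TangentBundle (𝓡 (2 * n + 1)) M) := by
  rw [continuous_iff_continuousAt]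
  intro z₀
  have hxs : g z₀ ∈ (chartAt (Euc (2 * n + 1)) (g z₀)).source := mem_chart_source _ _
  let e := (EuclideanSpace.basisFun (Fin N) ℝ).toBasis
  have hc : ContinuousAt (fun z => ∑ i, w z i • components (g z₀) (g z) (p (g z) (e i))) z₀ := by
    refine tendsto_finsetSum _ fun i _ => ?_
    exact (((EuclideanSpace.proj i).continuous.comp hw).continuousAt).smul
      (continuousAt_components (V := fun z => (⟨g z, p (g z) (e i)⟩ :
        TangentBundle (𝓡 (2 * n + 1)) M)) hxs ((hp (e i)).comp hg).continuousAt rfl)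
  refine (continuousAt_constField hxs hg.continuousAt rfl hc).congr ?_
  filter_upwards [hg.continuousAt.eventually (source_mem_nhds (n := n) (g z₀))] with z hz
  have h1 : p (g z) (w z) = ∑ i, w z i • p (g z) (e i) := by
    conv_lhs => rw [← e.sum_repr (w z), map_sum]
    simp only [map_smul]
    rfl
  have h2 : ∑ i, w z i • components (g z₀) (g z) (p (g z) (e i)) =
      components (g z₀) (g z) (p (g z) (w z)) := by
    rw [h1, map_sum]
    simp only [map_smul]
  rw [h2, constField_components hz]

theorem OneForm.IsSmooth.continuous_d {α : OneForm n M} (hα : α.IsSmooth)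
    {V W : ∀ x : M, TangentSpace (𝓡 (2 * n + 1)) x}
    (hV : Continuous fun x => (⟨x, V x⟩ : TangentBundle (𝓡 (2 * n + 1)) M))
    (hW : Continuous fun x => (⟨x, W x⟩ : TangentBundle (𝓡 (2 * n + 1)) M)) :
    Continuous fun x => α.d x (V x) (W x) := by
  rw [continuous_iff_continuousAt]
  intro x₀
  have hxs : x₀ ∈ (chartAt (Euc (2 * n + 1)) x₀).source := mem_chart_source _ _
  refine (hα.continuousAt_d (continuousAt_components hxs hV.continuousAt rfl)
    (continuousAt_components hxs hW.continuousAt rfl)).congr ?_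
  filter_upwards [source_mem_nhds (n := n) x₀] with x hx
  rw [constField_components hx, constField_components hx]

/-- Every contact form on a closed manifold has a compatible complex structure: the orthogonal
factor in the polar decomposition of `dα` with respect to the metric induced by an embedding. -/
theorem OneForm.IsContact.exists_complexStructure {α : OneForm n M} (hα : α.IsContact) {N : ℕ}
    {ι : ∀ x : M, TangentSpace (𝓡 (2 * n + 1)) x →L[ℝ] Euc N}
    (hιc : Continuous fun v : TangentBundle (𝓡 (2 * n + 1)) M => ι v.1 v.2)
    (hι : ∀ x v, ι x v = 0 → v = 0) :
    ∃ J, IsCompatibleComplexStructure α J := by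
  choose p hp using fun x => exists_projection_inverse (ι x) (hι x)
    (LinearMap.ker (α x).toLinearMap)
  have hpc := continuous_projection_inverse hα hιc hι fun x u => (hp x u).2
  have hpk : ∀ x u, α x (p x u) = 0 := fun x u => (hp x u).1
  have hpι : ∀ x v, α x v = 0 → p x (ι x v) = v := fun x v hv => by
    have h1 : ι x (p x (ι x v)) = ι x v := (hp x (ι x v)).2.trans
      (Submodule.starProjection_eq_self_iff.2 ⟨v, hv, rfl⟩)
    exact sub_eq_zero.1 (hι x _ ((map_sub (ι x) _ _).trans (sub_eq_zero.2 h1)))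
  obtain ⟨q, hq⟩ : ∃ q : M → Euc N →L[ℝ] Euc N, ∀ x u, q x u = ι x (p x u) :=
    ⟨fun x => (ι x).comp (p x), fun _ _ => rfl⟩
  let b : M → Euc N →ₗ[ℝ] Euc N →ₗ[ℝ] ℝ := fun x =>
    (α.dForm x).compl₁₂ (p x).toLinearMap (p x).toLinearMap
  have hb : ∀ x u w, b x u w = α.d x (p x u) (p x w) := fun x u w => rfl
  obtain ⟨Ω, hΩ, hΩc⟩ : ∃ Ω : M → Euc N →L[ℝ] Euc N,
      (∀ x u w, inner ℝ (Ω x u) w = α.d x (p x u) (p x w)) ∧ Continuous Ω := by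
    refine ⟨fun x => bilinOperator (b x), fun x u w => inner_bilinOperator (b x) u w,
      continuous_clm_apply.2 fun u => ?_⟩
    simp only [bilinOperator_apply, hb]
    exact continuous_finsetSum _ fun i _ =>
      (hα.smooth.continuous_d (hpc u) (hpc _)).smul continuous_const
  have hpq : ∀ x u, p x (q x u) = p x u := fun x u => by rw [hq, hpι x _ (hpk x u)]
  have hqsymm : ∀ x u v, inner ℝ (q x u) v = (inner ℝ u (q x v) : ℝ) := fun x u v => by
    rw [hq, hq, (hp x u).2, (hp x v).2]
    exact Submodule.inner_starProjection_left_eq_right _ u v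
  have hskew : ∀ x, IsSkewOn (Ω x) (q x) := fun x =>
    { skew := fun u v => by
        rw [hΩ, α.d_swap, ← hΩ, real_inner_comm]
      symm := hqsymm x
      idem := fun u => by rw [hq, hpq, hq]
      left := fun u => ext_inner_right ℝ fun w => by
        rw [hqsymm, hΩ, hΩ, hpq]
      right := fun u => ext_inner_right ℝ fun w => by
        rw [hΩ, hΩ, hpq]
      nondegenerate := fun u hu h0 => by
        have h1 : p x u = 0 := hα.nondegenerate x _ (hpk x u) fun v hv => by
          rw [← hpι x v hv, ← hΩ, h0, inner_zero_left]
        rw [← hu, hq, h1, map_zero] }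
  have hqc : Continuous q := continuous_clm_apply.2 fun u => by
    simp only [hq]
    exact hιc.comp (hpc u)
  obtain ⟨K', hKc, hK⟩ := exists_continuous_polar N
  obtain ⟨K, hKK⟩ : ∃ K : M → Euc N →L[ℝ] Euc N, ∀ x, K' (Ω x, q x) = K x :=
    ⟨fun x => K' (Ω x, q x), fun _ => rfl⟩
  have hKc' : Continuous K := by
    rw [← funext hKK, ← continuousOn_univ]
    exact hKc.comp (hΩc.prodMk hqc).continuousOn fun x _ => hskew x
  have hK1 := fun x => (hK (Ω x) (q x) (hskew x)).1
  have hK2 := fun x => (hK (Ω x) (q x) (hskew x)).2.1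
  have hK3 := fun x => (hK (Ω x) (q x) (hskew x)).2.2.1
  have hK4 := fun x => (hK (Ω x) (q x) (hskew x)).2.2.2
  simp only [hKK] at hK1 hK2 hK3 hK4
  have hqι : ∀ x v, α x v = 0 → q x (ι x v) = ι x v := fun x v hv => by rw [hq, hpι x v hv]
  obtain ⟨J, hJ⟩ : ∃ J : ∀ x : M, TangentSpace 𝓘ₙ x →L[ℝ] TangentSpace 𝓘ₙ x,
      ∀ x v, J x v = p x (K x (ι x v)) :=
    ⟨fun x => (p x).comp ((K x).comp (ι x)), fun _ _ => rfl⟩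
  have hιJ : ∀ x v, ι x (J x v) = K x (ι x v) := fun x v => by rw [hJ, ← hq, hK1]
  have hdJ : ∀ x u v, α x u = 0 → α.d x u (J x v) = inner ℝ (Ω x (ι x u)) (K x (ι x v)) :=
    fun x u v hu => by rw [hΩ, hpι x u hu, hJ]
  exact ⟨J,
    { continuous := by
        simp only [hJ]
        exact continuous_apply_of_forall hpc (FiberBundle.continuous_proj _ _)
          ((hKc'.comp (FiberBundle.continuous_proj _ _)).clm_apply hιc)
      maps_to := fun x v _ => by
        rw [hJ]
        exact hpk x _
      sq := fun x v hv => by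
        rw [hJ, hιJ, hK2 x _ (hqι x v hv), map_neg, hpι x v hv]
      symm := fun x u v hu hv => by
        rw [hdJ x u v hu, hdJ x v u hv]
        exact hK3 x _ _ (hqι x u hu) (hqι x v hv)
      pos := fun x v hv hv0 => by
        rw [hdJ x v v hv]
        exact hK4 x _ (hqι x v hv) fun h => hv0 (hι x v h) }⟩

/-- A real coordinate space embeds into `ℓ²` as a totally real subspace. -/
theorem exists_real_embedding (N : ℕ) : ∃ L : Euc N →L[ℝ] Hil, ∀ u (i : Fin N), L u (i : ℕ) = (u i : ℂ) := by
  refine ⟨∑ i : Fin N, (EuclideanSpace.proj i : Euc N →L[ℝ] ℝ).smulRight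
    (lp.single 2 (i : ℕ) (1 : ℂ) : Hil), fun u i => ?_⟩
  rw [sum_apply, lp.coeFn_sum, Finset.sum_apply, Finset.sum_eq_single i]
  · simp
  · intro j _ hj
    have : (j : ℕ) ≠ i := fun h => hj (Fin.ext h)
    simp [lp.single_apply, this.symm]
  · simp

/-- The bundle `(ker α, J)` embeds into its complexification, hence into `ℓ²`, by the complex linear
map `v ↦ v - i J v`. -/
theorem IsCompatibleComplexStructure.exists_classifyingMap {α : OneForm n M} (hα : α.IsContact)
    {J : ∀ x : M, TangentSpace (𝓡 (2 * n + 1)) x →L[ℝ] TangentSpace (𝓡 (2 * n + 1)) x}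
    (hJ : IsCompatibleComplexStructure α J) {N : ℕ}
    {ι : ∀ x : M, TangentSpace (𝓡 (2 * n + 1)) x →L[ℝ] Euc N}
    (hιc : Continuous fun v : TangentBundle (𝓡 (2 * n + 1)) M => ι v.1 v.2)
    (hι : ∀ x v, ι x v = 0 → v = 0) :
    ∃ P : C(M, Gr n), IsClassifyingMap α J P := by
  obtain ⟨L, hL⟩ := exists_real_embedding N
  obtain ⟨Φ, hΦ⟩ : ∃ Φ : ∀ x : M, TangentSpace 𝓘ₙ x →L[ℝ] Hil,
      ∀ x v, Φ x v = L (ι x v) - Complex.I • L (ι x (J x v)) :=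
    ⟨fun x => L.comp (ι x) - Complex.I • L.comp ((ι x).comp (J x)), fun _ _ => rfl⟩
  have hΦc : Continuous fun v : TM => Φ v.1 v.2 := by
    simp only [hΦ]
    exact (L.continuous.comp hιc).sub
      ((L.continuous.comp (hιc.comp hJ.continuous)).const_smul Complex.I)
  have hΦJ : ∀ x v, α x v = 0 → Φ x (J x v) = Complex.I • Φ x v := fun x v hv => by
    rw [hΦ, hΦ, hJ.sq x v hv, map_neg, map_neg, smul_neg, sub_neg_eq_add, smul_sub, smul_smul,
      Complex.I_mul_I, neg_one_smul, sub_neg_eq_add, add_comm]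
  have hΦ0 : ∀ x v, α x v = 0 → Φ x v = 0 → v = 0 := fun x v hv h => by
    refine hι x v ?_
    ext i
    rw [hΦ] at h
    have h1 : L (ι x v) (i : ℕ) - Complex.I * L (ι x (J x v)) (i : ℕ) = 0 :=
      congrArg (fun f : Hil => f (i : ℕ)) h
    rw [hL, hL] at h1
    simpa using congrArg Complex.re h1
  have hemb : IsComplexEmbedding α J id Φ :=
    { continuousAt := fun x₀ v => hΦc.continuousAt.comp
        (continuousAt_constField (mem_chart_source _ x₀) continuousAt_id rfl continuousAt_const)
      map_J := hΦJ
      injective := hΦ0 }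
  obtain ⟨P, hP⟩ := hemb.exists_map hα.smooth hα.ne_zero hJ.maps_to continuous_id
  refine ⟨P, Φ, hΦc, fun x => ⟨hΦJ x, ?_⟩⟩
  have hinj : InjOn (Φ x) {v | α x v = 0} := fun v hv w hw h => by
    refine sub_eq_zero.1 (hΦ0 x (v - w) ?_ ?_)
    · rw [map_sub, show α x v = 0 from hv, show α x w = 0 from hw, sub_zero]
    · rw [map_sub, h, sub_self]
  refine ⟨fun v hv => ?_, hinj, fun w hw => ?_⟩
  · have : Φ x v ∈ ((P x).1.range : Set Hil) := by
      rw [hP]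
      exact ⟨v, hv, rfl⟩
    exact this
  · have : w ∈ ((P x).1.range : Set Hil) := hw
    rw [hP] at this
    exact this

/-- The Chern classes of a contact structure on a closed manifold exist. -/
theorem ContactStructure.isChernClass_chernClass [T2Space M] [CompactSpace M]
    (ξ : ContactStructure n M) (k : ℕ) : ξ.IsChernClass k (ξ.chernClass k) := by
  have h : ∃ c, ξ.IsChernClass k c := by
    obtain ⟨α, hα, hξ⟩ := ξ.exists_form
    obtain ⟨N, ι, hιc, hι⟩ := exists_tangent_embedding n M
    obtain ⟨J, hJ⟩ := hα.exists_complexStructure hιc hι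
    obtain ⟨P, hP⟩ := hJ.exists_classifyingMap hα hιc hι
    exact ⟨_, α, ⟨hα, hξ⟩, J, hJ, P, hP, rfl⟩
  rw [ContactStructure.chernClass, dif_pos h]
  exact h.choose_spec

end Existence

/-! ### Vector bundles as fibre scalings -/

/-- The fibrewise multiplication of a vector bundle is a fibre scaling, with the local trivializations
as coordinates. -/
theorem isFibreScaling_totalSpace {X F : Type*} [TopologicalSpace X] [NormedAddCommGroup F]
    [NormedSpace ℝ F] {E : X → Type*} [∀ b, AddCommGroup (E b)] [∀ b, Module ℝ (E b)]
    [∀ b, TopologicalSpace (E b)] [TopologicalSpace (TotalSpace F E)] [FiberBundle F E]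
    [VectorBundle ℝ F E] :
    IsFibreScaling F fun (c : ℝ) (y : TotalSpace F E) => (⟨y.1, c • y.2⟩ : TotalSpace F E) where
  continuous := by
    rw [continuous_iff_continuousAt]
    rintro ⟨c₀, y₀⟩
    let t := trivializationAt F E y₀.1
    have ht : y₀ ∈ t.source := t.mem_source.2 (FiberBundle.mem_baseSet_trivializationAt' y₀.1)
    have hty : ContinuousAt (fun x : ℝ × TotalSpace F E => t x.2) (c₀, y₀) :=
      ContinuousAt.comp (g := t) (t.continuousAt ht) continuousAt_snd
    have hc : ContinuousAt (fun x : ℝ × TotalSpace F E =>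
        t.toOpenPartialHomeomorph.symm ((t x.2).1, x.1 • (t x.2).2)) (c₀, y₀) := by
      refine ContinuousAt.comp (g := t.toOpenPartialHomeomorph.symm)
        (f := fun x : ℝ × TotalSpace F E => ((t x.2).1, x.1 • (t x.2).2))
        (t.toOpenPartialHomeomorph.continuousAt_symm ?_)
        (hty.fst.prodMk (continuousAt_fst.smul hty.snd))
      refine t.mem_target.2 ?_
      rw [t.coe_fst ht]
      exact t.mem_source.1 ht
    refine hc.congr ?_
    filter_upwards [continuousAt_snd.eventually (t.open_source.mem_nhds ht)] with x hx
    have hb : x.2.1 ∈ t.baseSet := t.mem_source.1 hx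
    have h1 : (t x.2).1 = x.2.1 := t.coe_fst hx
    have h2 : t (⟨x.2.1, x.1 • x.2.2⟩ : TotalSpace F E) = ((t x.2).1, x.1 • (t x.2).2) := by
      refine Prod.ext ?_ ?_
      · exact (t.coe_fst (x := ⟨x.2.1, x.1 • x.2.2⟩) (t.mem_source.2 hb)).trans h1.symm
      · exact (t.linear ℝ hb).map_smul x.1 x.2.2
    rw [← h2]
    exact t.left_inv (t.mem_source.2 hb)
  scale_scale c d y := by simp only [smul_smul]
  one_scale y := by simp only [one_smul]
  exists_coordinate y₀ := by
    let t := trivializationAt F E y₀.1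
    have hadd : ∀ y : TotalSpace F E, y.1 ∈ t.baseSet → ∀ w,
        t (⟨y.1, y.2 + t.symm y.1 w⟩ : TotalSpace F E) = (y.1, (t y).2 + w) := fun y hy w => by
      refine Prod.ext (t.coe_fst (t.mem_source.2 hy)) ?_
      refine ((t.linear ℝ hy).map_add y.2 (t.symm y.1 w)).trans ?_
      rw [t.apply_mk_symm hy]
    refine ⟨TotalSpace.proj ⁻¹' t.baseSet, fun y => (t y).2,
      fun y w => ⟨y.1, y.2 + t.symm y.1 w⟩, FiberBundle.mem_baseSet_trivializationAt' y₀.1, ?_⟩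
    exact
    { isOpen := t.open_baseSet.preimage (FiberBundle.continuous_proj F E)
      saturated := fun y y' h hy => by
        have h' := congrArg (TotalSpace.proj (F := F) (E := E)) h
        change y'.1 ∈ t.baseSet
        change y.1 = y'.1 at h'
        rwa [← h']
      continuousOn := by
        rw [← t.source_eq]
        exact continuous_snd.comp_continuousOn t.continuousOn
      continuousOn_add := by
        have h1 : ContinuousOn (fun x : TotalSpace F E × F => (x.1.1, (t x.1).2 + x.2))
            ((TotalSpace.proj ⁻¹' t.baseSet) ×ˢ univ) := by
          have h2 : ContinuousOn (fun x : TotalSpace F E × F => t x.1)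
              ((TotalSpace.proj ⁻¹' t.baseSet) ×ˢ univ) := by
            refine t.continuousOn.comp continuousOn_fst fun x hx => ?_
            rw [t.source_eq]
            exact hx.1
          exact (((FiberBundle.continuous_proj F E).comp continuous_fst).continuousOn).prodMk
            ((continuous_snd.comp_continuousOn h2).add continuousOn_snd)
        refine (t.toOpenPartialHomeomorph.continuousOn_symm.comp h1 fun x hx => ?_).congr
          fun x hx => ?_
        · have hb : x.1.1 ∈ t.baseSet := hx.1
          exact t.mem_target.2 hb
        · rw [Function.comp_apply, ← hadd x.1 hx.1 x.2]
          exact (t.left_inv (x := ⟨x.1.1, x.1.2 + t.symm x.1.1 x.2⟩) (t.mem_source.2 hx.1)).symm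
      coord_scale := fun y hy c => (t.linear ℝ hy).map_smul c y.2
      coord_add := fun y hy w => by rw [hadd y hy w]
      base_add := fun y _ w => by simp only [zero_smul]
      add_zero := fun y hy => by
        have h1 := hadd y hy 0
        rw [add_zero] at h1
        refine t.injOn (x₁ := ⟨y.1, y.2 + t.symm y.1 0⟩) (x₂ := y) (t.mem_source.2 hy)
          (t.mem_source.2 hy) (h1.trans ?_)
        exact Prod.ext (t.coe_fst (x := y) (t.mem_source.2 hy)).symm rfl
      zero_of_coord := fun y hy h => by
        refine t.injOn (x₁ := ⟨y.1, (0 : ℝ) • y.2⟩) (x₂ := y) (t.mem_source.2 hy)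
          (t.mem_source.2 hy) (Prod.ext ?_ ?_)
        · exact (t.coe_fst (x := ⟨y.1, (0 : ℝ) • y.2⟩) (t.mem_source.2 hy)).trans
            (t.coe_fst (x := y) (t.mem_source.2 hy)).symm
        · refine Eq.trans ?_ h.symm
          refine ((t.linear ℝ hy).map_smul 0 y.2).trans ?_
          rw [zero_smul] }

/-- The direct sum of a vector bundle and of a trivial bundle with fibre `G`, over the product of the
base with a space `Z`. -/
theorem IsFibreScaling.prod_vector {Y F Z G : Type*} [TopologicalSpace Y] [NormedAddCommGroup F]
    [NormedSpace ℝ F] [TopologicalSpace Z] [NormedAddCommGroup G] [NormedSpace ℝ G]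
    {scale : ℝ → Y → Y} (h : IsFibreScaling F scale) :
    IsFibreScaling (F × G) fun (c : ℝ) (y : Y × Z × G) => (scale c y.1, y.2.1, c • y.2.2) where
  continuous := (h.continuous.comp (continuous_fst.prodMk continuous_snd.fst)).prodMk
    (continuous_snd.snd.fst.prodMk (continuous_fst.smul continuous_snd.snd.snd))
  scale_scale c d y := by simp only [h.scale_scale, smul_smul]
  one_scale y := by simp only [h.one_scale, one_smul]
  exists_coordinate y₀ := by
    obtain ⟨W, φ, add, hy₀, hW⟩ := h.exists_coordinate y₀.1
    exact ⟨W ×ˢ univ, fun y => (φ y.1, y.2.2), fun y w => (add y.1 w.1, y.2.1, y.2.2 + w.2),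
      ⟨hy₀, trivial⟩,
      { isOpen := hW.isOpen.prod isOpen_univ
        saturated := fun y y' he hy =>
          ⟨hW.saturated _ _ (congrArg (fun z : Y × Z × G => z.1) he) hy.1, trivial⟩
        continuousOn := (hW.continuousOn.comp continuousOn_fst fun y hy => hy.1).prodMk
          continuous_snd.snd.continuousOn
        continuousOn_add := by
          refine (hW.continuousOn_add.comp
            (f := fun x : (Y × Z × G) × F × G => (x.1.1, x.2.1)) (by fun_prop)
            fun x hx => ⟨hx.1.1, trivial⟩).prodMk (Continuous.continuousOn (by fun_prop))
        coord_scale := fun y hy c => Prod.ext (hW.coord_scale _ hy.1 c) rfl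
        coord_add := fun y hy w => Prod.ext (hW.coord_add _ hy.1 w.1) rfl
        base_add := fun y hy w => by
          simp only [hW.base_add _ hy.1, zero_smul]
        add_zero := fun y hy => by
          simp only [Prod.fst_zero, Prod.snd_zero, hW.add_zero _ hy.1, add_zero]
        zero_of_coord := fun y hy h0 => by
          have h1 := hW.zero_of_coord _ hy.1 (congrArg Prod.fst h0)
          have h2 : y.2.2 = 0 := congrArg Prod.snd h0
          simp only [h1, zero_smul]
          exact Prod.ext rfl (Prod.ext rfl h2.symm) }⟩

/-! ### Chern classes of contact structures that agree outside a tube -/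

section Comparison

variable {n : ℕ} {M : Type*} [TopologicalSpace M] [ChartedSpace (Euc (2 * n + 1)) M]
  [IsManifold (𝓡 (2 * n + 1)) ∞ M]

theorem pullback_comp {X Y Z : Type*} [TopologicalSpace X] [TopologicalSpace Y]
    [TopologicalSpace Z] (g : C(Y, Z)) (f : C(X, Y)) (m : ℕ) (x : Cohomology Z m) :
    pullback (g.comp f) m x = pullback f m (pullback g m x) := by
  obtain ⟨a, rfl⟩ := QuotientAddGroup.mk_surjective x
  rfl

theorem ContactStructure.eventually_agree {ξ ξ' : ContactStructure n M} {x : M}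
    (hx : x ∉ closure (ξ.diffSet ξ')) :
    ∀ᶠ y in 𝓝 x, ξ.hyperplane y = ξ'.hyperplane y ∧ ξ.positive y = ξ'.positive y := by
  filter_upwards [isClosed_closure.isOpen_compl.mem_nhds hx] with y hy
  exact not_not.1 fun h => hy (subset_closure h)

/-- Chern classes agree in the degrees in which the restriction of cohomology to a set where the
contact structures agree is injective. -/
theorem ContactStructure.chernClass_eq_of_compressible [T2Space M] [CompactSpace M]
    {ξ ξ' : ContactStructure n M} {A : Set M} (hA : ∀ x ∈ A, x ∉ closure (ξ.diffSet ξ')) {k : ℕ}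
    (hc : ∀ i ≤ 2 * k, Compressible A i) : ξ.chernClass k = ξ'.chernClass k := by
  obtain ⟨α, ⟨hα, hξ⟩, J, hJ, P, hP, hc₁⟩ := ξ.isChernClass_chernClass k
  obtain ⟨α', ⟨hα', hξ'⟩, J', hJ', P', hP', hc₂⟩ := ξ'.isChernClass_chernClass k
  have hhom : (P.comp (inclusionMap A)).Homotopic (P'.comp (inclusionMap A)) := by
    refine homotopic_of_agree hα hα' hJ hJ' hP hP' (inclusionMap A) fun y => ?_
    filter_upwards [ContactStructure.eventually_agree (hA y.1 y.2)] with x hx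
    exact ⟨((hξ x).1.symm.trans hx.1).trans (hξ' x).1, ((hξ x).2.symm.trans hx.2).trans (hξ' x).2⟩
  refine pullback_inclusionMap_injective hc ?_
  rw [← hc₁, ← hc₂, ← pullback_comp, ← pullback_comp, pullback_eq_of_homotopic hhom]

/-- If two contact structures differ only in a tube of codimension larger than `2k`, then their
`k`-th Chern classes agree. -/
theorem ContactStructure.chernClass_eq_of_tube [T2Space M] [CompactSpace M]
    {ξ ξ' : ContactStructure n M} {F Y : Type*} [NormedAddCommGroup F] [NormedSpace ℝ F]
    [FiniteDimensional ℝ F] [TopologicalSpace Y] {scale : ℝ → Y → Y} (h : IsFibreScaling F scale)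
    {e : Y → M} (he : IsOpenEmbedding e) (hdiff : closure (ξ.diffSet ξ') ⊆ range e) {k : ℕ}
    (hk : 2 * k < Module.finrank ℝ F) : ξ.chernClass k = ξ'.chernClass k := by
  have hK : IsCompact (e ⁻¹' closure (ξ.diffSet ξ')) :=
    (he.isInducing.isCompact_preimage_iff hdiff).2 isClosed_closure.isCompact
  refine ContactStructure.chernClass_eq_of_compressible
    (A := (e '' ((fun x : ℝ × Y => scale x.1 x.2) ''
      (Icc 0 1 ×ˢ (e ⁻¹' closure (ξ.diffSet ξ')))))ᶜ) (fun x hx hxc => hx ?_) fun i hi =>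
    compressible_compl_image h he (h.isCompact_hull hK) ?_ (hi.trans_lt hk)
  · obtain ⟨y, rfl⟩ := hdiff hxc
    exact ⟨y, ⟨(1, y), ⟨⟨zero_le_one, le_rfl⟩, hxc⟩, h.one_scale y⟩, rfl⟩
  · rintro _ ⟨⟨t, y⟩, ⟨ht, hy⟩, rfl⟩ c hc
    exact ⟨(c * t, y), ⟨⟨mul_nonneg hc.1 ht.1, mul_le_one₀ hc.2 ht.1 ht.2⟩, hy⟩,
      (h.scale_scale c t y).symm⟩

theorem ContactStructure.eq_of_diffSet_eq_empty {ξ ξ' : ContactStructure n M}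
    (h : ξ.diffSet ξ' = ∅) : ξ = ξ' := by
  have hx : ∀ x, ξ.hyperplane x = ξ'.hyperplane x ∧ ξ.positive x = ξ'.positive x := fun x =>
    not_not.1 fun hx => (h ▸ (show x ∈ ξ.diffSet ξ' from hx) : x ∈ (∅ : Set M))
  exact ContactStructure.ext (funext fun x => (hx x).1) (funext fun x => (hx x).2)

theorem isOpenEmbedding_of_isLocalDiffeomorph {V W H H' X Y : Type*} [NormedAddCommGroup V]
    [NormedSpace ℝ V] [NormedAddCommGroup W] [NormedSpace ℝ W] [TopologicalSpace H]
    [TopologicalSpace H'] [TopologicalSpace X] [TopologicalSpace Y] [ChartedSpace H X]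
    [ChartedSpace H' Y] {I : ModelWithCorners ℝ V H} {I' : ModelWithCorners ℝ W H'} {e : X → Y}
    (hinj : Function.Injective e) (he : IsLocalDiffeomorph I I' ∞ e) : IsOpenEmbedding e :=
  IsOpenEmbedding.of_continuous_injective_isOpenMap he.contMDiff.continuous hinj he.isOpenMap

theorem finrank_dual_euc (m : ℕ) : Module.finrank ℝ (Euc m →L[ℝ] ℝ) = m := by
  let D : (Euc m →ₗ[ℝ] ℝ) ≃ₗ[ℝ] (Euc m →L[ℝ] ℝ) := LinearMap.toContinuousLinearMap
  rw [← D.finrank_eq, Module.finrank_linearMap, finrank_euclideanSpace_fin, Module.finrank_self,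
    mul_one]

omit [IsManifold (𝓡 (2 * n + 1)) ∞ M] in
/-- The fibre of a tubular neighborhood of `B × S¹` has dimension `n + 1`. -/
theorem IsTubularNeighborhood.finrank_fibre (hn : 1 < n)
    {B : Type*} [TopologicalSpace B] [ChartedSpace (Euc (n - 1)) B] [IsManifold (𝓡 (n - 1)) ∞ B]
    {F : Type*} [NormedAddCommGroup F] [NormedSpace ℝ F]
    {E : B × Circle → Type*} [∀ b, AddCommGroup (E b)] [∀ b, Module ℝ (E b)]
    [∀ b, TopologicalSpace (E b)] [TopologicalSpace (TotalSpace F E)] [FiberBundle F E]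
    [VectorBundle ℝ F E] [ContMDiffVectorBundle ∞ F E ((𝓡 (n - 1)).prod (𝓡 1))]
    {ψ : B × Circle → M} {τ : TotalSpace F E → M} (hτ : IsTubularNeighborhood (n := n) ψ τ)
    (y : TotalSpace F E) : FiniteDimensional ℝ F ∧ Module.finrank ℝ F = n + 1 := by
  let D : ((Euc (n - 1) × Euc 1) × F) ≃L[ℝ] Euc (2 * n + 1) :=
    (hτ.isLocalDiffeomorph y).mfderivToContinuousLinearEquiv (by simp)
  have : FiniteDimensional ℝ ((Euc (n - 1) × Euc 1) × F) :=
    D.symm.toLinearEquiv.finiteDimensional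
  have hF : FiniteDimensional ℝ F :=
    FiniteDimensional.of_surjective (LinearMap.snd ℝ (Euc (n - 1) × Euc 1) F)
      LinearMap.snd_surjective
  refine ⟨hF, ?_⟩
  have h1 := D.toLinearEquiv.finrank_eq
  rw [Module.finrank_prod, Module.finrank_prod, finrank_euclideanSpace_fin,
    finrank_euclideanSpace_fin, finrank_euclideanSpace_fin] at h1
  omega

end Comparison

end ContactChern

end

theorem proposition5p2 {n : ℕ} (hn : 1 < n)
    {M : Type*} [TopologicalSpace M] [T2Space M] [CompactSpace M]
    [ChartedSpace (Euc (2 * n + 1)) M] [IsManifold (𝓡 (2 * n + 1)) ∞ M]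
    {B : Type*} [TopologicalSpace B] [ChartedSpace (Euc (n - 1)) B] [IsManifold (𝓡 (n - 1)) ∞ B]
    (ξ : ContactStructure n M) (ψ : B × Circle → M) (hψ : IsEmbeddedIsotropicFamily ξ ψ) :
    (∀ (F : Type*) [NormedAddCommGroup F] [NormedSpace ℝ F]
      (E : B × Circle → Type*) [∀ b, AddCommGroup (E b)] [∀ b, Module ℝ (E b)]
      [∀ b, TopologicalSpace (E b)] [TopologicalSpace (TotalSpace F E)] [FiberBundle F E]
      [VectorBundle ℝ F E] [ContMDiffVectorBundle ∞ F E ((𝓡 (n - 1)).prod (𝓡 1))]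
      (τ : TotalSpace F E → M), IsTubularNeighborhood (n := n) ψ τ →
      ∀ ξ' : ContactStructure n M, closure (ξ.diffSet ξ') ⊆ range τ →
        ∀ k : ℕ, (k : ℝ) < (n + 1) / 2 → ξ.chernClass k = ξ'.chernClass k) ∧
    (∀ ξ' : ContactStructure n M, IsLutzTwist ψ ξ ξ' → ξ.chernClass 1 = ξ'.chernClass 1) := by
  refine ⟨?_, ?_⟩
  · intro F _ _ E _ _ _ _ _ _ _ τ hτ ξ' hdiff k hk
    rcases (ξ.diffSet ξ').eq_empty_or_nonempty with h0 | ⟨x, hx⟩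
    · rw [ContactStructure.eq_of_diffSet_eq_empty h0]
    obtain ⟨y, -⟩ := hdiff (subset_closure hx)
    obtain ⟨hF, hdim⟩ := hτ.finrank_fibre hn y
    refine ContactStructure.chernClass_eq_of_tube (isFibreScaling_totalSpace (F := F) (E := E))
      (isOpenEmbedding_of_isLocalDiffeomorph hτ.injective hτ.isLocalDiffeomorph) hdiff ?_
    rw [hdim]
    have : (2 * k : ℝ) < n + 1 := by linarith
    exact_mod_cast this
  · rintro ξ' ⟨e, N, N', b, k, l, hinj, he, -, -, -, -, -, -, hdiff, -⟩
    refine ContactStructure.chernClass_eq_of_tube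
      ((isFibreScaling_totalSpace (F := Euc (n - 1) →L[ℝ] ℝ)
        (E := fun p : B => TangentSpace (𝓡 (n - 1)) p →L[ℝ] Bundle.Trivial B ℝ p)).prod_vector
          (Z := Circle) (G := ℂ))
      (isOpenEmbedding_of_isLocalDiffeomorph hinj he) (hdiff.trans (image_subset_range _ _)) ?_
    rw [Module.finrank_prod, finrank_dual_euc, Complex.finrank_real_complex]
    omega
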